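/- Let $d\ge 2$ and let $\Omega\subset\mathbb R^d$ be a bounded Lipschitz domain (bounded, open, connected, locally the region above a Lipschitz graph), with surface measure $ds$ on $\partial\Omega$ and outer unit normal $\boldsymbol\nu$, which exists $ds$-almost everywhere. Let $\varepsilon>0$ and let $T_t:\Omega\to\Omega_t=T_t(\Omega)$, $|t|<\varepsilon$, be bi-Lipschitz homeomorphisms with $T_0=I$. Assume that $\{T_t\}$ is twice differentiable: $t\mapsto T_tx$ is $C^2$ for every $x\in\Omega$, and the Jacobi matrices in $x$ of $\partial_tT_t$ and $\partial_t^2T_t$ (defined almost everywhere) are bounded uniformly in $t$, that is, $\partial_tT_t$ and $\partial_t^2T_t$ are Lipschitz continuous on $\Omega$ uniformly in $t$. Let $$S=\frac{\partial T_t}{\partial t}\Big|_{t=0},\qquad R=\frac{\partial^2T_t}{\partial t^2}\Big|_{t=0},$$ extended continuously to $\overline\Omega$ as Lipschitz vector fields, and put $\delta\rho=S\cdot\boldsymbol\nu$, $\delta^2\rho=R\cdot\boldsymbol\nu$ on $\partial\Omega$. Let $Q=\bigcup_{|t|<\varepsilon}\Omega_t\times\{t\}\subset\mathbb R^{d+1}$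 and let $c=c(x,t)\in C^{1,1}(\overline Q)$, i.e. $c$ is continuous on $\overline Q$ and differentiable in $Q$, and its derivative in $(x,t)$ is Lipschitz continuous on $Q$ (and so extends to $\overline Q$). Assume that $c_{tt}$ exists in $Q$ and is continuous on $\overline Q$ (extends continuously to $\overline Q$). Write $c_0=c(\cdot,0)$, $\dot c=c_t(\cdot,0)$, $\ddot c=c_{tt}(\cdot,0)$. Since $S$ is only Lipschitz, its Jacobi matrix on $\partial\Omega$ is understood as follows. A boundary Jacobian of $S$ is a field $A\in L^\infty(\partial\Omega;\mathbb R^{d\times d})$ such that, for almost every $x\in\partial\Omega$, $S(y)=S(x)+A(x)(y-x)+o(|y-x|)$ as $y\to x$, $y\in\partial\Omega$ (so $A$ is prescribed in tangential directions only; $A=DS$ is allowed if $S$ is $C^1$ up to the boundary). With $A$ in place of $DS$, put on $\partial\Omega$ $$\nabla\cdot(c_0S)=S\cdot\nabla c_0+c_0\,\mathrm{tr}\,A,\qquad (S\cdot\nabla)S=A\,S.$$ Then boundary Jacobians of $S$ exist, and for each of them the following holds. For all $t$ near $0$, $c(\cdot,t)$ is integrable on $\Omega_t$ and $I(t)=\int_{\Omega_t}c(x,t)\,dx$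 is differentiable at $t$; $I'$ is differentiable at $t=0$; the integrands below are integrable; and $$\frac{d^2}{dt^2}\int_{\Omega_t}c\,dx\,\Big|_{t=0}=\int_\Omega\ddot c\,dx+\int_{\partial\Omega}\bigl(2\dot c+\nabla\cdot(c_0S)\bigr)\,\delta\rho\,ds+\int_{\partial\Omega}c_0\,\bigl(\delta^2\rho-[(S\cdot\nabla)S]\cdot\boldsymbol\nu\bigr)\,ds .$$ -/

import Mathlib

open Set Filter Topology MeasureTheory
open scoped NNReal RealInnerProductSpace

namespace Liouville

noncomputable section

/-- The Euclidean space `ℝ^d`. -/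
abbrev Space (d : ℕ) : Type := EuclideanSpace ℝ (Fin d)

/-- A bounded Lipschitz domain: a nonempty, bounded, connected open set which, near every boundary
point and in a suitable orthonormal frame with last vector `e`, is the region above the graph of a
Lipschitz function. Here `y - ⟪e, y⟫ • e` is the orthogonal projection of `y` to the hyperplane
orthogonal to `e`; only the values of `f` on that hyperplane matter. -/
structure IsBoundedLipschitzDomain {d : ℕ} (Ω : Set (Space d)) : Prop where
  isOpen : IsOpen Ω
  isConnected : IsConnected Ω
  isBounded : Bornology.IsBounded Ω
  exists_graph : ∀ x₀ ∈ frontier Ω, ∃ (e : Space d) (f : Space d → ℝ) (K : ℝ≥0),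
    ‖e‖ = 1 ∧ LipschitzWith K f ∧ ∀ᶠ y in 𝓝 x₀, (y ∈ Ω ↔ f (y - ⟪e, y⟫ • e) < ⟪e, y⟫)

/-- The surface measure `ds` of `∂Ω`: the `(d-1)`-dimensional Hausdorff measure, normalised so that
it is Lebesgue measure on isometric copies of `ℝ^(d-1)`, restricted to `∂Ω`. -/
def surfaceMeasure {d : ℕ} (Ω : Set (Space d)) : Measure (Space d) :=
  (Measure.euclideanHausdorffMeasure (d - 1)).restrict (frontier Ω)

/-- `n` is the outer unit normal of `Ω` at `x`: for every `η > 0`, near `x`, the set `Ω` contains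
the cone `⟪y - x, n⟫ < -η ‖y - x‖` and misses the cone `⟪y - x, n⟫ > η ‖y - x‖`. Such an `n` is
unique. For the region above a graph it exists exactly where the graph function is
differentiable. -/
def IsOuterUnitNormal {d : ℕ} (Ω : Set (Space d)) (x n : Space d) : Prop :=
  ‖n‖ = 1 ∧ ∀ η : ℝ, 0 < η → ∀ᶠ y in 𝓝 x,
    (⟪y - x, n⟫ < -(η * ‖y - x‖) → y ∈ Ω) ∧ (η * ‖y - x‖ < ⟪y - x, n⟫ → y ∉ Ω)

open Classical in
/-- The outer unit normal `ν` of `Ω` (and `0` where there is none). -/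
def outerNormal {d : ℕ} (Ω : Set (Space d)) (x : Space d) : Space d :=
  if h : ∃ n, IsOuterUnitNormal Ω x n then h.choose else 0

/-- `{T_t}`, `|t| < ε`, is a twice differentiable family of bi-Lipschitz deformations of `Ω` with
`T_0 = I`. That the Jacobi matrices `∂_t DT_t` and `∂_t² DT_t`, which exist almost everywhere, are
uniformly bounded is the same as the uniform Lipschitz continuity in `x` of `∂_t T_t` and
`∂_t² T_t`. The boundedness of `∂_t (DT_t)⁻¹` and `∂_t² (DT_t)⁻¹` follows for small `|t|`, because
`DT_t → I` uniformly, and is therefore not listed. -/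
structure IsTwiceDifferentiableFamily {d : ℕ} (Ω : Set (Space d)) (ε : ℝ)
    (T : ℝ → Space d → Space d) : Prop where
  zero_eq : ∀ x ∈ Ω, T 0 x = x
  biLipschitz : ∀ t ∈ Ioo (-ε) ε, ∃ K K' : ℝ≥0, LipschitzOnWith K (T t) Ω ∧
    ∀ x ∈ Ω, ∀ y ∈ Ω, dist x y ≤ K' * dist (T t x) (T t y)
  contDiffOn : ∀ x ∈ Ω, ContDiffOn ℝ 2 (fun t => T t x) (Ioo (-ε) ε)
  bounded_jacobian_deriv : ∃ M : ℝ≥0, ∀ t ∈ Ioo (-ε) ε,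
    LipschitzOnWith M (fun x => deriv (fun s => T s x) t) Ω
  bounded_jacobian_deriv_two : ∃ M : ℝ≥0, ∀ t ∈ Ioo (-ε) ε,
    LipschitzOnWith M (fun x => iteratedDeriv 2 (fun s => T s x) t) Ω

/-- The vector field `S = ∂_t T_t` at `t = 0`, extended continuously from `Ω` to its closure. -/
def velocity {d : ℕ} (Ω : Set (Space d)) (T : ℝ → Space d → Space d) : Space d → Space d :=
  extendFrom Ω (fun x => deriv (fun t => T t x) 0)

/-- The vector field `R = ∂_t² T_t` at `t = 0`, extended continuously from `Ω` to its closure. -/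
def acceleration {d : ℕ} (Ω : Set (Space d)) (T : ℝ → Space d → Space d) : Space d → Space d :=
  extendFrom Ω (fun x => iteratedDeriv 2 (fun t => T t x) 0)

/-- `δρ = S · ν` on `∂Ω`. -/
def deltaRho {d : ℕ} (Ω : Set (Space d)) (T : ℝ → Space d → Space d) (x : Space d) : ℝ :=
  ⟪velocity Ω T x, outerNormal Ω x⟫

/-- `δ²ρ = R · ν` on `∂Ω`. -/
def deltaSqRho {d : ℕ} (Ω : Set (Space d)) (T : ℝ → Space d → Space d) (x : Space d) : ℝ :=
  ⟪acceleration Ω T x, outerNormal Ω x⟫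

/-- The non-cylindrical domain `Q = ⋃_{|t| < ε} Ω_t × {t}`, where `Ω_t = T_t(Ω)`. -/
def spaceTime {d : ℕ} (Ω : Set (Space d)) (ε : ℝ) (T : ℝ → Space d → Space d) :
    Set (Space d × ℝ) :=
  {z | z.2 ∈ Ioo (-ε) ε ∧ z.1 ∈ T z.2 '' Ω}

/-- `c ∈ C^{1,1}(Q̄)`: `c` is continuous on `Q̄`, differentiable in `Q`, and its derivative in
`(x, t)` is Lipschitz continuous on `Q` (hence extends to a Lipschitz function on `Q̄`). -/
def IsC11 {d : ℕ} (Q : Set (Space d × ℝ)) (c : Space d × ℝ → ℝ) : Prop :=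
  ContinuousOn c (closure Q) ∧ (∀ z ∈ Q, DifferentiableAt ℝ c z) ∧
    ∃ K : ℝ≥0, LipschitzOnWith K (fderiv ℝ c) Q

/-- `c_tt` exists in `Q` and is continuous on `Q̄` (i.e. has a continuous extension to `Q̄`). -/
def HasContinuousTimeDerivTwo {d : ℕ} (Q : Set (Space d × ℝ)) (c : Space d × ℝ → ℝ) : Prop :=
  ∃ g : Space d × ℝ → ℝ, ContinuousOn g (closure Q) ∧
    ∀ z ∈ Q, HasDerivAt (deriv fun s => c (z.1, s)) (g z) z.2

/-- `ċ = c_t(·, 0)`, on the closure of `Ω`, where `c_t` is extended continuously from `Q`. -/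
def timeDeriv {d : ℕ} (Q : Set (Space d × ℝ)) (c : Space d × ℝ → ℝ) (x : Space d) : ℝ :=
  extendFrom Q (fderiv ℝ c) (x, 0) (0, 1)

/-- `v · ∇c₀`, with `c₀ = c(·, 0)`, at a point `x` of the closure of `Ω`, where `∇c` is extended
continuously from `Q`. -/
def spaceDeriv {d : ℕ} (Q : Set (Space d × ℝ)) (c : Space d × ℝ → ℝ) (x v : Space d) : ℝ :=
  extendFrom Q (fderiv ℝ c) (x, 0) (v, 0)

/-- `c̈ = c_tt(·, 0)` in `Ω`. -/
def timeDerivTwo {d : ℕ} (c : Space d × ℝ → ℝ) (x : Space d) : ℝ :=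
  iteratedDeriv 2 (fun s => c (x, s)) 0

/-- `A` is a version on `∂Ω` of the Jacobi matrix `DS` of a Lipschitz vector field `S`: it is in
`L^∞(∂Ω)`, and at almost every `x ∈ ∂Ω`
`S(y) = S(x) + A(x) (y - x) + o(|y - x|)` as `y → x` in `∂Ω`.
This determines `A(x)` on the tangent space of `∂Ω` and leaves its values on `ν(x)` free; if `S` is
differentiable at `x`, or only differentiable at `x` from within the closure of `Ω`, then
`A(x) = DS(x)` is allowed. -/
structure IsBoundaryJacobian {d : ℕ} (Ω : Set (Space d)) (S : Space d → Space d)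
    (A : Space d → Space d →L[ℝ] Space d) : Prop where
  memLp : MemLp A ⊤ (surfaceMeasure Ω)
  hasFDerivWithinAt : ∀ᵐ x ∂(surfaceMeasure Ω), HasFDerivWithinAt S (A x) (frontier Ω) x

/-- `∇ · (c₀ S) = S · ∇c₀ + c₀ ∇ · S` on `∂Ω`, where `A` stands for `DS`. -/
def divProduct {d : ℕ} (Q : Set (Space d × ℝ)) (c : Space d × ℝ → ℝ) (S : Space d → Space d)
    (A : Space d → Space d →L[ℝ] Space d) (x : Space d) : ℝ :=
  spaceDeriv Q c x (S x) + c (x, 0) * LinearMap.trace ℝ (Space d) (A x : Space d →ₗ[ℝ] Space d)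

/-- `[(S · ∇)S] · ν` on `∂Ω`, where `A` stands for `DS`. -/
def convectiveNormal {d : ℕ} (Ω : Set (Space d)) (S : Space d → Space d)
    (A : Space d → Space d →L[ℝ] Space d) (x : Space d) : ℝ :=
  ⟪A x (S x), outerNormal Ω x⟫

/-- `I(t) = ∫_{Ω_t} c(x, t) dx`. -/
def volumeIntegral {d : ℕ} (Ω : Set (Space d)) (T : ℝ → Space d → Space d)
    (c : Space d × ℝ → ℝ) (t : ℝ) : ℝ :=
  ∫ x in T t '' Ω, c (x, t)

end

end Liouville

/-!
The starting point is that the determinant is a null Lagrangian: for Lipschitz maps `T` and `W` of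
the whole space, `W` with compact support, the integral of the first variation
`detDeriv (DT) (DW)` of `det DT` in the direction `DW` vanishes (`integral_detDeriv_eq_zero`). No
smoothness is needed. For large `s`, both `s + T` and `s + T + W` are homeomorphisms which agree
off the support of `W`, so they map this support to sets of the same volume; since `det (s + DT)`
is a polynomial in `s`, the resulting identity persists at `s = 0`.

Applied above a Lipschitz graph, after flattening the graph and extending the data below it, this
gives for a bounded Lipschitz domain `Ω`

  `∫_Ω detDeriv (DT) (DW) = ∫_∂Ω detDeriv A (W ⊗ ν)`

(`setIntegral_detDeriv_eq_surface`), where `A` is any boundary Jacobian of `T`. Only tangential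
derivatives of `T` enter on the right, since `detDeriv A (W ⊗ ν)` does not see the values of `A`
on `ν`. This needs the area formula for Lipschitz graphs (`Frame.restrict_range_graphMap`), the
normal in a chart (`IsChart.ae_outerNormal`) and a partition of unity. By Rademacher's theorem
along the graphs, Lipschitz fields have boundary Jacobians (`exists_boundaryJacobian`), with a
bound proportional to the Lipschitz constant.

Now extend the family `T t` and its velocity to the whole space as
`Θ t = id + t V 0 + E t` and `V t`, where `E t` has Lipschitz constant `O(t²)`
(`IsTwiceDifferentiableFamily.exists_extension`). A change of variables gives
`I(t) = ∫_Ω c(Θ t, t) det DΘ t`, which is differentiated under the integral. As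
`det DΘ · (∇c)(Θ) · V + c(Θ) detDeriv (DΘ) (DV) = detDeriv (DΘ) (D(c(Θ) V))`, the surface formula
yields, for all small `t`,

  `I'(t) = ∫_Ω c_t(Θ t, t) det DΘ t + ∫_∂Ω detDeriv (1 + t A + P t) (c(Θ t, t) V t ⊗ ν)`,

where `A` is a boundary Jacobian of `S = V 0` and `P t = O(t²)` one of `E t`
(`IsDensityExtension.hasDerivAt_volumeIntegral`, `IsDensityExtension.setIntegral_deriv_eq`). The
second time derivative of the volume element never occurs, and `P t` does not contribute to the
derivative at `t = 0`. The interior term has the derivative `∫_Ω c_tt + ∫_∂Ω c_t S · ν`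
(`IsDensityExtension.hasDerivAt_setIntegral_time`). The expansion

  `detDeriv (1 + t A + O(t²)) (w ⊗ ν) = w · ν + t (tr A (w · ν) - A w · ν) + O(t²)`

(`exists_abs_detDeriv_rankOne_sub_le`) gives the derivative of the boundary term
(`IsDensityExtension.hasDerivAt_surface`), and the sum of the two is the asserted formula.
-/

namespace Liouville

noncomputable section

set_option linter.unusedSectionVars false

/-! ### The determinant and its derivative -/

section Determinant

open InnerProductSpace (rankOne)

variable {E : Type*} [NormedAddCommGroup E] [InnerProductSpace ℝ E] [FiniteDimensional ℝ E]

theorem contDiff_det {n : WithTop ℕ∞} : ContDiff ℝ n (fun A : E →L[ℝ] E => A.det) := by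
  classical
  let b := stdOrthonormalBasis ℝ E
  have h : (fun A : E →L[ℝ] E => A.det) = fun A : E →L[ℝ] E =>
      ∑ σ : Equiv.Perm (Fin (Module.finrank ℝ E)),
        (Equiv.Perm.sign σ : ℝ) * ∏ i, ⟪b (σ i), A (b i)⟫ := by
    ext A
    rw [ContinuousLinearMap.det, ← LinearMap.det_toMatrix b.toBasis, Matrix.det_apply]
    refine Finset.sum_congr rfl fun σ _ => ?_
    rw [Units.smul_def, zsmul_eq_mul]
    simp [LinearMap.toMatrix_apply, OrthonormalBasis.repr_apply_apply]
  rw [h]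
  refine ContDiff.sum fun σ _ => contDiff_const.mul (contDiff_prod fun i _ => ?_)
  exact contDiff_const.inner ℝ
    ((ContinuousLinearMap.apply ℝ E (b i)).contDiff)

theorem continuous_det : Continuous (fun A : E →L[ℝ] E => A.det) :=
  (contDiff_det (n := 0)).continuous

theorem det_mul (A B : E →L[ℝ] E) : (A ∘L B).det = A.det * B.det := by
  simp [ContinuousLinearMap.det, LinearMap.det_comp]

theorem det_one_add_rankOne (w n : E) :
    (1 + rankOne ℝ w n : E →L[ℝ] E).det = 1 + ⟪n, w⟫ := by
  have := LinearMap.transvection.det (innerSL ℝ n : E →L[ℝ] ℝ).toLinearMap w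
  simp only [ContinuousLinearMap.coe_coe, innerSL_apply_apply] at this
  rw [← this, ContinuousLinearMap.det]
  congr 1

/-- Along a multiple of the identity the determinant is a polynomial, monic of degree `dim E`. -/
theorem det_smul_one_add (A : E →L[ℝ] E) (s : ℝ) :
    (s • (1 : E →L[ℝ] E) + A).det = (LinearMap.charpoly (-(A : E →ₗ[ℝ] E))).eval s := by
  rw [LinearMap.eval_charpoly, ContinuousLinearMap.det]
  congr 1
  ext v
  simp

theorem eventually_det_smul_one_add_ne_zero (A : E →L[ℝ] E) :
    ∀ᶠ s in 𝓝[≠] (0 : ℝ), (s • (1 : E →L[ℝ] E) + A).det ≠ 0 := by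
  have hfin := (LinearMap.charpoly (-(A : E →ₗ[ℝ] E))).rootSet_finite ℝ
  have : {s : ℝ | (s • (1 : E →L[ℝ] E) + A).det = 0}.Finite := by
    refine hfin.subset fun s hs => ?_
    rw [Polynomial.mem_rootSet]
    refine ⟨(LinearMap.charpoly_monic _).ne_zero, ?_⟩
    rw [mem_ofPred_eq, det_smul_one_add] at hs
    simpa [Polynomial.aeval_def] using hs
  have h2 : ({s : ℝ | (s • (1 : E →L[ℝ] E) + A).det = 0} \ {0})ᶜ ∈ 𝓝 (0 : ℝ) :=
    (this.subset sdiff_subset).isClosed.isOpen_compl.mem_nhds (by simp)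
  rw [eventually_nhdsWithin_iff]
  filter_upwards [h2] with s hs hs0 hs1
  exact hs ⟨hs1, hs0⟩

/-- The determinant is affine along operators of rank one. -/
theorem det_add_smul_rankOne (B : E →L[ℝ] E) (w n : E) (τ : ℝ) :
    (B + τ • rankOne ℝ w n).det = B.det + τ * ((B + rankOne ℝ w n).det - B.det) := by
  set R : E →L[ℝ] E := rankOne ℝ w n
  -- both sides are continuous in `B`, and invertible operators are dense
  let q : ℝ → ℝ := fun s => ((s • (1 : E →L[ℝ] E) + B) + τ • R).det
    - (s • (1 : E →L[ℝ] E) + B).det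
    - τ * (((s • (1 : E →L[ℝ] E) + B) + R).det - (s • (1 : E →L[ℝ] E) + B).det)
  have hq : Continuous q := by
    have h1 : Continuous fun s : ℝ => s • (1 : E →L[ℝ] E) + B := by fun_prop
    have c := continuous_det (E := E)
    exact ((c.comp (h1.add continuous_const)).sub (c.comp h1)).sub
      (continuous_const.mul ((c.comp (h1.add continuous_const)).sub (c.comp h1)))
  have hz : ∀ᶠ s in 𝓝[≠] (0 : ℝ), q s = 0 := by
    filter_upwards [eventually_det_smul_one_add_ne_zero B] with s hs
    set X := s • (1 : E →L[ℝ] E) + B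
    obtain ⟨v, hv⟩ : ∃ v, X v = w := by
      have : LinearMap.ker (X : E →ₗ[ℝ] E) = ⊥ := by
        by_contra hne
        exact hs (LinearMap.det_eq_zero_iff_ker_ne_bot.2 hne)
      exact LinearMap.surjective_of_injective (LinearMap.ker_eq_bot.1 this) w
    have key : ∀ r : ℝ, (X + r • R).det = X.det * (1 + r * ⟪n, v⟫) := by
      intro r
      have : X + r • R = X ∘L (1 + rankOne ℝ (r • v) n) := by
        ext x
        simp [R, hv, smul_smul]
      rw [this, det_mul, det_one_add_rankOne, inner_smul_right]
    have k1 := key 1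
    rw [one_smul] at k1
    simp only [q]
    rw [key τ, k1]
    ring
  have h0 : q 0 = 0 := by
    have t1 : Tendsto q (𝓝[≠] 0) (𝓝 (q 0)) := hq.continuousAt.mono_left nhdsWithin_le_nhds
    have t2 : Tendsto q (𝓝[≠] 0) (𝓝 0) :=
      tendsto_const_nhds.congr' (hz.mono fun s hs => hs.symm)
    exact tendsto_nhds_unique t1 t2
  simp only [q, zero_smul, zero_add] at h0
  linarith

/-- The derivative of the determinant at `B` in the direction `C`, that is `tr (adj(B) C)`. -/
def detDeriv (B C : E →L[ℝ] E) : ℝ := fderiv ℝ (fun A : E →L[ℝ] E => A.det) B C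

theorem hasDerivAt_det_line (B C : E →L[ℝ] E) :
    HasDerivAt (fun τ : ℝ => (B + τ • C).det) (detDeriv B C) 0 := by
  have h1 : HasFDerivAt (fun A : E →L[ℝ] E => A.det)
      (fderiv ℝ (fun A : E →L[ℝ] E => A.det) B) B :=
    ((contDiff_det (n := 1)).differentiable (by norm_num) B).hasFDerivAt
  have h2 : HasDerivAt (fun τ : ℝ => B + τ • C) C 0 := by
    simpa using ((hasDerivAt_id (0 : ℝ)).smul_const C).const_add B
  have h3 : HasFDerivAt (fun A : E →L[ℝ] E => A.det)
      (fderiv ℝ (fun A : E →L[ℝ] E => A.det) B) (B + (0 : ℝ) • C) := by simpa using h1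
  exact h3.comp_hasDerivAt 0 h2

theorem detDeriv_eq_of_line {B C : E →L[ℝ] E} {a b : ℝ}
    (h : ∀ τ : ℝ, (B + τ • C).det = a + τ * b) : detDeriv B C = b := by
  have h1 := hasDerivAt_det_line B C
  have h2 : HasDerivAt (fun τ : ℝ => (B + τ • C).det) b 0 := by
    simp_rw [h]
    simpa using ((hasDerivAt_id (0 : ℝ)).mul_const b).const_add a
  exact h1.unique h2

theorem detDeriv_rankOne (B : E →L[ℝ] E) (w n : E) :
    detDeriv B (rankOne ℝ w n) = (B + rankOne ℝ w n).det - B.det :=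
  detDeriv_eq_of_line (a := B.det) fun τ => by rw [det_add_smul_rankOne]

theorem detDeriv_add (B C D : E →L[ℝ] E) : detDeriv B (C + D) = detDeriv B C + detDeriv B D :=
  map_add _ _ _

theorem detDeriv_sub (B C D : E →L[ℝ] E) : detDeriv B (C - D) = detDeriv B C - detDeriv B D :=
  map_sub _ _ _

theorem detDeriv_smul (B C : E →L[ℝ] E) (r : ℝ) : detDeriv B (r • C) = r * detDeriv B C :=
  map_smul _ _ _

theorem detDeriv_sum {ι : Type*} (s : Finset ι) (B : E →L[ℝ] E) (C : ι → E →L[ℝ] E) :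
    detDeriv B (∑ i ∈ s, C i) = ∑ i ∈ s, detDeriv B (C i) :=
  map_sum _ _ _

theorem detDeriv_one (C : E →L[ℝ] E) :
    detDeriv 1 C = LinearMap.trace ℝ E (C : E →ₗ[ℝ] E) := by
  classical
  let b := stdOrthonormalBasis ℝ E
  set M := LinearMap.toMatrix b.toBasis b.toBasis (C : E →ₗ[ℝ] E)
  have h1 := hasDerivAt_det_line 1 C
  obtain ⟨p, hp⟩ : ∃ p : Polynomial ℝ, ∀ τ : ℝ, ((1 : E →L[ℝ] E) + τ • C).det
      = 1 + M.trace * τ + p.eval τ * τ ^ 2 := by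
    refine ⟨(Matrix.det (1 + (Polynomial.X : Polynomial ℝ) •
      M.map Polynomial.C)).divX.divX, fun τ => ?_⟩
    rw [← Matrix.det_one_add_smul, ContinuousLinearMap.det,
      ← LinearMap.det_toMatrix b.toBasis]
    congr 1
    have : (((1 : E →L[ℝ] E) + τ • C : E →L[ℝ] E) : E →ₗ[ℝ] E)
        = LinearMap.id + τ • (C : E →ₗ[ℝ] E) := by ext; simp
    rw [this, map_add, map_smul, LinearMap.toMatrix_id]
  have h2 : HasDerivAt (fun τ : ℝ => ((1 : E →L[ℝ] E) + τ • C).det) M.trace 0 := by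
    simp_rw [hp]
    have := (((hasDerivAt_id (0 : ℝ)).const_mul M.trace).const_add 1).add
      ((p.hasDerivAt 0).mul ((hasDerivAt_id (0 : ℝ)).pow 2))
    convert! this using 1
    simp
  rw [h1.unique h2, LinearMap.trace_eq_matrix_trace ℝ b.toBasis]

theorem detDeriv_comp_right (B C X : E →L[ℝ] E) :
    detDeriv (B ∘L X) (C ∘L X) = detDeriv B C * X.det := by
  have h1 := hasDerivAt_det_line (B ∘L X) (C ∘L X)
  have h2 := (hasDerivAt_det_line B C).mul_const X.det
  refine h1.unique (h2.congr_of_eventuallyEq (Eventually.of_forall fun τ => ?_))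
  simp only
  rw [← det_mul]
  congr 1

theorem det_eq_zero_of_apply_eq_zero {B : E →L[ℝ] E} {e : E} (he : e ≠ 0) (h : B e = 0) :
    B.det = 0 := by
  by_contra hne
  have : LinearMap.ker (B : E →ₗ[ℝ] E) = ⊥ := by
    by_contra hk
    exact hne (LinearMap.det_eq_zero_iff_ker_ne_bot.2 hk)
  exact he (LinearMap.ker_eq_bot'.1 this e h)

theorem detDeriv_eq_zero_of_apply_eq_zero {B C : E →L[ℝ] E} {e : E} (he : e ≠ 0)
    (hB : B e = 0) (hC : C e = 0) : detDeriv B C = 0 :=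
  detDeriv_eq_of_line (a := 0) fun τ => by
    rw [det_eq_zero_of_apply_eq_zero he (by simp [hB, hC])]; simp

/-- `rankOne (X w) n` is `X` times a transvection. -/
theorem detDeriv_rankOne_apply (X : E →L[ℝ] E) (w n : E) :
    detDeriv X (rankOne ℝ (X w) n) = X.det * ⟪n, w⟫ := by
  have : X + rankOne ℝ (X w) n = X ∘L (1 + rankOne ℝ w n) := by ext; simp
  rw [detDeriv_rankOne, this, det_mul, det_one_add_rankOne]
  ring

/-- For the gradient `ℓ ∘ B` of a composition `f ∘ T` with `DT = B`, `Df = ℓ`. -/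
theorem detDeriv_smulRight_comp (B : E →L[ℝ] E) (ℓ : E →L[ℝ] ℝ) (v : E) :
    detDeriv B ((ℓ ∘L B).smulRight v) = ℓ v * B.det := by
  obtain ⟨n, rfl⟩ := (InnerProductSpace.toDual ℝ E).surjective ℓ
  have h1 : ((InnerProductSpace.toDual ℝ E n) ∘L B).smulRight v = (rankOne ℝ v n) ∘L B := by
    ext; simp
  have h2 : B = (1 : E →L[ℝ] E) ∘L B := by ext; simp
  rw [h1]
  conv_lhs => rw [h2]
  rw [show ((rankOne ℝ v n) ∘L ((1 : E →L[ℝ] E) ∘L B)) = (rankOne ℝ v n) ∘L B by ext; simp]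
  rw [detDeriv_comp_right, detDeriv_rankOne, det_one_add_rankOne]
  simp [ContinuousLinearMap.det]

/-- How the boundary density `detDeriv A (w ⊗ ν)` looks in a graph chart. Here `e` is the vertical
unit vector, `q` the horizontal gradient of the graph function, `1 + e ⊗ (q - e)` the derivative of
the parametrisation composed with the projection along `e`, and `q - e` the (unnormalised) outer
normal. -/
theorem det_comp_graph_add_rankOne (A : E →L[ℝ] E) {e q : E} (w : E) (he : ‖e‖ = 1)
    (hq : ⟪e, q⟫ = 0) :
    (A ∘L (1 + rankOne ℝ e (q - e)) + rankOne ℝ w e).det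
      = -detDeriv A (rankOne ℝ w (q - e)) := by
  have hee : ⟪e, e⟫ = 1 := by rw [real_inner_self_eq_norm_sq, he]; norm_num
  have hqe : ⟪q, e⟫ = 0 := by rw [real_inner_comm, hq]
  -- `1 - e ⊗ q` has determinant one and undoes the graph shear
  obtain ⟨m, hm⟩ : ∃ m : E, ∀ x, ⟪m, x⟫ = -⟪q, x⟫ := ⟨-q, fun x => inner_neg_left _ _⟩
  have hX : (1 + rankOne ℝ e m : E →L[ℝ] E).det = 1 := by
    rw [det_one_add_rankOne, hm, hqe]; simp
  have h1 : (A ∘L (1 + rankOne ℝ e (q - e)) + rankOne ℝ w e) ∘L (1 + rankOne ℝ e m)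
      = A + rankOne ℝ (A e - w) (q - e) := by
    ext x
    simp only [ContinuousLinearMap.comp_apply, add_apply, one_apply_eq_self,
      InnerProductSpace.rankOne_apply, map_add, map_smul,
      inner_sub_left, hee, hqe, hm]
    module
  have h2 : (A + rankOne ℝ (A e) (q - e)).det = 0 := by
    have : A + rankOne ℝ (A e) (q - e) = A ∘L (1 + rankOne ℝ e (q - e)) := by ext; simp
    rw [this, det_mul, det_one_add_rankOne]
    rw [inner_sub_left, hee, hqe]; norm_num
  calc (A ∘L (1 + rankOne ℝ e (q - e)) + rankOne ℝ w e).det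
      = ((A ∘L (1 + rankOne ℝ e (q - e)) + rankOne ℝ w e) ∘L (1 + rankOne ℝ e m)).det := by
        rw [det_mul, hX, mul_one]
    _ = (A + rankOne ℝ (A e - w) (q - e)).det := by rw [h1]
    _ = A.det + detDeriv A (rankOne ℝ (A e - w) (q - e)) := by rw [detDeriv_rankOne]; ring
    _ = A.det + (detDeriv A (rankOne ℝ (A e) (q - e)) - detDeriv A (rankOne ℝ w (q - e))) := by
        rw [← detDeriv_sub]; congr 2; ext; simp
    _ = -detDeriv A (rankOne ℝ w (q - e)) := by
        rw [detDeriv_rankOne A (A e), h2]; ring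

/-- Taylor's formula for the determinant, uniform on bounded sets: the derivative of the smooth
function `det` is Lipschitz there. -/
theorem exists_abs_det_add_sub_le (E : Type*) [NormedAddCommGroup E] [InnerProductSpace ℝ E]
    [FiniteDimensional ℝ E] (R : ℝ) :
    ∃ C : ℝ, 0 ≤ C ∧ ∀ A B : E →L[ℝ] E, ‖A‖ ≤ R → ‖B‖ ≤ R →
      |B.det - A.det - detDeriv A (B - A)| ≤ C * ‖B - A‖ ^ 2 := by
  set f := fun A : E →L[ℝ] E => A.det
  have hcd : ContDiff ℝ 1 (fderiv ℝ f) := contDiff_det.fderiv_right (m := 1) (n := 2) (by norm_num)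
  obtain ⟨K, hK⟩ := hcd.contDiffOn.exists_lipschitzOnWith (s := Metric.closedBall 0 R)
    (by norm_num) (convex_closedBall _ _) (isCompact_closedBall _ _)
  refine ⟨K, K.2, fun A B hA hB => ?_⟩
  have hA' : A ∈ Metric.closedBall (0 : E →L[ℝ] E) R := by simpa using hA
  have hB' : B ∈ Metric.closedBall (0 : E →L[ℝ] E) R := by simpa using hB
  have hseg : segment ℝ A B ⊆ Metric.closedBall 0 R :=
    (convex_closedBall _ _).segment_subset hA' hB'
  have key := (convex_segment A B).norm_image_sub_le_of_norm_hasFDerivWithin_le'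
    (f := f) (f' := fderiv ℝ f) (φ := fderiv ℝ f A) (C := K * ‖B - A‖)
    (fun x _ => ((contDiff_det (n := 1)).differentiable (by norm_num) x).hasFDerivAt.hasFDerivWithinAt)
    (fun x hx => by
      refine (hK.norm_sub_le (hseg hx) hA').trans ?_
      gcongr
      obtain ⟨t, ht, rfl⟩ := (segment_eq_image' ℝ A B ▸ hx : x ∈ _)
      simp only [add_sub_cancel_left, norm_smul, Real.norm_eq_abs, abs_of_nonneg ht.1]
      exact mul_le_of_le_one_left (norm_nonneg _) ht.2)
    (left_mem_segment ℝ A B) (right_mem_segment ℝ A B)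
  rw [Real.norm_eq_abs] at key
  calc _ ≤ _ := key
    _ = _ := by ring

theorem exists_abs_detDeriv_sub_le (E : Type*) [NormedAddCommGroup E] [InnerProductSpace ℝ E]
    [FiniteDimensional ℝ E] (R : ℝ) :
    ∃ C : ℝ, 0 ≤ C ∧ ∀ A B D : E →L[ℝ] E, ‖A‖ ≤ R → ‖B‖ ≤ R →
      |detDeriv A D - detDeriv B D| ≤ C * ‖A - B‖ * ‖D‖ := by
  set f := fun A : E →L[ℝ] E => A.det
  have hcd : ContDiff ℝ 1 (fderiv ℝ f) := contDiff_det.fderiv_right (m := 1) (n := 2) (by norm_num)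
  obtain ⟨K, hK⟩ := hcd.contDiffOn.exists_lipschitzOnWith (s := Metric.closedBall 0 R)
    (by norm_num) (convex_closedBall _ _) (isCompact_closedBall _ _)
  refine ⟨K, K.2, fun A B D hA hB => ?_⟩
  have h := hK.norm_sub_le (x := A) (y := B) (by simpa using hA) (by simpa using hB)
  calc |detDeriv A D - detDeriv B D| = ‖(fderiv ℝ f A - fderiv ℝ f B) D‖ := by
        simp [detDeriv, f]
    _ ≤ ‖fderiv ℝ f A - fderiv ℝ f B‖ * ‖D‖ := ContinuousLinearMap.le_opNorm _ _
    _ ≤ _ := by gcongr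

theorem exists_abs_detDeriv_le (E : Type*) [NormedAddCommGroup E] [InnerProductSpace ℝ E]
    [FiniteDimensional ℝ E] (R : ℝ) :
    ∃ C : ℝ, 0 ≤ C ∧ ∀ A B : E →L[ℝ] E, ‖A‖ ≤ R → |detDeriv A B| ≤ C * ‖B‖ := by
  obtain ⟨C, hC0, hC⟩ := exists_abs_detDeriv_sub_le E R
  set F := fderiv ℝ (fun A : E →L[ℝ] E => A.det) 0
  refine ⟨‖F‖ + C * |R|, by positivity, fun A B hA => ?_⟩
  have hR : 0 ≤ R := (norm_nonneg A).trans hA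
  have h1 := hC A 0 B hA (by simpa using hR)
  have h2 : |detDeriv 0 B| ≤ ‖F‖ * ‖B‖ := F.le_opNorm B
  rw [sub_zero] at h1
  have h3 : C * ‖A‖ * ‖B‖ ≤ C * |R| * ‖B‖ := by
    gcongr
    exact hA.trans (le_abs_self R)
  have h4 := abs_add_le (detDeriv A B - detDeriv 0 B) (detDeriv 0 B)
  rw [sub_add_cancel] at h4
  linarith

theorem continuous_detDeriv :
    Continuous fun p : (E →L[ℝ] E) × (E →L[ℝ] E) => detDeriv p.1 p.2 := by
  have hc : Continuous (fderiv ℝ fun A : E →L[ℝ] E => A.det) :=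
    (contDiff_det (n := 1)).continuous_fderiv (by norm_num)
  exact (hc.comp continuous_fst).clm_apply continuous_snd

end Determinant

/-! ### Lipschitz changes of variables and the null Lagrangian property of the determinant -/

section NullLagrangian

theorem euclideanHausdorffMeasure_image_le {X Y : Type*} [EMetricSpace X] [MeasurableSpace X]
    [BorelSpace X] [EMetricSpace Y] [MeasurableSpace Y] [BorelSpace Y] {K : ℝ≥0} {f : X → Y}
    {s : Set X} (h : LipschitzOnWith K f s) (k : ℕ) :
    Measure.euclideanHausdorffMeasure k (f '' s)
      ≤ (K : ENNReal) ^ k * Measure.euclideanHausdorffMeasure k s := by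
  simp_rw [Measure.euclideanHausdorffMeasure_def, Measure.smul_apply, ENNReal.smul_def, smul_eq_mul]
  have := h.hausdorffMeasure_image_le (d := k) (by positivity)
  rw [ENNReal.rpow_natCast] at this
  calc _ ≤ _ := mul_le_mul_right this _
    _ = _ := by ring

variable {E : Type*} [NormedAddCommGroup E] [InnerProductSpace ℝ E] [FiniteDimensional ℝ E]
  [MeasurableSpace E] [BorelSpace E]

theorem volume_image_eq_zero_of_lipschitz {K : ℝ≥0} {f : E → E} (hf : LipschitzWith K f)
    {s : Set E} (hs : volume s = 0) : volume (f '' s) = 0 := by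
  have h := euclideanHausdorffMeasure_image_le (hf.lipschitzOnWith (s := s))
    (Module.finrank ℝ E)
  rw [InnerProductSpace.euclideanHausdorffMeasure_eq_volume, hs, mul_zero] at h
  exact le_antisymm h bot_le

/-- A bounded measurable field, composed with a continuous function, is integrable on a set of
finite measure. -/
theorem integrable_continuous_comp {X F : Type*} [MeasurableSpace X] {μ : Measure X}
    [IsFiniteMeasure μ] [NormedAddCommGroup F] [NormedSpace ℝ F] [FiniteDimensional ℝ F]
    {G : F → ℝ} (hG : Continuous G) {u : X → F} (hu : AEStronglyMeasurable u μ) {R : ℝ}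
    (hR : ∀ᵐ x ∂μ, ‖u x‖ ≤ R) : Integrable (fun x => G (u x)) μ := by
  have : ProperSpace F := FiniteDimensional.proper_real F
  obtain ⟨C, hC⟩ := (isCompact_closedBall (0 : F) R).bddAbove_image hG.norm.continuousOn
  refine Integrable.of_bound (hG.comp_aestronglyMeasurable hu) C ?_
  filter_upwards [hR] with x hx
  exact hC (mem_image_of_mem _ (by simpa using hx))

theorem aestronglyMeasurable_fderiv {F : Type*} [NormedAddCommGroup F] [NormedSpace ℝ F]
    [FiniteDimensional ℝ F] (f : E → F) (μ : Measure E) :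
    AEStronglyMeasurable (fderiv ℝ f) μ := by
  have : CompleteSpace F := FiniteDimensional.complete ℝ F
  borelize (E →L[ℝ] F)
  have : SecondCountableTopology (E →L[ℝ] F) := by
    have : ProperSpace (E →L[ℝ] F) := FiniteDimensional.proper_real _
    infer_instance
  exact (measurable_fderiv ℝ f).aestronglyMeasurable

section ChangeOfVariables

variable {K : ℝ≥0} {f : E → E} {s : Set E}

/-- By Rademacher's theorem and since Lipschitz maps preserve null sets, the change of variables
formulas, which ask for derivatives everywhere, may be applied on a subset of full measure. -/
theorem exists_good_set_changeOfVariables (hf : LipschitzWith K f) (hs : MeasurableSet s) :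
    ∃ D ⊆ s, MeasurableSet D ∧ (∀ x ∈ D, HasFDerivWithinAt f (fderiv ℝ f x) D x) ∧
      D =ᵐ[volume] s ∧ f '' D =ᵐ[volume] f '' s := by
  let D := s ∩ {x | DifferentiableAt ℝ f x}
  have hnull : volume (s \ D) = 0 := by
    refine measure_mono_null ?_ (ae_iff.1 hf.ae_differentiableAt)
    rintro x ⟨hx, hxD⟩
    exact fun h => hxD ⟨hx, h⟩
  have hD : D ⊆ s := inter_subset_left
  refine ⟨D, hD, hs.inter (measurableSet_of_differentiableAt ℝ f), fun x hx =>
    hx.2.hasFDerivAt.hasFDerivWithinAt, ?_, ?_⟩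
  · exact (ae_le_set.2 (by rw [sdiff_eq_empty.2 hD]; exact measure_empty)).antisymm
      (ae_le_set.2 hnull)
  · refine (ae_le_set.2 (by rw [sdiff_eq_empty.2 (image_mono hD)]; exact measure_empty)).antisymm
      (ae_le_set.2 ?_)
    refine measure_mono_null ?_ (volume_image_eq_zero_of_lipschitz hf hnull)
    rintro _ ⟨⟨x, hx, rfl⟩, hn⟩
    exact ⟨x, ⟨hx, fun h => hn ⟨x, h, rfl⟩⟩, rfl⟩

theorem setIntegral_image_of_lipschitz (hf : LipschitzWith K f) (hs : MeasurableSet s)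
    (hinj : InjOn f s) (g : E → ℝ) :
    ∫ x in f '' s, g x = ∫ x in s, |(fderiv ℝ f x).det| * g (f x) := by
  obtain ⟨D, hDs, hD, hd, he, hi⟩ := exists_good_set_changeOfVariables hf hs
  rw [← setIntegral_congr_set hi, ← setIntegral_congr_set he,
    integral_image_eq_integral_abs_det_fderiv_smul volume hD hd (hinj.mono hDs)]
  simp

theorem integrableOn_image_iff_of_lipschitz (hf : LipschitzWith K f) (hs : MeasurableSet s)
    (hinj : InjOn f s) (g : E → ℝ) :
    IntegrableOn g (f '' s) ↔ IntegrableOn (fun x => |(fderiv ℝ f x).det| * g (f x)) s := by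
  obtain ⟨D, hDs, hD, hd, he, hi⟩ := exists_good_set_changeOfVariables hf hs
  rw [← integrableOn_congr_set_ae hi, ← integrableOn_congr_set_ae he,
    integrableOn_image_iff_integrableOn_abs_det_fderiv_smul volume hD hd (hinj.mono hDs)]
  simp

end ChangeOfVariables

section Perturbation

variable {K : ℝ≥0} {f : E → E} {s : ℝ≥0}

/-- A perturbation of `s • id` by a map with Lipschitz constant less than `s` is bijective, by the
contraction principle. -/
theorem bijective_smul_add_lipschitz (hf : LipschitzWith K f) (hs : K < s) :
    Function.Bijective fun x => (s : ℝ) • x + f x := by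
  have hs0 : (s : ℝ) ≠ 0 := by
    have : (0 : ℝ≥0) < s := bot_le.trans_lt hs
    exact_mod_cast this.ne'
  let g : E → E := fun x => x + (s : ℝ)⁻¹ • f x
  have hg : ApproximatesLinearOn g ((ContinuousLinearEquiv.refl ℝ E : E ≃L[ℝ] E) : E →L[ℝ] E)
      univ (s⁻¹ * K) := by
    intro x _ y _
    have : g x - g y - ((ContinuousLinearEquiv.refl ℝ E : E ≃L[ℝ] E) : E →L[ℝ] E) (x - y)
        = (s : ℝ)⁻¹ • (f x - f y) := by
      simp only [g, ContinuousLinearEquiv.coe_refl, ContinuousLinearMap.id_apply]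
      module
    rw [this, norm_smul]
    have h := hf.norm_sub_le x y
    simp only [norm_inv, Real.norm_eq_abs, NNReal.abs_eq, NNReal.coe_mul, NNReal.coe_inv]
    rw [mul_assoc]
    gcongr
  have hc : Subsingleton E ∨ s⁻¹ * K
      < ‖(((ContinuousLinearEquiv.refl ℝ E).symm : E ≃L[ℝ] E) : E →L[ℝ] E)‖₊⁻¹ := by
    rcases subsingleton_or_nontrivial E with h | h
    · exact Or.inl h
    · refine Or.inr ?_
      have : ‖(((ContinuousLinearEquiv.refl ℝ E).symm : E ≃L[ℝ] E) : E →L[ℝ] E)‖₊ = 1 := by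
        ext
        simp
      rw [this, inv_one, inv_mul_lt_iff₀ (bot_le.trans_lt hs), mul_one]
      exact hs
  have hb : Function.Bijective g := (hg.toHomeomorph g hc).bijective
  have : (fun x => (s : ℝ) • x + f x) = (fun y => (s : ℝ) • y) ∘ g := by
    ext1 x
    simp [g, smul_smul, hs0]
  rw [this]
  exact (MulAction.bijective (Units.mk0 (s : ℝ) hs0)).comp hb

/-- The determinant does not vanish on the segment from `s • 1` to `s • 1 + A`, hence keeps its
sign. -/
theorem det_smul_one_add_pos {A : E →L[ℝ] E} {s : ℝ} (h : ‖A‖ < s) :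
    0 < (s • (1 : E →L[ℝ] E) + A).det := by
  have hne : ∀ τ ∈ Icc (0 : ℝ) 1, (s • (1 : E →L[ℝ] E) + τ • A).det ≠ 0 := by
    intro τ hτ h0
    have hk : LinearMap.ker ((s • (1 : E →L[ℝ] E) + τ • A : E →L[ℝ] E) : E →ₗ[ℝ] E) ≠ ⊥ :=
      LinearMap.det_eq_zero_iff_ker_ne_bot.1 h0
    obtain ⟨v, hv, hv0⟩ := Submodule.exists_mem_ne_zero_of_ne_bot hk
    have h1 : s • v = -(τ • A v) := by
      have : s • v + τ • A v = 0 := by simpa using hv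
      exact eq_neg_of_add_eq_zero_left this
    have h2 : s * ‖v‖ ≤ ‖A‖ * ‖v‖ := by
      calc s * ‖v‖ ≤ ‖s • v‖ := by
            rw [norm_smul]; gcongr; exact le_abs_self s
        _ = |τ| * ‖A v‖ := by rw [h1, norm_neg, norm_smul, Real.norm_eq_abs]
        _ ≤ 1 * (‖A‖ * ‖v‖) := by
            gcongr
            · rw [abs_of_nonneg hτ.1]; exact hτ.2
            · exact A.le_opNorm v
        _ = _ := one_mul _
    exact absurd (le_of_mul_le_mul_right h2 (norm_pos_iff.2 hv0)) (not_le.2 h)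
  have hs : 0 < s := (norm_nonneg A).trans_lt h
  let g : ℝ → ℝ := fun τ => (s • (1 : E →L[ℝ] E) + τ • A).det
  have hg : Continuous g := continuous_det.comp (by fun_prop)
  have h0 : 0 < g 0 := by
    have : g 0 = s ^ Module.finrank ℝ E := by
      simp [g, ContinuousLinearMap.det]
    rw [this]; positivity
  by_contra hle
  have h1 : g 1 ≤ 0 := by simpa [g] using not_lt.1 hle
  obtain ⟨τ, hτ, h⟩ := intermediate_value_Icc' (zero_le_one' ℝ) hg.continuousOn
    (show (0 : ℝ) ∈ Icc (g 1) (g 0) from ⟨h1, h0.le⟩)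
  exact hne τ hτ h

end Perturbation

variable {K L : ℝ≥0} {T W : E → E}

theorem norm_fderiv_le_of_lipschitz' {F : Type*} [NormedAddCommGroup F] [NormedSpace ℝ F]
    {K : ℝ≥0} {f : E → F} (hf : LipschitzWith K f) (x : E) : ‖fderiv ℝ f x‖ ≤ K :=
  norm_fderiv_le_of_lipschitz ℝ hf

/-- For large `s`, both `s + T` and `s + T + W` are homeomorphisms which agree outside the support
of `W`, so they map this support to sets of the same volume. -/
theorem setIntegral_det_smul_one_add_eq (hT : LipschitzWith K T) (hW : LipschitzWith L W)
    {B : Set E} (hB : MeasurableSet B) (hWB : ∀ x ∉ B, W x = 0)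
    {s : ℝ≥0} (hs : K + L < s) :
    ∫ x in B, ((s : ℝ) • (1 : E →L[ℝ] E) + (fderiv ℝ T x + fderiv ℝ W x)).det
      = ∫ x in B, ((s : ℝ) • (1 : E →L[ℝ] E) + fderiv ℝ T x).det := by
  have key : ∀ (f : E → E), LipschitzWith (K + L) f →
      ∫ x in B, ((s : ℝ) • (1 : E →L[ℝ] E) + fderiv ℝ f x).det
        = (volume ((fun x => (s : ℝ) • x + f x) '' B)).toReal := by
    intro f hf
    have hΦ : LipschitzWith (s + (K + L)) fun x => (s : ℝ) • x + f x := by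
      refine LipschitzWith.add ?_ hf
      have := lipschitzWith_smul (α := ℝ) (β := E) (s : ℝ)
      simpa using this
    have h := setIntegral_image_of_lipschitz hΦ hB
      (bijective_smul_add_lipschitz hf hs).injective.injOn (fun _ => (1 : ℝ))
    rw [setIntegral_const, smul_eq_mul, mul_one] at h
    rw [← Measure.real, h]
    refine integral_congr_ae (ae_restrict_of_ae ?_)
    filter_upwards [hf.ae_differentiableAt] with x hx
    have hd : fderiv ℝ (fun x => (s : ℝ) • x + f x) x
        = (s : ℝ) • (1 : E →L[ℝ] E) + fderiv ℝ f x :=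
      (((hasFDerivAt_id x).const_smul (s : ℝ)).add hx.hasFDerivAt).fderiv
    simp only [mul_one]
    rw [hd, abs_of_pos]
    refine det_smul_one_add_pos ((norm_fderiv_le_of_lipschitz' hf x).trans_lt ?_)
    exact_mod_cast hs
  have hTW := hT.add hW
  have hT' : LipschitzWith (K + L) T := hT.weaken (by simp)
  have h1 := key _ hTW
  have h2 := key _ hT'
  have himg : (fun x => (s : ℝ) • x + (T x + W x)) '' B = (fun x => (s : ℝ) • x + T x) '' B := by
    rw [← compl_inj_iff, ← image_compl_eq (bijective_smul_add_lipschitz hTW hs),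
      ← image_compl_eq (bijective_smul_add_lipschitz hT' hs)]
    exact image_congr fun x hx => by simp [hWB x hx]
  rw [himg] at h1
  rw [h2, ← h1]
  refine integral_congr_ae (ae_restrict_of_ae ?_)
  filter_upwards [hT.ae_differentiableAt, hW.ae_differentiableAt] with x h3 h4
  rw [fderiv_fun_add h3 h4]

/-- Both sides of `setIntegral_det_smul_one_add_eq` are polynomials in `s`, hence agree at `0`. -/
theorem setIntegral_det_add_eq (hT : LipschitzWith K T) (hW : LipschitzWith L W)
    {B : Set E} (hB : MeasurableSet B) (hBf : volume B ≠ ⊤) (hWB : ∀ x ∉ B, W x = 0) :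
    ∫ x in B, (fderiv ℝ T x + fderiv ℝ W x).det = ∫ x in B, (fderiv ℝ T x).det := by
  have : IsFiniteMeasure (volume.restrict B) := ⟨by simpa using hBf.lt_top⟩
  let p : E → Polynomial ℝ := fun x =>
    LinearMap.charpoly (-((fderiv ℝ T x + fderiv ℝ W x : E →L[ℝ] E) : E →ₗ[ℝ] E))
      - LinearMap.charpoly (-(fderiv ℝ T x : E →ₗ[ℝ] E))
  have hp : ∀ x (s : ℝ), (p x).eval s
      = (s • (1 : E →L[ℝ] E) + (fderiv ℝ T x + fderiv ℝ W x)).det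
        - (s • (1 : E →L[ℝ] E) + fderiv ℝ T x).det := by
    intro x s
    rw [det_smul_one_add, det_smul_one_add, Polynomial.eval_sub]
  have hdeg : ∀ x, (p x).degree < (Finset.range (Module.finrank ℝ E + 1)).card := by
    intro x
    rw [Finset.card_range]
    refine (Polynomial.degree_sub_le _ _).trans_lt (max_lt ?_ ?_)
    all_goals
      rw [Polynomial.degree_eq_natDegree (LinearMap.charpoly_monic _).ne_zero,
        LinearMap.charpoly_natDegree]
      exact_mod_cast Nat.lt_succ_self _
  let v : ℕ → ℝ := fun i => ((K + L + 1 + i : ℝ≥0) : ℝ)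
  have hv : InjOn v (Finset.range (Module.finrank ℝ E + 1)) := by
    intro i _ j _ h
    have : (K + L + 1 + i : ℝ) = K + L + 1 + j := by simpa [v] using h
    exact_mod_cast add_left_cancel this
  have hmeas : ∀ s : ℝ, Integrable
      (fun x => (s • (1 : E →L[ℝ] E) + (fderiv ℝ T x + fderiv ℝ W x)).det)
        (volume.restrict B) := fun s =>
    integrable_continuous_comp (G := fun A : E →L[ℝ] E => (s • (1 : E →L[ℝ] E) + A).det)
      (continuous_det.comp (by fun_prop))
      ((aestronglyMeasurable_fderiv T _).add (aestronglyMeasurable_fderiv W _)) (R := K + L)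
      (Eventually.of_forall fun x => (norm_add_le _ _).trans
        (add_le_add (norm_fderiv_le_of_lipschitz' hT x) (norm_fderiv_le_of_lipschitz' hW x)))
  have hmeas' : ∀ s : ℝ, Integrable
      (fun x => (s • (1 : E →L[ℝ] E) + fderiv ℝ T x).det) (volume.restrict B) := fun s =>
    integrable_continuous_comp (G := fun A : E →L[ℝ] E => (s • (1 : E →L[ℝ] E) + A).det)
      (continuous_det.comp (by fun_prop)) (aestronglyMeasurable_fderiv T _) (R := K)
      (Eventually.of_forall fun x => norm_fderiv_le_of_lipschitz' hT x)
  have hint : ∀ s : ℝ, Integrable (fun x => (p x).eval s) (volume.restrict B) := fun s => by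
    simp_rw [hp]
    exact (hmeas s).sub (hmeas' s)
  have hzero : ∀ i, ∫ x in B, (p x).eval (v i) = 0 := by
    intro i
    simp_rw [hp]
    rw [integral_sub (hmeas _) (hmeas' _), sub_eq_zero]
    refine setIntegral_det_smul_one_add_eq hT hW hB hWB ?_
    calc K + L < K + L + 1 := lt_add_one _
      _ ≤ K + L + 1 + i := le_self_add
  -- the value of `p x` at `0` is a fixed linear combination of its values at the nodes `v i`
  have h0 : ∫ x in B, (p x).eval 0 = 0 := by
    have : ∀ x, (p x).eval 0 = ∑ i ∈ Finset.range (Module.finrank ℝ E + 1), (p x).eval (v i) *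
        (Lagrange.basis (Finset.range (Module.finrank ℝ E + 1)) v i).eval 0 := by
      intro x
      conv_lhs => rw [Lagrange.eq_interpolate hv (hdeg x), Lagrange.interpolate_apply]
      simp [Polynomial.eval_finsetSum]
    simp_rw [this]
    rw [integral_finsetSum _ fun i _ => (hint _).mul_const _]
    refine Finset.sum_eq_zero fun i _ => ?_
    rw [integral_mul_const, hzero, zero_mul]
  simp_rw [hp] at h0
  rw [integral_sub (hmeas _) (hmeas' _), sub_eq_zero] at h0
  simpa using h0

/-- The first order term, as `τ → 0`, of `setIntegral_det_add_eq` for `T` and `τ • W`. -/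
theorem setIntegral_detDeriv_eq_zero (hT : LipschitzWith K T) (hW : LipschitzWith L W)
    {B : Set E} (hB : MeasurableSet B) (hBf : volume B ≠ ⊤) (hWB : ∀ x ∉ B, W x = 0) :
    ∫ x in B, detDeriv (fderiv ℝ T x) (fderiv ℝ W x) = 0 := by
  have : IsFiniteMeasure (volume.restrict B) := ⟨by simpa using hBf.lt_top⟩
  obtain ⟨C, hC0, hC⟩ := exists_abs_det_add_sub_le E (K + L)
  have hdet : ∀ τ : ℝ, Integrable (fun x => (fderiv ℝ T x + τ • fderiv ℝ W x).det)
      (volume.restrict B) := fun τ =>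
    integrable_continuous_comp (G := fun p : (E →L[ℝ] E) × (E →L[ℝ] E) => (p.1 + τ • p.2).det)
      (continuous_det.comp (by fun_prop))
      ((aestronglyMeasurable_fderiv T _).prodMk (aestronglyMeasurable_fderiv W _))
      (R := max K L) (Eventually.of_forall fun x => max_le_max
        (norm_fderiv_le_of_lipschitz' hT x) (norm_fderiv_le_of_lipschitz' hW x))
  have hdd : Integrable (fun x => detDeriv (fderiv ℝ T x) (fderiv ℝ W x))
      (volume.restrict B) :=
    integrable_continuous_comp continuous_detDeriv
      ((aestronglyMeasurable_fderiv T _).prodMk (aestronglyMeasurable_fderiv W _))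
      (R := max K L) (Eventually.of_forall fun x => max_le_max
        (norm_fderiv_le_of_lipschitz' hT x) (norm_fderiv_le_of_lipschitz' hW x))
  have hT0 : Integrable (fun x => (fderiv ℝ T x).det) (volume.restrict B) := by
    simpa using hdet 0
  set I := ∫ x in B, detDeriv (fderiv ℝ T x) (fderiv ℝ W x)
  have hbound : ∀ τ ∈ Ioc (0 : ℝ) 1, |I| ≤ τ * (C * L ^ 2 * (volume B).toReal) := by
    intro τ hτ
    have hτW : LipschitzWith L (fun x => τ • W x) := by
      refine LipschitzWith.of_dist_le_mul fun x y => ?_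
      rw [dist_smul₀]
      calc ‖τ‖ * dist (W x) (W y) ≤ 1 * dist (W x) (W y) := by
            gcongr; rw [Real.norm_eq_abs, abs_of_pos hτ.1]; exact hτ.2
        _ ≤ _ := by rw [one_mul]; exact hW.dist_le_mul x y
    have h1 := setIntegral_det_add_eq hT hτW hB hBf (fun x hx => by simp [hWB x hx])
    have h2 : ∫ x in B, (fderiv ℝ T x + fderiv ℝ (fun x => τ • W x) x).det
        = ∫ x in B, (fderiv ℝ T x + τ • fderiv ℝ W x).det := by
      refine integral_congr_ae (ae_restrict_of_ae ?_)
      filter_upwards [hW.ae_differentiableAt] with x hx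
      rw [fderiv_fun_const_smul hx]
    rw [h2] at h1
    have h3 : ∫ x in B, ((fderiv ℝ T x + τ • fderiv ℝ W x).det - (fderiv ℝ T x).det
        - τ * detDeriv (fderiv ℝ T x) (fderiv ℝ W x)) = -(τ * I) := by
      have hs : Integrable (fun x => (fderiv ℝ T x + τ • fderiv ℝ W x).det - (fderiv ℝ T x).det)
        (volume.restrict B) := (hdet τ).sub hT0
      rw [integral_sub hs (hdd.const_mul τ), integral_sub (hdet τ) hT0, h1,
        integral_const_mul]
      ring
    have h4 := norm_setIntegral_le_of_norm_le_const (μ := volume) (s := B)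
      (f := fun x => (fderiv ℝ T x + τ • fderiv ℝ W x).det - (fderiv ℝ T x).det
        - τ * detDeriv (fderiv ℝ T x) (fderiv ℝ W x)) (C := C * (τ * L) ^ 2) hBf.lt_top
      (fun x _ => by
        have n1 := norm_fderiv_le_of_lipschitz' hT x
        have n2 := norm_fderiv_le_of_lipschitz' hW x
        have n3 : ‖τ • fderiv ℝ W x‖ ≤ τ * L := by
          rw [norm_smul, Real.norm_eq_abs, abs_of_pos hτ.1]
          exact mul_le_mul_of_nonneg_left n2 hτ.1.le
        have n4 : τ * L ≤ L := mul_le_of_le_one_left L.2 hτ.2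
        have := hC (fderiv ℝ T x) (fderiv ℝ T x + τ • fderiv ℝ W x)
          (n1.trans (by simp)) ((norm_add_le _ _).trans (add_le_add n1 (n3.trans n4)))
        rw [add_sub_cancel_left, detDeriv_smul] at this
        rw [Real.norm_eq_abs]
        refine this.trans ?_
        gcongr)
    rw [h3, norm_neg, norm_mul, Real.norm_eq_abs, Real.norm_eq_abs, abs_of_pos hτ.1] at h4
    refine le_of_mul_le_mul_left (h4.trans_eq ?_) hτ.1
    rw [Measure.real]
    ring
  have hlim : Tendsto (fun τ : ℝ => τ * (C * L ^ 2 * (volume B).toReal)) (𝓝[>] 0) (𝓝 0) := by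
    have : Continuous fun τ : ℝ => τ * (C * L ^ 2 * (volume B).toReal) := by fun_prop
    simpa using (this.tendsto 0).mono_left (nhdsWithin_le_nhds (s := Ioi 0))
  have : |I| ≤ 0 := ge_of_tendsto hlim (by
    filter_upwards [Ioc_mem_nhdsGT (zero_lt_one' ℝ)] with τ hτ
    exact hbound τ hτ)
  exact abs_nonpos_iff.1 this

/-- The null Lagrangian property of the determinant: its first variation in the direction of a
compactly supported Lipschitz field vanishes. -/
theorem integral_detDeriv_eq_zero (hT : LipschitzWith K T) (hW : LipschitzWith L W)
    (hWc : HasCompactSupport W) :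
    ∫ x, detDeriv (fderiv ℝ T x) (fderiv ℝ W x) = 0 := by
  rw [← setIntegral_detDeriv_eq_zero hT hW (B := tsupport W) hWc.isCompact.measurableSet
    hWc.isCompact.measure_lt_top.ne (fun x hx => image_eq_zero_of_notMem_tsupport hx)]
  refine (setIntegral_eq_integral_of_forall_compl_eq_zero fun x hx => ?_).symm
  have : fderiv ℝ W x = 0 := by
    by_contra h
    exact hx (support_fderiv_subset ℝ h)
  simp [this, detDeriv]

end NullLagrangian

/-! ### Graph coordinates -/

/-- A splitting of `E` into a hyperplane, parametrised isometrically by `H`, and the line spanned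
by a unit vector `e` orthogonal to it. -/
structure Frame (H E : Type*) [NormedAddCommGroup H] [InnerProductSpace ℝ H]
    [NormedAddCommGroup E] [InnerProductSpace ℝ E] where
  /-- the parametrisation of the hyperplane -/
  incl : H →ₗᵢ[ℝ] E
  /-- the vertical unit vector -/
  e : E
  norm_e : ‖e‖ = 1
  inner_e_incl : ∀ u, ⟪e, incl u⟫ = 0
  finrank_eq : Module.finrank ℝ E = Module.finrank ℝ H + 1

namespace Frame

open InnerProductSpace (rankOne)

variable {H E : Type*} [NormedAddCommGroup H] [InnerProductSpace ℝ H] [FiniteDimensional ℝ H]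
  [NormedAddCommGroup E] [InnerProductSpace ℝ E] [FiniteDimensional ℝ E] (F : Frame H E)

/-- The coordinate along the hyperplane. -/
def proj : E →L[ℝ] H := ContinuousLinearMap.adjoint F.incl.toContinuousLinearMap

theorem e_ne_zero : F.e ≠ 0 := by
  intro h
  have := F.norm_e
  simp [h] at this

theorem inner_proj (y : E) (u : H) : ⟪F.proj y, u⟫ = ⟪y, F.incl u⟫ :=
  ContinuousLinearMap.adjoint_inner_left _ _ _

@[simp]
theorem proj_incl (u : H) : F.proj (F.incl u) = u := by
  refine ext_inner_right ℝ fun v => ?_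
  rw [inner_proj, F.incl.inner_map_map]

@[simp]
theorem proj_e : F.proj F.e = 0 := by
  refine ext_inner_right ℝ fun v => ?_
  rw [inner_proj, F.inner_e_incl, inner_zero_left]

/-- The frame as an isometry from the orthogonal sum of `H` and `ℝ`. -/
def isometryEquiv : WithLp 2 (H × ℝ) ≃ₗᵢ[ℝ] E :=
  LinearIsometry.toLinearIsometryEquiv
    { toFun := fun z => F.incl z.fst + z.snd • F.e
      map_add' := fun x y => by simp only [WithLp.add_fst, WithLp.add_snd, map_add]; module
      map_smul' := fun r x => by
        simp only [WithLp.smul_fst, WithLp.smul_snd, map_smul, RingHom.id_apply]; module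
      norm_map' := fun z => by
        simp only [LinearMap.coe_mk, AddHom.coe_mk]
        rw [← sq_eq_sq₀ (norm_nonneg _) (norm_nonneg _), WithLp.prod_norm_sq_eq_of_L2,
          norm_add_sq_real, inner_smul_right, real_inner_comm, F.inner_e_incl, norm_smul, F.norm_e,
          F.incl.norm_map]
        simp }
    (by
      rw [F.finrank_eq, LinearEquiv.finrank_eq (WithLp.linearEquiv 2 ℝ (H × ℝ))]
      simp)

theorem isometryEquiv_apply (z : WithLp 2 (H × ℝ)) :
    F.isometryEquiv z = F.incl z.fst + z.snd • F.e := rfl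

theorem incl_proj_add (y : E) : F.incl (F.proj y) + ⟪F.e, y⟫ • F.e = y := by
  obtain ⟨z, rfl⟩ := F.isometryEquiv.surjective y
  rw [isometryEquiv_apply]
  simp [inner_add_right, inner_smul_right, F.inner_e_incl, F.norm_e]

theorem incl_proj (y : E) : F.incl (F.proj y) = y - ⟪F.e, y⟫ • F.e :=
  eq_sub_of_add_eq (F.incl_proj_add y)

theorem norm_proj_le (y : E) : ‖F.proj y‖ ≤ ‖y‖ := by
  rw [← F.incl.norm_map, ← sq_le_sq₀ (norm_nonneg _) (norm_nonneg _)]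
  have h : ‖F.incl (F.proj y) + ⟪F.e, y⟫ • F.e‖ ^ 2 = ‖y‖ ^ 2 := by rw [incl_proj_add]
  rw [norm_add_sq_real, inner_smul_right, real_inner_comm F.e, F.inner_e_incl] at h
  nlinarith [sq_nonneg ‖⟪F.e, y⟫ • F.e‖]

theorem lipschitzWith_proj : LipschitzWith 1 F.proj :=
  LipschitzWith.of_dist_le_mul fun x y => by
    rw [dist_eq_norm, dist_eq_norm, ← map_sub, NNReal.coe_one, one_mul]
    exact F.norm_proj_le _

theorem exists_frame (hd : Module.finrank ℝ E = Module.finrank ℝ H + 1) {e : E} (he : ‖e‖ = 1) :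
    ∃ F : Frame H E, F.e = e := by
  have : Fact (Module.finrank ℝ E = Module.finrank ℝ H + 1) := ⟨hd⟩
  have he0 : e ≠ 0 := by
    intro h
    simp [h] at he
  have hr : Module.finrank ℝ (ℝ ∙ e)ᗮ = Module.finrank ℝ H :=
    Submodule.finrank_orthogonal_span_singleton he0
  let i : H ≃ₗᵢ[ℝ] (ℝ ∙ e)ᗮ := ((stdOrthonormalBasis ℝ H).reindex
    (finCongr hr.symm)).equiv (stdOrthonormalBasis ℝ (ℝ ∙ e)ᗮ) (Equiv.refl _)
  refine ⟨⟨(ℝ ∙ e)ᗮ.subtypeₗᵢ.comp i.toLinearIsometry, e, he, fun u => ?_, hd⟩, rfl⟩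
  exact Submodule.mem_orthogonal_singleton_iff_inner_right.1 (i u).2

section Measure

variable [MeasurableSpace H] [BorelSpace H] [MeasurableSpace E] [BorelSpace E]

theorem measurePreserving_coord :
    MeasurePreserving (fun z : H × ℝ => F.incl z.1 + z.2 • F.e) := by
  have h := F.isometryEquiv.measurePreserving.comp (WithLp.volume_preserving_toLp H ℝ)
  exact h

theorem measurableEmbedding_coord :
    MeasurableEmbedding (fun z : H × ℝ => F.incl z.1 + z.2 • F.e) := by
  have h1 : MeasurableEmbedding F.isometryEquiv :=
    F.isometryEquiv.toHomeomorph.measurableEmbedding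
  exact h1.comp (MeasurableEquiv.toLp 2 (H × ℝ)).measurableEmbedding

theorem volume_level (r : ℝ) : volume {y : E | ⟪F.e, y⟫ = r} = 0 := by
  have hm : MeasurableSet {y : E | ⟪F.e, y⟫ = r} :=
    (isClosed_eq (by fun_prop) continuous_const).measurableSet
  rw [← F.measurePreserving_coord.measure_preimage hm.nullMeasurableSet]
  have : (fun z : H × ℝ => F.incl z.1 + z.2 • F.e) ⁻¹' {y : E | ⟪F.e, y⟫ = r}
      = univ ×ˢ {r} := by
    ext z
    simp [inner_add_right, inner_smul_right, F.inner_e_incl, F.norm_e]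
  rw [this, Measure.volume_eq_prod, Measure.prod_prod]
  simp

theorem ae_proj {P : H → Prop} (h : ∀ᵐ u, P u) : ∀ᵐ y : E, P (F.proj y) := by
  have h1 : ∀ᵐ z : H × ℝ, P z.1 := Measure.quasiMeasurePreserving_fst.ae h
  have h2 := F.measurePreserving_coord.map_eq
  rw [← h2, F.measurableEmbedding_coord.ae_map_iff]
  filter_upwards [h1] with z hz
  simpa using hz

/-- Fubini's theorem on a slab of height one. -/
theorem setIntegral_slab (h : H → ℝ) :
    ∫ y in {y : E | ⟪F.e, y⟫ ∈ Ioo (-1 : ℝ) 0}, h (F.proj y) = ∫ u, h u := by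
  have hm : MeasurableSet {y : E | ⟪F.e, y⟫ ∈ Ioo (-1 : ℝ) 0} :=
    measurableSet_Ioo.preimage (by fun_prop : Measurable fun y : E => ⟪F.e, y⟫)
  rw [← F.measurePreserving_coord.setIntegral_preimage_emb F.measurableEmbedding_coord]
  have : (fun z : H × ℝ => F.incl z.1 + z.2 • F.e) ⁻¹' {y : E | ⟪F.e, y⟫ ∈ Ioo (-1 : ℝ) 0}
      = univ ×ˢ Ioo (-1 : ℝ) 0 := by
    ext z
    simp [inner_add_right, inner_smul_right, F.inner_e_incl, F.norm_e]
  rw [this, Measure.volume_eq_prod]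
  have h2 := setIntegral_prod_mul (μ := (volume : Measure H)) (ν := (volume : Measure ℝ))
    h (fun _ => (1 : ℝ)) univ (Ioo (-1) 0)
  simp only [mul_one] at h2
  simp only [map_add, proj_incl, map_smul, proj_e, smul_zero, add_zero]
  rw [h2]
  simp

end Measure

/-! ### The area formula for Lipschitz graphs -/

/-- The parametrisation of the graph of `φ`. -/
def graphMap (φ : H → ℝ) (u : H) : E := F.incl u + φ u • F.e

/-- The derivative of `graphMap` at a point where `φ` has the derivative `ℓ`. -/
def graphMapDeriv (ℓ : H →L[ℝ] ℝ) : H →L[ℝ] E :=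
  F.incl.toContinuousLinearMap + ℓ.smulRight F.e

/-- The density of the surface measure of the graph of `φ`. -/
def graphDensity (φ : H → ℝ) (u : H) : ℝ := √(1 + ‖fderiv ℝ φ u‖ ^ 2)

variable {φ : H → ℝ} {K : ℝ≥0}

@[simp]
theorem proj_graphMap (u : H) : F.proj (F.graphMap φ u) = u := by simp [graphMap]

@[simp]
theorem inner_e_graphMap (u : H) : ⟪F.e, F.graphMap φ u⟫ = φ u := by
  simp [graphMap, inner_add_right, inner_smul_right, F.inner_e_incl, F.norm_e]

theorem graphMap_proj (y : E) : F.graphMap φ (F.proj y) = y + (φ (F.proj y) - ⟪F.e, y⟫) • F.e := by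
  rw [graphMap, incl_proj]; module

theorem mem_range_graphMap {y : E} : y ∈ range (F.graphMap φ) ↔ φ (F.proj y) = ⟪F.e, y⟫ := by
  constructor
  · rintro ⟨u, rfl⟩; simp
  · intro h
    exact ⟨F.proj y, by rw [graphMap_proj, h]; simp⟩

theorem lipschitzWith_graphMap (hφ : LipschitzWith K φ) : LipschitzWith (1 + K) (F.graphMap φ) := by
  refine F.incl.lipschitz.add (LipschitzWith.of_dist_le_mul fun x y => ?_)
  rw [dist_eq_norm, ← sub_smul, norm_smul, F.norm_e, mul_one, ← dist_eq_norm]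
  exact hφ.dist_le_mul x y

theorem isClosedEmbedding_graphMap (hφ : Continuous φ) :
    Topology.IsClosedEmbedding (F.graphMap φ) := by
  refine Topology.IsClosedEmbedding.of_continuous_injective_isClosedMap ?_ ?_ ?_
  · unfold graphMap
    have := F.incl.continuous
    fun_prop
  · exact Function.LeftInverse.injective F.proj_graphMap
  · intro s hs
    have : F.graphMap φ '' s = F.proj ⁻¹' s ∩ {y | φ (F.proj y) = ⟪F.e, y⟫} := by
      ext y
      constructor
      · rintro ⟨u, hu, rfl⟩
        exact ⟨by simpa using hu, by simp⟩
      · rintro ⟨h1, h2⟩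
        obtain ⟨u, rfl⟩ := F.mem_range_graphMap.2 h2
        exact ⟨u, by simpa using h1, rfl⟩
    rw [this]
    exact (hs.preimage F.proj.continuous).inter
      (isClosed_eq (hφ.comp F.proj.continuous) (by fun_prop))

theorem hasFDerivAt_graphMap {ℓ : H →L[ℝ] ℝ} {u : H} (h : HasFDerivAt φ ℓ u) :
    HasFDerivAt (F.graphMap φ) (F.graphMapDeriv ℓ) u :=
  F.incl.toContinuousLinearMap.hasFDerivAt.add (h.smul_const F.e)

theorem norm_sq_graphMapDeriv (ℓ : H →L[ℝ] ℝ) (v : H) :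
    ‖F.graphMapDeriv ℓ v‖ ^ 2 = ‖v‖ ^ 2 + ℓ v ^ 2 := by
  have : F.graphMapDeriv ℓ v = F.incl v + ℓ v • F.e := rfl
  rw [this, norm_add_sq_real, inner_smul_right, real_inner_comm, F.inner_e_incl, norm_smul,
    F.norm_e, F.incl.norm_map]
  simp

theorem norm_le_norm_graphMapDeriv (ℓ : H →L[ℝ] ℝ) (v : H) : ‖v‖ ≤ ‖F.graphMapDeriv ℓ v‖ := by
  rw [← sq_le_sq₀ (norm_nonneg _) (norm_nonneg _), norm_sq_graphMapDeriv]
  nlinarith [sq_nonneg (ℓ v)]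

/-- The Jacobian factor of a graph: the Gram matrix of its parametrisation is `1 + ℓᵀ ℓ`. -/
theorem normDet_graphMapDeriv (ℓ : H →L[ℝ] ℝ) :
    (F.graphMapDeriv ℓ : H →ₗ[ℝ] E).normDet = √(1 + ‖ℓ‖ ^ 2) := by
  obtain ⟨n, rfl⟩ := (InnerProductSpace.toDual ℝ H).surjective ℓ
  rw [eq_comm, Real.sqrt_eq_iff_mul_self_eq (by positivity) (LinearMap.normDet_nonneg _), ← sq]
  have h := ContinuousLinearMap.normDet_sq (𝕜 := ℝ) (F.graphMapDeriv (InnerProductSpace.toDual ℝ H n))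
  have h2 : (ContinuousLinearMap.adjoint (F.graphMapDeriv (InnerProductSpace.toDual ℝ H n)))
      ∘L (F.graphMapDeriv (InnerProductSpace.toDual ℝ H n)) = 1 + rankOne ℝ n n := by
    ext1 v
    refine ext_inner_right ℝ fun w => ?_
    rw [ContinuousLinearMap.comp_apply, ContinuousLinearMap.adjoint_inner_left]
    simp [graphMapDeriv, inner_add_left, inner_add_right, inner_smul_left, inner_smul_right,
      F.inner_e_incl, F.norm_e, real_inner_comm F.e, mul_comm]
  rw [h2, det_one_add_rankOne, real_inner_self_eq_norm_sq] at h
  rw [LinearIsometryEquiv.norm_map]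
  exact h.symm

section Area

variable [MeasurableSpace H] [BorelSpace H] [MeasurableSpace E] [BorelSpace E]

local notation "HE" => Measure.euclideanHausdorffMeasure (Module.finrank ℝ H)

/-- A piece of the graph on which the parametrisation is nearly affine has nearly the measure of
its affine approximation. -/
theorem measure_graphMap_image_of_approximatesLinearOn {ℓ : H →L[ℝ] ℝ} {t : Set H} {δ : ℝ≥0}
    (hδ : δ < 1) (h : ApproximatesLinearOn (F.graphMap φ) (F.graphMapDeriv ℓ) t δ) :
    HE (F.graphMap φ '' t) ≤ ((1 + δ : ℝ≥0) : ENNReal) ^ (Module.finrank ℝ H)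
        * (ENNReal.ofReal √(1 + ‖ℓ‖ ^ 2) * volume t) ∧
      ENNReal.ofReal √(1 + ‖ℓ‖ ^ 2) * volume t
        ≤ (((1 - δ)⁻¹ : ℝ≥0) : ENNReal) ^ (Module.finrank ℝ H) * HE (F.graphMap φ '' t) := by
  set A := F.graphMapDeriv ℓ
  have hvol : HE (A '' t) = ENNReal.ofReal √(1 + ‖ℓ‖ ^ 2) * volume t := by
    have := LinearMap.euclideanHausdorffMeasure_image_eq_normDet_mul_volume
      (A : H →ₗ[ℝ] E) t
    rw [F.normDet_graphMapDeriv] at this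
    exact this
  have hinj : Function.Injective A := by
    refine (injective_iff_map_eq_zero A).2 fun v hv => ?_
    have := F.norm_le_norm_graphMapDeriv ℓ v
    rw [show F.graphMapDeriv ℓ v = 0 from hv, norm_zero] at this
    exact norm_le_zero_iff.1 this
  have hest : ∀ x ∈ t, ∀ y ∈ t, ‖F.graphMap φ x - F.graphMap φ y - A (x - y)‖
      ≤ δ * ‖A (x - y)‖ := fun x hx y hy => (h x hx y hy).trans (by
    gcongr; exact F.norm_le_norm_graphMapDeriv ℓ _)
  constructor
  · have hlip : LipschitzOnWith (1 + δ) (F.graphMap φ ∘ Function.invFun A) (A '' t) := by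
      refine LipschitzOnWith.of_dist_le_mul ?_
      rintro _ ⟨x, hx, rfl⟩ _ ⟨y, hy, rfl⟩
      simp only [Function.comp_apply, Function.leftInverse_invFun hinj _]
      rw [dist_eq_norm, dist_eq_norm, ← map_sub]
      have h1 := hest x hx y hy
      have h2 := norm_add_le (F.graphMap φ x - F.graphMap φ y - A (x - y)) (A (x - y))
      rw [sub_add_cancel] at h2
      push_cast
      linarith
    have himg : (F.graphMap φ ∘ Function.invFun A) '' (A '' t) = F.graphMap φ '' t := by
      rw [image_image]
      exact image_congr fun x _ => by
        simp only [Function.comp_apply, Function.leftInverse_invFun hinj _]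
    have := euclideanHausdorffMeasure_image_le hlip (Module.finrank ℝ H)
    rwa [himg, hvol] at this
  · have hlip : LipschitzOnWith (1 - δ)⁻¹ (A ∘ F.proj) (F.graphMap φ '' t) := by
      refine LipschitzOnWith.of_dist_le_mul ?_
      rintro _ ⟨x, hx, rfl⟩ _ ⟨y, hy, rfl⟩
      simp only [Function.comp_apply, proj_graphMap]
      rw [dist_eq_norm, dist_eq_norm, ← map_sub]
      have h1 := hest x hx y hy
      have h2 := norm_sub_le (F.graphMap φ x - F.graphMap φ y)
        (F.graphMap φ x - F.graphMap φ y - A (x - y))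
      rw [sub_sub_cancel] at h2
      have h3 : (0 : ℝ) < 1 - δ := sub_pos.2 (by exact_mod_cast hδ)
      rw [NNReal.coe_inv, NNReal.coe_sub hδ.le, NNReal.coe_one, ← div_eq_inv_mul, le_div_iff₀ h3]
      linarith
    have himg : (A ∘ F.proj) '' (F.graphMap φ '' t) = A '' t := by
      rw [image_image]
      exact image_congr fun x _ => by simp
    have := euclideanHausdorffMeasure_image_le hlip (Module.finrank ℝ H)
    rwa [himg, hvol] at this

/-- Bounds for the area of a piece of a Lipschitz graph by bounds of the density. Up to a factor
close to `1`, the graph map is affine on each of countably many pieces. -/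
theorem measure_graphMap_image_of_density (hφ : LipschitzWith K φ) {s : Set H}
    (hs : MeasurableSet s) (hd : ∀ u ∈ s, DifferentiableAt ℝ φ u) (q : ENNReal) :
    ((∀ u ∈ s, ENNReal.ofReal (graphDensity φ u) ≤ q) →
      HE (F.graphMap φ '' s) ≤ q * volume s) ∧
    ((∀ u ∈ s, q ≤ ENNReal.ofReal (graphDensity φ u)) →
      q * volume s ≤ HE (F.graphMap φ '' s)) := by
  rcases s.eq_empty_or_nonempty with rfl | hne
  · simp
  have hemb := F.isClosedEmbedding_graphMap hφ.continuous
  have hder : ∀ u ∈ s, HasFDerivWithinAt (F.graphMap φ) (F.graphMapDeriv (fderiv ℝ φ u)) s u :=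
    fun u hu => (F.hasFDerivAt_graphMap (hd u hu).hasFDerivAt).hasFDerivWithinAt
  -- a decomposition into countably many nearly affine pieces, for each error `δ`
  have hpart : ∀ δ : ℝ≥0, 0 < δ → ∃ (t : ℕ → Set H) (ℓ : ℕ → H →L[ℝ] ℝ),
      Pairwise (Function.onFun Disjoint t) ∧ (∀ n, MeasurableSet (t n)) ∧ (⋃ n, t n = s) ∧
      (∀ n, ApproximatesLinearOn (F.graphMap φ) (F.graphMapDeriv (ℓ n)) (t n) δ) ∧
      ∀ n, ∃ y ∈ s, ℓ n = fderiv ℝ φ y := by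
    intro δ hδ
    obtain ⟨t, A, h1, h2, h3, h4, h5⟩ := exists_partition_approximatesLinearOn_of_hasFDerivWithinAt
      (F.graphMap φ) s (fun u => F.graphMapDeriv (fderiv ℝ φ u)) hder (fun _ => δ)
      (fun _ => hδ.ne')
    choose y hys hA using h5 hne
    refine ⟨fun n => s ∩ t n, fun n => fderiv ℝ φ (y n), ?_, fun n => hs.inter (h2 n), ?_,
      fun n => ?_, fun n => ⟨y n, hys n, rfl⟩⟩
    · exact fun i j hij => (h1 hij).mono inter_subset_right inter_subset_right
    · rw [← inter_iUnion, inter_eq_left.2 h3]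
    · rw [← hA n]; exact h4 n
  have hvol : ∀ t : ℕ → Set H, Pairwise (Function.onFun Disjoint t) →
      (∀ n, MeasurableSet (t n)) → (⋃ n, t n = s) →
      volume s = ∑' n, volume (t n) ∧
        HE (F.graphMap φ '' s) = ∑' n, HE (F.graphMap φ '' t n) := by
    intro t h1 h2 h3
    rw [← h3, image_iUnion]
    refine ⟨measure_iUnion h1 h2, measure_iUnion (fun i j hij => ?_) fun n => ?_⟩
    · exact (disjoint_image_iff hemb.injective).2 (h1 hij)
    · exact hemb.measurableEmbedding.measurableSet_image.2 (h2 n)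
  constructor
  · intro hq
    have hle : ∀ᶠ δ : ℝ≥0 in 𝓝[>] 0, HE (F.graphMap φ '' s)
        ≤ ((1 + δ : ℝ≥0) : ENNReal) ^ (Module.finrank ℝ H) * (q * volume s) := by
      filter_upwards [Ioo_mem_nhdsGT (zero_lt_one' ℝ≥0)] with δ hδ
      obtain ⟨t, ℓ, h1, h2, h3, h4, h5⟩ := hpart δ hδ.1
      obtain ⟨v1, v2⟩ := hvol t h1 h2 h3
      rw [v2, v1, ← ENNReal.tsum_mul_left, ← ENNReal.tsum_mul_left]
      refine ENNReal.tsum_le_tsum fun n => ?_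
      refine (F.measure_graphMap_image_of_approximatesLinearOn hδ.2 (h4 n)).1.trans ?_
      obtain ⟨y, hy, he⟩ := h5 n
      gcongr
      rw [he]; exact hq y hy
    refine ge_of_tendsto (x := 𝓝[>] (0 : ℝ≥0)) ?_ hle
    have hc : Continuous fun δ : ℝ≥0 => ((1 + δ : ℝ≥0) : ENNReal) ^ (Module.finrank ℝ H) := by
      exact (ENNReal.continuous_pow _).comp (ENNReal.continuous_coe.comp (by fun_prop))
    have := (hc.tendsto 0).mono_left (nhdsWithin_le_nhds (s := Ioi 0))
    have h2 := ENNReal.Tendsto.mul_const this (b := q * volume s) (Or.inl (by simp))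
    simpa using h2
  · intro hq
    have hle : ∀ᶠ δ : ℝ≥0 in 𝓝[>] 0, q * volume s ≤
        (((1 - δ)⁻¹ : ℝ≥0) : ENNReal) ^ (Module.finrank ℝ H) * HE (F.graphMap φ '' s) := by
      filter_upwards [Ioo_mem_nhdsGT (zero_lt_one' ℝ≥0)] with δ hδ
      obtain ⟨t, ℓ, h1, h2, h3, h4, h5⟩ := hpart δ hδ.1
      obtain ⟨v1, v2⟩ := hvol t h1 h2 h3
      rw [v2, v1, ← ENNReal.tsum_mul_left, ← ENNReal.tsum_mul_left]
      refine ENNReal.tsum_le_tsum fun n => ?_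
      refine le_trans ?_ (F.measure_graphMap_image_of_approximatesLinearOn hδ.2 (h4 n)).2
      obtain ⟨y, hy, he⟩ := h5 n
      gcongr
      rw [he]; exact hq y hy
    refine ge_of_tendsto (x := 𝓝[>] (0 : ℝ≥0)) ?_ hle
    have hc : ContinuousAt (fun δ : ℝ≥0 =>
        (((1 - δ)⁻¹ : ℝ≥0) : ENNReal) ^ (Module.finrank ℝ H)) 0 := by
      refine (ENNReal.continuous_pow _).continuousAt.comp
        (ENNReal.continuous_coe.continuousAt.comp ?_)
      exact (continuous_const.sub continuous_id).continuousAt.inv₀ (by simp)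
    have := hc.tendsto.mono_left (nhdsWithin_le_nhds (s := Ioi 0))
    have h2 := ENNReal.Tendsto.mul_const this (b := HE (F.graphMap φ '' s)) (Or.inl (by simp))
    simpa using h2

/-- A measure which is squeezed between multiples of `μ` by the bounds of `f` is `f • μ`. -/
theorem eq_withDensity_of_bounds {α : Type*} [MeasurableSpace α] {μ ν : Measure α}
    {f : α → ENNReal} (hf : Measurable f) (h0 : ∀ x, f x ≠ 0) (htop : ∀ x, f x ≠ ⊤)
    (hub : ∀ s, MeasurableSet s → ∀ q, (∀ x ∈ s, f x ≤ q) → ν s ≤ q * μ s)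
    (hlb : ∀ s, MeasurableSet s → ∀ q, (∀ x ∈ s, q ≤ f x) → q * μ s ≤ ν s) :
    ν = μ.withDensity f := by
  ext s hs
  have hub' : ∀ s, MeasurableSet s → ∀ q, (∀ x ∈ s, f x ≤ q) →
      μ.withDensity f s ≤ q * μ s := fun s hs q h => by
    rw [withDensity_apply _ hs, ← setLIntegral_const]
    exact setLIntegral_mono' hs h
  have hlb' : ∀ s, MeasurableSet s → ∀ q, (∀ x ∈ s, q ≤ f x) →
      q * μ s ≤ μ.withDensity f s := fun s hs q h => by
    rw [withDensity_apply _ hs, ← setLIntegral_const]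
    exact setLIntegral_mono' hs h
  have key : ∀ ν₁ ν₂ : Measure α,
      (∀ s, MeasurableSet s → ∀ q, (∀ x ∈ s, f x ≤ q) → ν₁ s ≤ q * μ s) →
      (∀ s, MeasurableSet s → ∀ q, (∀ x ∈ s, q ≤ f x) → q * μ s ≤ ν₂ s) →
      ν₁ s ≤ ν₂ s := by
    intro ν₁ ν₂ h1 h2
    have hle : ∀ᶠ t : ℝ≥0 in 𝓝[>] 1, ν₁ s ≤ (t : ENNReal) * ν₂ s := by
      filter_upwards [self_mem_nhdsWithin] with t ht
      have ht : 1 < t := ht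
      have ht0 : (t : ENNReal) ≠ 0 := by
        have : t ≠ 0 := (zero_lt_one.trans ht).ne'
        exact_mod_cast this
      have z0 : f ⁻¹' {0} = ∅ := by ext x; simp [h0 x]
      have z1 : f ⁻¹' {⊤} = ∅ := by ext x; simp [htop x]
      rw [measure_eq_measure_preimage_add_measure_tsum_Ico_zpow ν₁ hf hs ht,
        measure_eq_measure_preimage_add_measure_tsum_Ico_zpow ν₂ hf hs ht, z0, z1]
      simp only [inter_empty, measure_empty, zero_add]
      rw [← ENNReal.tsum_mul_left]
      refine ENNReal.tsum_le_tsum fun n => ?_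
      have hm : MeasurableSet (s ∩ f ⁻¹' Ico ((t : ENNReal) ^ n) ((t : ENNReal) ^ (n + 1))) :=
        hs.inter (hf measurableSet_Ico)
      have he : (t : ENNReal) ^ (n + 1) = t * (t : ENNReal) ^ n := by
        rw [ENNReal.zpow_add ht0 ENNReal.coe_ne_top, zpow_one, mul_comm]
      calc _ ≤ (t : ENNReal) ^ (n + 1) * μ _ := h1 _ hm _ fun x hx => hx.2.2.le
        _ = t * ((t : ENNReal) ^ n * μ _) := by rw [← mul_assoc, ← he]
        _ ≤ _ := by gcongr; exact h2 _ hm _ fun x hx => hx.2.1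
    refine ge_of_tendsto (x := 𝓝[>] (1 : ℝ≥0)) ?_ hle
    have := (ENNReal.continuous_coe.tendsto (1 : ℝ≥0)).mono_left
      (nhdsWithin_le_nhds (s := Ioi 1))
    have h2 := ENNReal.Tendsto.mul_const this (b := ν₂ s) (Or.inl (by simp))
    simpa using h2
  exact le_antisymm (key _ _ hub hlb') (key _ _ hub' hlb)

theorem graphDensity_pos (φ : H → ℝ) (u : H) : 0 < graphDensity φ u :=
  Real.sqrt_pos.2 (by positivity)

theorem measurable_graphDensity (φ : H → ℝ) : Measurable (graphDensity φ) := by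
  unfold graphDensity
  have := (measurable_fderiv ℝ φ).norm
  fun_prop

/-- The area formula: the surface measure on the graph of a Lipschitz function. -/
theorem restrict_range_graphMap (hφ : LipschitzWith K φ) :
    (HE : Measure E).restrict (range (F.graphMap φ))
      = ((volume : Measure H).withDensity fun u => ENNReal.ofReal (graphDensity φ u)).map
          (F.graphMap φ) := by
  have hemb := (F.isClosedEmbedding_graphMap hφ.continuous).measurableEmbedding
  rw [← hemb.map_comap]
  congr 1
  let D := {u | DifferentiableAt ℝ φ u}
  have hD : MeasurableSet D := measurableSet_of_differentiableAt ℝ φ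
  have hDn : volume Dᶜ = 0 := ae_iff.1 hφ.ae_differentiableAt
  have hnull : ∀ s : Set H, HE (F.graphMap φ '' (s \ D)) = 0 := by
    intro s
    have h := euclideanHausdorffMeasure_image_le
      ((F.lipschitzWith_graphMap hφ).lipschitzOnWith (s := s \ D)) (Module.finrank ℝ H)
    rw [InnerProductSpace.euclideanHausdorffMeasure_eq_volume,
      measure_mono_null (fun x hx => hx.2 : s \ D ⊆ Dᶜ) hDn, mul_zero] at h
    exact le_antisymm h bot_le
  have himg : ∀ s : Set H, HE (F.graphMap φ '' s) = HE (F.graphMap φ '' (s ∩ D)) := by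
    intro s
    refine le_antisymm ?_ (measure_mono (image_mono inter_subset_left))
    conv_lhs => rw [← inter_union_sdiff s D, image_union]
    exact (measure_union_le _ _).trans (by rw [hnull, add_zero])
  have hvol : ∀ s : Set H, volume s = volume (s ∩ D) := fun s =>
    (measure_inter_conull hDn).symm
  refine eq_withDensity_of_bounds (measurable_graphDensity φ).ennreal_ofReal
    (fun u => by simpa using graphDensity_pos φ u) (fun u => ENNReal.ofReal_ne_top)
    (fun s hs q h => ?_) (fun s hs q h => ?_)
  · rw [hemb.comap_apply, himg, hvol]
    exact (F.measure_graphMap_image_of_density hφ (hs.inter hD) (fun u hu => hu.2) q).1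
      fun u hu => h u hu.1
  · rw [hemb.comap_apply, himg, hvol]
    exact (F.measure_graphMap_image_of_density hφ (hs.inter hD) (fun u hu => hu.2) q).2
      fun u hu => h u hu.1

end Area

end Frame

/-! ### The first variation of the determinant on the region above a graph -/

theorem integrable_detDeriv_fderiv {E : Type*} [NormedAddCommGroup E] [InnerProductSpace ℝ E]
    [FiniteDimensional ℝ E] [MeasurableSpace E] [BorelSpace E] {K L : ℝ≥0} {T W : E → E}
    (hT : LipschitzWith K T) (hW : LipschitzWith L W) (hWc : HasCompactSupport W) :
    Integrable (fun x => detDeriv (fderiv ℝ T x) (fderiv ℝ W x)) := by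
  have hsupp : Function.support (fun x => detDeriv (fderiv ℝ T x) (fderiv ℝ W x))
      ⊆ tsupport W := by
    intro x hx
    refine support_fderiv_subset ℝ (f := W) fun h0 => hx ?_
    simp only [h0]
    simp [detDeriv]
  rw [← integrableOn_iff_integrable_of_support_subset hsupp]
  have : IsFiniteMeasure (volume.restrict (tsupport W)) :=
    ⟨by simpa using hWc.isCompact.measure_lt_top⟩
  exact integrable_continuous_comp continuous_detDeriv
    ((aestronglyMeasurable_fderiv T _).prodMk (aestronglyMeasurable_fderiv W _))
    (R := max K L) (Eventually.of_forall fun x => max_le_max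
      (norm_fderiv_le_of_lipschitz' hT x) (norm_fderiv_le_of_lipschitz' hW x))

theorem integrableOn_detDeriv_fderiv {E : Type*} [NormedAddCommGroup E] [InnerProductSpace ℝ E]
    [FiniteDimensional ℝ E] [MeasurableSpace E] [BorelSpace E] {K L : ℝ≥0} {T W : E → E}
    (hT : LipschitzWith K T) (hW : LipschitzWith L W) {s : Set E} (hs : volume s ≠ ⊤) :
    IntegrableOn (fun x => detDeriv (fderiv ℝ T x) (fderiv ℝ W x)) s := by
  have : IsFiniteMeasure (volume.restrict s) := ⟨by simpa using hs.lt_top⟩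
  exact integrable_continuous_comp continuous_detDeriv
    ((aestronglyMeasurable_fderiv T _).prodMk (aestronglyMeasurable_fderiv W _))
    (R := max K L) (Eventually.of_forall fun x => max_le_max
      (norm_fderiv_le_of_lipschitz' hT x) (norm_fderiv_le_of_lipschitz' hW x))

theorem exists_lipschitzWith_smul {X F : Type*} [PseudoMetricSpace X] [NormedAddCommGroup F]
    [NormedSpace ℝ F] {f : X → ℝ} {g : X → F} {K L : ℝ≥0} {a b : ℝ} (hf : LipschitzWith K f)
    (hg : LipschitzWith L g) (ha : ∀ x, |f x| ≤ a) (hb : ∀ x, f x ≠ 0 → ‖g x‖ ≤ b) :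
    ∃ M, LipschitzWith M fun x => f x • g x := by
  refine ⟨(|a| * L + K * |b|).toNNReal, LipschitzWith.of_dist_le_mul fun x y => ?_⟩
  rw [Real.coe_toNNReal _ (by positivity)]
  wlog hy : f y ≠ 0 generalizing x y
  · by_cases hx : f x ≠ 0
    · rw [dist_comm, dist_comm x y]
      exact this y x hx
    · rw [not_not.1 hy, not_not.1 hx, zero_smul, zero_smul, dist_self]
      positivity
  have e : f x • g x - f y • g y = f x • (g x - g y) + (f x - f y) • g y := by module
  rw [dist_eq_norm, e]
  refine (norm_add_le _ _).trans ?_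
  rw [norm_smul, norm_smul, add_mul, ← dist_eq_norm, ← dist_eq_norm, Real.norm_eq_abs]
  have h1 := hf.dist_le_mul x y
  have h2 := hg.dist_le_mul x y
  have h3 := (ha x).trans (le_abs_self a)
  have h4 := (hb y hy).trans (le_abs_self b)
  calc |f x| * dist (g x) (g y) + dist (f x) (f y) * ‖g y‖
      ≤ |a| * (L * dist x y) + (K * dist x y) * |b| := by gcongr
    _ = _ := by ring

namespace Frame

open InnerProductSpace (rankOne)

variable {H E : Type*} [NormedAddCommGroup H] [InnerProductSpace ℝ H] [FiniteDimensional ℝ H]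
  [NormedAddCommGroup E] [InnerProductSpace ℝ E] [FiniteDimensional ℝ E] (F : Frame H E)

variable {φ : H → ℝ} {K : ℝ≥0}

/-- The open region above the graph of `φ`. -/
def epigraph (φ : H → ℝ) : Set E := {y | φ (F.proj y) < ⟪F.e, y⟫}

/-- The vertical shear that maps the hyperplane to the graph of `φ`. -/
def shear (φ : H → ℝ) (y : E) : E := y + φ (F.proj y) • F.e

/-- The retraction onto the upper half-space along `e`. -/
def retract (y : E) : E := y - min ⟪F.e, y⟫ 0 • F.e

theorem proj_shear (y : E) : F.proj (F.shear φ y) = F.proj y := by simp [shear]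

theorem inner_e_shear (y : E) : ⟪F.e, F.shear φ y⟫ = ⟪F.e, y⟫ + φ (F.proj y) := by
  simp [shear, inner_add_right, inner_smul_right, F.norm_e]

theorem shear_neg_shear (y : E) : F.shear (-φ) (F.shear φ y) = y := by
  rw [shear, proj_shear, shear]; simp

theorem shear_shear_neg (y : E) : F.shear φ (F.shear (-φ) y) = y := by
  have := F.shear_neg_shear (φ := -φ) y
  rwa [neg_neg] at this

theorem bijective_shear : Function.Bijective (F.shear φ) :=
  ⟨Function.LeftInverse.injective F.shear_neg_shear,
    Function.RightInverse.surjective F.shear_shear_neg⟩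

theorem lipschitzWith_inner_e : LipschitzWith 1 fun y => ⟪F.e, y⟫ :=
  LipschitzWith.of_dist_le_mul fun x y => by
    rw [Real.dist_eq, ← inner_sub_right, NNReal.coe_one, one_mul, dist_eq_norm]
    refine (abs_real_inner_le_norm _ _).trans ?_
    rw [F.norm_e, one_mul]

theorem lipschitzWith_smul_e {X : Type*} [PseudoMetricSpace X] {f : X → ℝ} {L : ℝ≥0}
    (hf : LipschitzWith L f) : LipschitzWith L fun y => f y • F.e :=
  LipschitzWith.of_dist_le_mul fun x y => by
    rw [dist_eq_norm, ← sub_smul, norm_smul, F.norm_e, mul_one, ← dist_eq_norm]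
    exact hf.dist_le_mul x y

theorem lipschitzWith_shear (hφ : LipschitzWith K φ) : LipschitzWith (1 + K) (F.shear φ) := by
  have h := F.lipschitzWith_smul_e (hφ.comp F.lipschitzWith_proj)
  rw [mul_one] at h
  exact LipschitzWith.id.add h

theorem lipschitzWith_retract : LipschitzWith 2 F.retract := by
  have h := F.lipschitzWith_smul_e (F.lipschitzWith_inner_e.min_const 0)
  have := (LipschitzWith.id (α := E)).sub h
  exact this.weaken (by norm_num)

theorem shear_image_halfSpace : F.shear φ '' {y | 0 < ⟪F.e, y⟫} = F.epigraph φ := by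
  ext y
  constructor
  · rintro ⟨z, hz, rfl⟩
    have hz : 0 < ⟪F.e, z⟫ := hz
    rw [epigraph, mem_ofPred_eq, proj_shear, inner_e_shear]
    linarith
  · intro hy
    refine ⟨F.shear (-φ) y, ?_, F.shear_shear_neg y⟩
    have hy : φ (F.proj y) < ⟪F.e, y⟫ := hy
    rw [mem_ofPred_eq, inner_e_shear, Pi.neg_apply]
    linarith

theorem isOpen_epigraph (hφ : Continuous φ) : IsOpen (F.epigraph φ) :=
  isOpen_lt (hφ.comp F.proj.continuous) (by fun_prop)

theorem det_fderiv_shear {y : E} (h : DifferentiableAt ℝ (fun y => φ (F.proj y)) y) :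
    (fderiv ℝ (F.shear φ) y).det = 1 := by
  set ℓ := fderiv ℝ (fun y => φ (F.proj y)) y
  obtain ⟨q, hq⟩ := (InnerProductSpace.toDual ℝ E).surjective ℓ
  have h1 : HasFDerivAt (F.shear φ) (1 + rankOne ℝ F.e q) y := by
    refine ((hasFDerivAt_id y).add (h.hasFDerivAt.smul_const F.e)).congr_fderiv ?_
    ext v
    change v + ℓ v • F.e = _
    rw [← hq]
    simp
  rw [h1.fderiv, det_one_add_rankOne]
  -- the gradient is horizontal, as `φ ∘ proj` does not change along `e`
  have h2 : ⟪q, F.e⟫ = ℓ F.e := by rw [← hq]; rfl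
  have h3 : HasDerivAt (fun τ : ℝ => φ (F.proj (y + τ • F.e))) (ℓ F.e) 0 := by
    have h4 : HasFDerivAt (fun y => φ (F.proj y)) ℓ (y + (0 : ℝ) • F.e) := by
      simpa using h.hasFDerivAt
    have h5 : HasDerivAt (fun τ : ℝ => y + τ • F.e) F.e 0 := by
      simpa using ((hasDerivAt_id (0 : ℝ)).smul_const F.e).const_add y
    exact h4.comp_hasDerivAt 0 h5
  have h6 : (fun τ : ℝ => φ (F.proj (y + τ • F.e))) = fun _ => φ (F.proj y) := by
    ext τ; simp
  rw [h6] at h3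
  rw [h2, h3.unique (hasDerivAt_const _ _), add_zero]

section Measure

variable [MeasurableSpace H] [BorelSpace H] [MeasurableSpace E] [BorelSpace E]

theorem ae_shear {P : E → Prop} (hφ : LipschitzWith K φ) (h : ∀ᵐ y, P y) :
    ∀ᵐ y, P (F.shear φ y) := by
  rw [ae_iff] at h ⊢
  refine measure_mono_null ?_ (volume_image_eq_zero_of_lipschitz
    (F.lipschitzWith_shear (φ := -φ) hφ.neg) h)
  intro y hy
  exact ⟨F.shear φ y, hy, F.shear_neg_shear y⟩

/-- On the region above the graph of `φ`, the integral of the first variation of the determinant is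
a boundary integral. The fields are straightened by a shear and extended below the boundary, `T`
constantly and `W` by a linear decay, along the vertical direction. The null Lagrangian property
then makes the integral over the half-space equal to the one over the slab of height one below, and
the latter is a boundary integral because nothing but the decay of `W` depends on the height. In
particular no trace of `fderiv ℝ T` on the boundary is needed. -/
theorem setIntegral_epigraph_detDeriv (hφ : LipschitzWith K φ) {KT KW : ℝ≥0} {T W : E → E}
    (hT : LipschitzWith KT T) (hW : LipschitzWith KW W) (hWc : HasCompactSupport W) :
    ∫ y in F.epigraph φ, detDeriv (fderiv ℝ T y) (fderiv ℝ W y)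
      = -∫ u, (fderiv ℝ (T ∘ F.graphMap φ) u ∘L F.proj
          + rankOne ℝ (W (F.graphMap φ u)) F.e).det := by
  have hsh := F.lipschitzWith_shear hφ
  have hgr := F.lipschitzWith_graphMap hφ
  have hcont_e : Continuous fun y : E => ⟪F.e, y⟫ := F.lipschitzWith_inner_e.continuous
  -- In sheared coordinates the region is the half space `P`. Below it, `T` is extended constantly
  -- in the vertical direction and `W` is cut off linearly on the slab of height one.
  let P : Set E := {y | 0 < ⟪F.e, y⟫}
  have hPo : IsOpen P := isOpen_lt continuous_const hcont_e
  let cut : E → ℝ := fun y => max 0 (min 1 (1 + ⟪F.e, y⟫))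
  let T' : E → E := fun y => T (F.shear φ (F.retract y))
  let W' : E → E := fun y => cut y • W (F.shear φ (F.retract y))
  have hT' : LipschitzWith (KT * ((1 + K) * 2)) T' := hT.comp (hsh.comp F.lipschitzWith_retract)
  have hcutL : LipschitzWith 1 cut := by
    have : LipschitzWith 1 fun y : E => 1 + ⟪F.e, y⟫ := by
      have := (LipschitzWith.const (α := E) (1 : ℝ)).add F.lipschitzWith_inner_e
      simpa using this
    exact (this.const_min 1).const_max 0
  have hcut : ∀ y, |cut y| ≤ 1 := fun y => by
    rw [abs_of_nonneg (le_max_left _ _)]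
    exact max_le zero_le_one (min_le_left _ _)
  obtain ⟨b, hb⟩ := hWc.exists_bound_of_continuous hW.continuous
  obtain ⟨KW', hW'⟩ : ∃ M, LipschitzWith M W' :=
    exists_lipschitzWith_smul hcutL (hW.comp (hsh.comp F.lipschitzWith_retract)) hcut
      (fun y _ => hb _)
  have hW'c : HasCompactSupport W' := by
    obtain ⟨R, hR⟩ := hWc.isCompact.isBounded.exists_norm_le
    have hinv := F.lipschitzWith_shear (φ := -φ) hφ.neg
    refine HasCompactSupport.intro (isCompact_closedBall (0 : E)
      (‖F.shear (-φ) 0‖ + (1 + K) * R + 1)) fun y hy => ?_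
    by_contra hne
    have hc0 : cut y ≠ 0 := fun h => hne (by simp [W', h])
    have hW0 : W (F.shear φ (F.retract y)) ≠ 0 := fun h => hne (by simp [W', h])
    refine hy (mem_closedBall_zero_iff.2 ?_)
    have h1 : -1 < ⟪F.e, y⟫ := by
      by_contra h
      refine hc0 (max_eq_left ((min_le_right _ _).trans ?_))
      linarith [not_lt.1 h]
    have h2 := hR _ (subset_tsupport _ (Function.mem_support.2 hW0))
    have h3 : ‖F.retract y‖ ≤ ‖F.shear (-φ) 0‖ + (1 + K) * R := by
      have h4 := hinv.norm_sub_le (F.shear φ (F.retract y)) 0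
      rw [F.shear_neg_shear, sub_zero] at h4
      have h5 := norm_le_norm_add_norm_sub' (F.retract y) (F.shear (-φ) 0)
      refine h5.trans (add_le_add_right (h4.trans ?_) _)
      push_cast
      gcongr
    have h6 : y = F.retract y + min ⟪F.e, y⟫ 0 • F.e := by simp [retract]
    rw [h6]
    refine (norm_add_le _ _).trans (add_le_add h3 ?_)
    rw [norm_smul, F.norm_e, mul_one, Real.norm_eq_abs, abs_of_nonpos (min_le_right _ _)]
    rw [neg_le]
    exact le_min h1.le (by norm_num)
  have hnull := integral_detDeriv_eq_zero hT' hW' hW'c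
  have hint := integrable_detDeriv_fderiv hT' hW' hW'c
  rw [← integral_add_compl hPo.measurableSet hint] at hnull
  -- the part above the boundary
  have hup : ∫ y in P, detDeriv (fderiv ℝ T' y) (fderiv ℝ W' y)
      = ∫ y in F.epigraph φ, detDeriv (fderiv ℝ T y) (fderiv ℝ W y) := by
    rw [← F.shear_image_halfSpace, setIntegral_image_of_lipschitz hsh hPo.measurableSet
      F.bijective_shear.injective.injOn]
    refine setIntegral_congr_ae hPo.measurableSet ?_
    filter_upwards [F.ae_shear hφ hT.ae_differentiableAt, F.ae_shear hφ hW.ae_differentiableAt,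
      hsh.ae_differentiableAt, (hφ.comp F.lipschitzWith_proj).ae_differentiableAt]
      with y h1 h2 h3 h4 hy
    have hy' : ∀ᶠ z in 𝓝 y, 0 < ⟪F.e, z⟫ := hPo.mem_nhds hy
    have e1 : T' =ᶠ[𝓝 y] T ∘ F.shear φ := by
      filter_upwards [hy'] with z hz
      simp [T', retract, min_eq_right hz.le]
    have e2 : W' =ᶠ[𝓝 y] W ∘ F.shear φ := by
      filter_upwards [hy'] with z hz
      have : min 1 (1 + ⟪F.e, z⟫) = 1 := min_eq_left (by linarith)
      simp [W', cut, retract, min_eq_right hz.le, this]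
    rw [e1.fderiv_eq, e2.fderiv_eq, fderiv_comp y h1 h3, fderiv_comp y h2 h3,
      detDeriv_comp_right, F.det_fderiv_shear h4]
    simp
  -- the part below the boundary
  have hlow : ∫ y in Pᶜ, detDeriv (fderiv ℝ T' y) (fderiv ℝ W' y)
      = ∫ u, (fderiv ℝ (T ∘ F.graphMap φ) u ∘L F.proj
          + rankOne ℝ (W (F.graphMap φ u)) F.e).det := by
    rw [← F.setIntegral_slab]
    have hm : MeasurableSet {y : E | ⟪F.e, y⟫ ∈ Ioo (-1 : ℝ) 0} :=
      measurableSet_Ioo.preimage (by fun_prop : Measurable fun y : E => ⟪F.e, y⟫)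
    have hsub : {y : E | ⟪F.e, y⟫ ∈ Ioo (-1 : ℝ) 0} ⊆ Pᶜ := fun y hy h =>
      absurd hy.2 (not_lt.2 (le_of_lt h))
    rw [setIntegral_eq_of_subset_of_ae_sdiff_eq_zero hPo.measurableSet.compl.nullMeasurableSet hsub]
    · refine setIntegral_congr_ae hm ?_
      filter_upwards [F.ae_proj (hT.comp hgr).ae_differentiableAt,
        F.ae_proj (hW.comp hgr).ae_differentiableAt] with y h1 h2 hy
      have hop : IsOpen {y : E | ⟪F.e, y⟫ ∈ Ioo (-1 : ℝ) 0} := isOpen_Ioo.preimage hcont_e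
      have hy' : ∀ᶠ z in 𝓝 y, ⟪F.e, z⟫ ∈ Ioo (-1 : ℝ) 0 := hop.mem_nhds hy
      have e0 : ∀ z : E, ⟪F.e, z⟫ ∈ Ioo (-1 : ℝ) 0 →
          F.shear φ (F.retract z) = F.graphMap φ (F.proj z) := by
        intro z hz
        have : F.retract z = z - ⟪F.e, z⟫ • F.e := by rw [retract, min_eq_left hz.2.le]
        rw [shear, this, graphMap_proj]
        simp only [map_sub, map_smul, proj_e, smul_zero, sub_zero]
        module
      have e1 : T' =ᶠ[𝓝 y] (T ∘ F.graphMap φ) ∘ F.proj := by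
        filter_upwards [hy'] with z hz
        simp [T', e0 z hz]
      have e2 : W' =ᶠ[𝓝 y] fun z => (1 + ⟪F.e, z⟫) • (W ∘ F.graphMap φ) (F.proj z) := by
        filter_upwards [hy'] with z hz
        have : cut z = 1 + ⟪F.e, z⟫ := by
          simp only [cut]
          rw [min_eq_right (by linarith [hz.2]), max_eq_right (by linarith [hz.1])]
        simp [W', this, e0 z hz]
      have d1 : HasFDerivAt T' (fderiv ℝ (T ∘ F.graphMap φ) (F.proj y) ∘L F.proj) y :=
        (h1.hasFDerivAt.comp y F.proj.hasFDerivAt).congr_of_eventuallyEq e1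
      have d2 : HasFDerivAt W' ((1 + ⟪F.e, y⟫) • (fderiv ℝ (W ∘ F.graphMap φ) (F.proj y) ∘L F.proj)
          + rankOne ℝ (W (F.graphMap φ (F.proj y))) F.e) y := by
        have ha : HasFDerivAt (fun z : E => 1 + ⟪F.e, z⟫) (innerSL ℝ F.e) y :=
          (innerSL ℝ F.e).hasFDerivAt.const_add 1
        exact (ha.smul (h2.hasFDerivAt.comp y F.proj.hasFDerivAt)).congr_of_eventuallyEq e2
      rw [d1.fderiv, d2.fderiv, detDeriv_add, detDeriv_smul, detDeriv_rankOne,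
        detDeriv_eq_zero_of_apply_eq_zero F.e_ne_zero (by simp) (by simp),
        det_eq_zero_of_apply_eq_zero (B := fderiv ℝ (T ∘ F.graphMap φ) (F.proj y) ∘L F.proj)
          F.e_ne_zero (by simp)]
      simp
    · have hz := measure_eq_zero_iff_ae_notMem.1 (F.volume_level 0)
      have hz' := measure_eq_zero_iff_ae_notMem.1 (F.volume_level (-1))
      filter_upwards [hz, hz'] with y h0 h1 hy
      have h0 : ⟪F.e, y⟫ ≠ 0 := h0
      have h1 : ⟪F.e, y⟫ ≠ -1 := h1
      have hlt : ⟪F.e, y⟫ < -1 := by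
        by_contra hge
        refine hy.2 ⟨lt_of_le_of_ne (not_lt.1 hge) h1.symm, lt_of_le_of_ne (not_lt.1 ?_) h0⟩
        exact hy.1
      have : W' =ᶠ[𝓝 y] fun _ => 0 := by
        filter_upwards [(isOpen_lt hcont_e continuous_const).mem_nhds hlt] with z hz
        have hz : ⟪F.e, z⟫ < -1 := hz
        have : cut z = 0 := max_eq_left ((min_le_right _ _).trans (by linarith))
        simp [W', this]
      rw [this.fderiv_eq]
      simp [detDeriv]
  rw [hup, hlow] at hnull
  linarith

end Measure

end Frame

/-! ### Charts of a Lipschitz domain, its surface measure and its normal -/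

section

open InnerProductSpace (rankOne)

variable {d : ℕ}

/-- `U` is an open set in which `Ω` is the region above the graph of the Lipschitz function `φ` in
the frame `F`. -/
structure IsChart (Ω U : Set (Space d)) (F : Frame (Space (d - 1)) (Space d))
    (φ : Space (d - 1) → ℝ) (K : ℝ≥0) : Prop where
  isOpen : IsOpen U
  lipschitz : LipschitzWith K φ
  mem_iff : ∀ y ∈ U, y ∈ Ω ↔ y ∈ F.epigraph φ

theorem exists_chart (hd : 2 ≤ d) {Ω : Set (Space d)} (hΩ : IsBoundedLipschitzDomain Ω)
    {x₀ : Space d} (hx₀ : x₀ ∈ frontier Ω) :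
    ∃ r > 0, ∃ F φ K, IsChart Ω (Metric.ball x₀ r) F φ K := by
  obtain ⟨e, f, K, he, hf, hy⟩ := hΩ.exists_graph x₀ hx₀
  obtain ⟨F, rfl⟩ := Frame.exists_frame (H := Space (d - 1)) (E := Space d)
    (by simp; omega) he
  obtain ⟨r, hr, h⟩ := Metric.eventually_nhds_iff_ball.1 hy
  refine ⟨r, hr, F, fun u => f (F.incl u), K, Metric.isOpen_ball, ?_, fun y hy => ?_⟩
  · have := hf.comp F.incl.lipschitz
    rwa [mul_one] at this
  · rw [h y hy, ← F.incl_proj]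
    rfl

namespace Frame

variable {H E : Type*} [NormedAddCommGroup H] [InnerProductSpace ℝ H] [FiniteDimensional ℝ H]
  [NormedAddCommGroup E] [InnerProductSpace ℝ E] [FiniteDimensional ℝ E] (F : Frame H E)
  {φ : H → ℝ} {K : ℝ≥0}

theorem frontier_epigraph (hφ : Continuous φ) : frontier (F.epigraph φ) = range (F.graphMap φ) := by
  ext y
  rw [mem_range_graphMap]
  constructor
  · intro h
    exact frontier_lt_subset_eq (hφ.comp F.proj.continuous)
      (by fun_prop : Continuous fun y : E => ⟪F.e, y⟫) h
  · intro h
    have hc : Continuous fun τ : ℝ => y + τ • F.e := by fun_prop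
    have h0 : Tendsto (fun τ : ℝ => y + τ • F.e) (𝓝 0) (𝓝 y) := by
      simpa using hc.tendsto 0
    refine ⟨?_, fun hi => ?_⟩
    · refine mem_closure_of_tendsto (h0.mono_left (nhdsWithin_le_nhds (s := Ioi 0))) ?_
      filter_upwards [self_mem_nhdsWithin] with τ hτ
      have hτ : 0 < τ := hτ
      simp [epigraph, inner_add_right, inner_smul_right, F.norm_e, h, hτ]
    · have : y ∈ F.epigraph φ := interior_subset hi
      exact absurd h (ne_of_lt this)

/-- The downward normal of the graph of `φ`, not normalised. -/
def graphNormal (φ : H → ℝ) (u : H) : E :=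
  F.incl ((InnerProductSpace.toDual ℝ H).symm (fderiv ℝ φ u)) - F.e

theorem norm_graphNormal (u : H) : ‖F.graphNormal φ u‖ = graphDensity φ u := by
  rw [graphDensity, eq_comm, Real.sqrt_eq_iff_mul_self_eq (by positivity) (norm_nonneg _), ← sq,
    graphNormal, norm_sub_sq_real, real_inner_comm, F.inner_e_incl, F.incl.norm_map, F.norm_e,
    LinearIsometryEquiv.norm_map]
  ring

theorem inner_graphNormal (u : H) (v : E) :
    ⟪F.graphNormal φ u, v⟫ = fderiv ℝ φ u (F.proj v) - ⟪F.e, v⟫ := by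
  rw [graphNormal, inner_sub_left, real_inner_comm, ← inner_proj, real_inner_comm,
    InnerProductSpace.toDual_symm_apply]

theorem graphMapDeriv_comp_proj (u : H) :
    F.graphMapDeriv (fderiv ℝ φ u) ∘L F.proj = 1 + rankOne ℝ F.e (F.graphNormal φ u) := by
  ext1 v
  change F.incl (F.proj v) + fderiv ℝ φ u (F.proj v) • F.e
    = v + ⟪F.graphNormal φ u, v⟫ • F.e
  rw [inner_graphNormal, incl_proj]
  module

theorem measurable_graphNormal [MeasurableSpace H] [BorelSpace H] [MeasurableSpace E]
    [BorelSpace E] : Measurable (F.graphNormal φ) := by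
  have h1 : Continuous fun ℓ : H →L[ℝ] ℝ =>
      F.incl ((InnerProductSpace.toDual ℝ H).symm ℓ) - F.e :=
    (F.incl.continuous.comp (InnerProductSpace.toDual ℝ H).symm.continuous).sub continuous_const
  exact h1.measurable.comp (measurable_fderiv ℝ φ)

end Frame

theorem mem_frontier_congr {X : Type*} [TopologicalSpace X] {s t : Set X} {x : X}
    (h : ∀ᶠ y in 𝓝 x, y ∈ s ↔ y ∈ t) : x ∈ frontier s ↔ x ∈ frontier t := by
  have h1 : x ∈ closure s ↔ x ∈ closure t := by
    rw [mem_closure_iff_frequently, mem_closure_iff_frequently]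
    exact frequently_congr h
  have h2 : x ∈ interior s ↔ x ∈ interior t := by
    rw [mem_interior_iff_mem_nhds, mem_interior_iff_mem_nhds]
    exact eventually_congr h
  rw [frontier, frontier, Set.mem_sdiff, Set.mem_sdiff, h1, h2]

theorem IsOuterUnitNormal.unique {Ω : Set (Space d)} {x n n' : Space d}
    (h : IsOuterUnitNormal Ω x n) (h' : IsOuterUnitNormal Ω x n') : n = n' := by
  by_contra hne
  have hv : 0 < ‖n' - n‖ := norm_pos_iff.2 (sub_ne_zero.2 (Ne.symm hne))
  have hsq : ‖n' - n‖ ^ 2 = 2 * (1 - ⟪n, n'⟫) := by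
    rw [norm_sub_sq_real, h.1, h'.1, real_inner_comm]; ring
  have hpos : 0 < 1 - ⟪n, n'⟫ := by nlinarith
  set η := (1 - ⟪n, n'⟫) / (2 * ‖n' - n‖)
  have hη : 0 < η := by positivity
  have hηv : η * ‖n' - n‖ = (1 - ⟪n, n'⟫) / 2 := by simp only [η]; field_simp
  -- close to `x`, the points `x + τ • (n' - n)` would lie in `Ω` by `h` and outside by `h'`
  have hc : Tendsto (fun τ : ℝ => x + τ • (n' - n)) (𝓝[>] 0) (𝓝 x) := by
    have : Continuous fun τ : ℝ => x + τ • (n' - n) := by fun_prop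
    simpa using (this.tendsto 0).mono_left (nhdsWithin_le_nhds (s := Ioi 0))
  obtain ⟨τ, ⟨h1, h2⟩, hτ⟩ :=
    ((hc.eventually ((h.2 η hη).and (h'.2 η hη))).and self_mem_nhdsWithin).exists
  have hτ : 0 < τ := hτ
  have hn : ‖x + τ • (n' - n) - x‖ = τ * ‖n' - n‖ := by
    rw [add_sub_cancel_left, norm_smul, Real.norm_eq_abs, abs_of_pos hτ]
  have i1 : ⟪x + τ • (n' - n) - x, n⟫ = -(τ * (1 - ⟪n, n'⟫)) := by
    rw [add_sub_cancel_left, inner_smul_left, inner_sub_left, real_inner_self_eq_norm_sq, h.1,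
      real_inner_comm]
    simp only [conj_trivial]; ring
  have i2 : ⟪x + τ • (n' - n) - x, n'⟫ = τ * (1 - ⟪n, n'⟫) := by
    rw [add_sub_cancel_left, inner_smul_left, inner_sub_left, real_inner_self_eq_norm_sq, h'.1]
    simp
  have k : η * (τ * ‖n' - n‖) = τ * ((1 - ⟪n, n'⟫) / 2) := by rw [← hηv]; ring
  refine h2.2 ?_ (h1.1 ?_)
  · rw [hn, i2, k]; nlinarith
  · rw [hn, i1, k]; nlinarith

theorem outerNormal_eq {Ω : Set (Space d)} {x n : Space d} (h : IsOuterUnitNormal Ω x n) :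
    outerNormal Ω x = n := by
  have hex : ∃ n, IsOuterUnitNormal Ω x n := ⟨n, h⟩
  rw [outerNormal, dif_pos hex]
  exact hex.choose_spec.unique h

theorem norm_outerNormal_le (Ω : Set (Space d)) (x : Space d) : ‖outerNormal Ω x‖ ≤ 1 := by
  by_cases hex : ∃ n, IsOuterUnitNormal Ω x n
  · rw [outerNormal, dif_pos hex]
    exact hex.choose_spec.1.le
  · rw [outerNormal, dif_neg hex]
    simp

namespace IsChart

variable {Ω U : Set (Space d)} {F : Frame (Space (d - 1)) (Space d)} {φ : Space (d - 1) → ℝ}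
  {K : ℝ≥0}

theorem frontier_inter (h : IsChart Ω U F φ K) :
    frontier Ω ∩ U = range (F.graphMap φ) ∩ U := by
  ext y
  simp only [mem_inter_iff, and_congr_left_iff]
  intro hy
  rw [← F.frontier_epigraph h.lipschitz.continuous]
  exact mem_frontier_congr ((h.isOpen.eventually_mem hy).mono h.mem_iff)

theorem restrict_surfaceMeasure (h : IsChart Ω U F φ K) :
    (surfaceMeasure Ω).restrict U = (((volume : Measure (Space (d - 1))).withDensity
      fun u => ENNReal.ofReal (Frame.graphDensity φ u)).map (F.graphMap φ)).restrict U := by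
  rw [← F.restrict_range_graphMap h.lipschitz, surfaceMeasure,
    Measure.restrict_restrict h.isOpen.measurableSet,
    Measure.restrict_restrict h.isOpen.measurableSet, inter_comm U, inter_comm U, h.frontier_inter]
  simp

/-- Surface integrals in a chart. -/
theorem integral_surfaceMeasure (h : IsChart Ω U F φ K) {k : Space d → ℝ}
    (hk : ∀ x ∉ U, k x = 0) :
    ∫ x, k x ∂(surfaceMeasure Ω)
      = ∫ u, Frame.graphDensity φ u * k (F.graphMap φ u) := by
  rw [← setIntegral_eq_integral_of_forall_compl_eq_zero hk, h.restrict_surfaceMeasure,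
    setIntegral_eq_integral_of_forall_compl_eq_zero hk,
    (F.isClosedEmbedding_graphMap h.lipschitz.continuous).measurableEmbedding.integral_map,
    integral_withDensity_eq_integral_toReal_smul
      (Frame.measurable_graphDensity φ).ennreal_ofReal (Eventually.of_forall fun _ => by simp)]
  refine integral_congr_ae (Eventually.of_forall fun u => ?_)
  simp [ENNReal.toReal_ofReal (Frame.graphDensity_pos φ u).le]

theorem ae_restrict_iff (h : IsChart Ω U F φ K) {P : Space d → Prop} :
    (∀ᵐ x ∂((surfaceMeasure Ω).restrict U), P x) ↔
      ∀ᵐ u : Space (d - 1), F.graphMap φ u ∈ U → P (F.graphMap φ u) := by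
  rw [h.restrict_surfaceMeasure, MeasureTheory.ae_restrict_iff' h.isOpen.measurableSet,
    (F.isClosedEmbedding_graphMap h.lipschitz.continuous).measurableEmbedding.ae_map_iff,
    ae_withDensity_iff (Frame.measurable_graphDensity φ).ennreal_ofReal]
  refine eventually_congr (Eventually.of_forall fun u => ?_)
  simp [Frame.graphDensity_pos φ u]

/-- Where the graph function is differentiable, the normalised graph normal is the outer unit
normal. -/
theorem isOuterUnitNormal (h : IsChart Ω U F φ K) {u : Space (d - 1)}
    (hu : F.graphMap φ u ∈ U) (hd : DifferentiableAt ℝ φ u) :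
    IsOuterUnitNormal Ω (F.graphMap φ u)
      ((Frame.graphDensity φ u)⁻¹ • F.graphNormal φ u) := by
  set x := F.graphMap φ u
  set m := Frame.graphDensity φ u
  have hm : 0 < m := Frame.graphDensity_pos φ u
  have hm1 : 1 ≤ m := Real.one_le_sqrt.2 (by nlinarith [sq_nonneg ‖fderiv ℝ φ u‖])
  refine ⟨?_, fun η hη => ?_⟩
  · rw [norm_smul, F.norm_graphNormal, Real.norm_eq_abs, abs_inv, abs_of_pos hm,
      inv_mul_cancel₀ hm.ne']
  · -- the height above the graph is, to first order, `-⟪y - x, n⟫` times the density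
    have hd' : HasFDerivAt (fun y : Space d => φ (F.proj y)) (fderiv ℝ φ u ∘L F.proj) x := by
      have : HasFDerivAt φ (fderiv ℝ φ u) (F.proj x) := by
        rw [F.proj_graphMap]; exact hd.hasFDerivAt
      exact this.comp x F.proj.hasFDerivAt
    filter_upwards [h.isOpen.mem_nhds hu, hd'.isLittleO.def hη] with y hyU hy
    have hyx : φ (F.proj x) = ⟪F.e, x⟫ := by simp [x]
    have hin : ⟪y - x, m⁻¹ • F.graphNormal φ u⟫
        = m⁻¹ * (fderiv ℝ φ u (F.proj (y - x)) - ⟪F.e, y - x⟫) := by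
      rw [inner_smul_right, real_inner_comm, F.inner_graphNormal]
    have hy' : |φ (F.proj y) - φ (F.proj x) - fderiv ℝ φ u (F.proj (y - x))| ≤ η * ‖y - x‖ := hy
    rw [hyx, abs_le] at hy'
    have hsub : ⟪F.e, y - x⟫ = ⟪F.e, y⟫ - ⟪F.e, x⟫ := inner_sub_right _ _ _
    have hle : η * ‖y - x‖ ≤ m * (η * ‖y - x‖) := le_mul_of_one_le_left (by positivity) hm1
    rw [h.mem_iff y hyU, hin, Frame.epigraph, mem_ofPred_eq]
    constructor
    · intro h1
      have := mul_lt_mul_of_pos_left h1 hm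
      rw [mul_inv_cancel_left₀ hm.ne'] at this
      linarith [hy'.2]
    · intro h1
      have := mul_lt_mul_of_pos_left h1 hm
      rw [mul_inv_cancel_left₀ hm.ne'] at this
      rw [not_lt]
      linarith [hy'.1]

theorem ae_outerNormal (h : IsChart Ω U F φ K) : ∀ᵐ u : Space (d - 1), F.graphMap φ u ∈ U →
    outerNormal Ω (F.graphMap φ u) = (Frame.graphDensity φ u)⁻¹ • F.graphNormal φ u := by
  filter_upwards [h.lipschitz.ae_differentiableAt] with u hu hU
  exact outerNormal_eq (h.isOuterUnitNormal hU hu)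

theorem aestronglyMeasurable_outerNormal (h : IsChart Ω U F φ K) :
    AEStronglyMeasurable (outerNormal Ω) ((surfaceMeasure Ω).restrict U) := by
  have hm : Measurable fun y : Space d =>
      (Frame.graphDensity φ (F.proj y))⁻¹ • F.graphNormal φ (F.proj y) :=
    ((Frame.measurable_graphDensity φ).inv.smul F.measurable_graphNormal).comp
      F.proj.continuous.measurable
  refine ⟨_, hm.stronglyMeasurable, h.ae_restrict_iff.2 ?_⟩
  filter_upwards [h.ae_outerNormal] with u hu hU
  rw [hu hU, F.proj_graphMap]

theorem measure_lt_top (h : IsChart Ω U F φ K) (hU : Bornology.IsBounded U) :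
    surfaceMeasure Ω U < ⊤ := by
  have hemb := (F.isClosedEmbedding_graphMap h.lipschitz.continuous).measurableEmbedding
  rw [← Measure.restrict_apply_self, h.restrict_surfaceMeasure, Measure.restrict_apply_self,
    hemb.map_apply, withDensity_apply _ (hemb.measurable h.isOpen.measurableSet)]
  have hb : Bornology.IsBounded (F.graphMap φ ⁻¹' U) := by
    refine (F.lipschitzWith_proj.isBounded_image hU).subset fun u hu => ?_
    exact ⟨F.graphMap φ u, hu, by simp⟩
  refine setLIntegral_lt_top_of_le_nnreal hb.measure_lt_top.ne
    ⟨(√(1 + (K : ℝ) ^ 2)).toNNReal, fun u _ => ENNReal.ofReal_le_ofReal ?_⟩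
  refine Real.sqrt_le_sqrt ?_
  gcongr
  exact norm_fderiv_le_of_lipschitz' h.lipschitz u

end IsChart

variable {Ω : Set (Space d)}

theorem IsBoundedLipschitzDomain.isCompact_closure (hΩ : IsBoundedLipschitzDomain Ω) :
    IsCompact (closure Ω) := hΩ.isBounded.isCompact_closure

theorem IsBoundedLipschitzDomain.isCompact_frontier (hΩ : IsBoundedLipschitzDomain Ω) :
    IsCompact (frontier Ω) :=
  hΩ.isCompact_closure.of_isClosed_subset isClosed_frontier frontier_subset_closure

theorem surfaceMeasure_frontier_compl (Ω : Set (Space d)) :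
    ∀ᵐ x ∂(surfaceMeasure Ω), x ∈ frontier Ω :=
  ae_restrict_mem isClosed_frontier.measurableSet

theorem isFiniteMeasure_surfaceMeasure (hd : 2 ≤ d) (hΩ : IsBoundedLipschitzDomain Ω) :
    IsFiniteMeasure (surfaceMeasure Ω) := by
  have h1 : surfaceMeasure Ω (frontier Ω) < ⊤ := by
    refine hΩ.isCompact_frontier.measure_lt_top_of_nhdsWithin fun x hx => ?_
    obtain ⟨r, hr, F, φ, K, hc⟩ := exists_chart hd hΩ hx
    exact ⟨_, mem_nhdsWithin_of_mem_nhds (Metric.ball_mem_nhds x hr),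
      hc.measure_lt_top Metric.isBounded_ball⟩
  refine ⟨?_⟩
  rwa [surfaceMeasure, Measure.restrict_apply_self, ← Measure.restrict_apply_univ] at h1

theorem aestronglyMeasurable_outerNormal (hd : 2 ≤ d) (hΩ : IsBoundedLipschitzDomain Ω) :
    AEStronglyMeasurable (outerNormal Ω) (surfaceMeasure Ω) := by
  have h : ∀ x : frontier Ω, ∃ r > 0, ∃ F φ K, IsChart Ω (Metric.ball (x : Space d) r) F φ K :=
    fun x => exists_chart hd hΩ x.2
  choose r hr F φ K hc using h
  obtain ⟨t, ht⟩ := hΩ.isCompact_frontier.elim_finite_subcover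
    (fun x : frontier Ω => Metric.ball (x : Space d) (r x)) (fun x => Metric.isOpen_ball)
    (fun x hx => mem_iUnion.2 ⟨⟨x, hx⟩, Metric.mem_ball_self (hr _)⟩)
  have h1 : AEStronglyMeasurable (outerNormal Ω)
      ((surfaceMeasure Ω).restrict (⋃ i : t, Metric.ball ((i : frontier Ω) : Space d) (r i))) :=
    (aestronglyMeasurable_iUnion_iff).2 fun i => (hc i).aestronglyMeasurable_outerNormal
  have h2 : surfaceMeasure Ω
      = (surfaceMeasure Ω).restrict (⋃ i : t, Metric.ball ((i : frontier Ω) : Space d) (r i)) := by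
    rw [Measure.restrict_eq_self_of_ae_mem]
    filter_upwards [surfaceMeasure_frontier_compl Ω] with x hx
    have := ht hx
    simpa [mem_iUnion] using this
  rw [h2]
  exact h1

end

/-! ### A partition of unity by charts -/

section

open InnerProductSpace (rankOne)

variable {d : ℕ} {Ω : Set (Space d)}

open scoped ContDiff Manifold in
/-- A finite partition of unity on the closure of `Ω` by Lipschitz functions, each supported in `Ω`
or in a chart. -/
theorem exists_partition_of_charts (hd : 2 ≤ d) (hΩ : IsBoundedLipschitzDomain Ω) :
    ∃ (t : Finset (Space d)) (U : t → Set (Space d)) (χ : t → Space d → ℝ),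
      (∀ i, U i ⊆ Ω ∨ ∃ F φ K, IsChart Ω (U i) F φ K) ∧
      (∀ i, ∃ L, LipschitzWith L (χ i)) ∧ (∀ i, HasCompactSupport (χ i)) ∧
      (∀ i, tsupport (χ i) ⊆ U i) ∧ (∀ i x, 0 ≤ χ i x) ∧ (∀ i x, χ i x ≤ 1) ∧
      ∀ x ∈ closure Ω, ∑ i, χ i x = 1 := by
  have h : ∀ x : Space d, ∃ r > 0, x ∈ closure Ω → (Metric.ball x r ⊆ Ω ∨
      ∃ F φ K, IsChart Ω (Metric.ball x r) F φ K) := by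
    intro x
    by_cases hx : x ∈ closure Ω
    · by_cases hxΩ : x ∈ Ω
      · obtain ⟨r, hr, h⟩ := Metric.isOpen_iff.1 hΩ.isOpen x hxΩ
        exact ⟨r, hr, fun _ => Or.inl h⟩
      · obtain ⟨r, hr, h⟩ := exists_chart hd hΩ (x₀ := x)
          ⟨hx, fun hi => hxΩ (interior_subset hi)⟩
        exact ⟨r, hr, fun _ => Or.inr h⟩
    · exact ⟨1, one_pos, fun h => absurd h hx⟩
  choose r hr hU using h
  obtain ⟨t, htΩ, ht⟩ := hΩ.isCompact_closure.elim_nhds_subcover (fun x => Metric.ball x (r x))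
    (fun x _ => Metric.ball_mem_nhds x (hr x))
  obtain ⟨f, hf⟩ := SmoothPartitionOfUnity.exists_isSubordinate 𝓘(ℝ, Space d)
    (isClosed_closure (s := Ω)) (fun i : t => Metric.ball (i : Space d) (r i))
    (fun i => Metric.isOpen_ball) (by
      intro x hx
      obtain ⟨i, hi, hxi⟩ := mem_iUnion₂.1 (ht hx)
      exact mem_iUnion.2 ⟨⟨i, hi⟩, hxi⟩)
  have hc : ∀ i : t, HasCompactSupport (f i) := fun i =>
    Metric.isCompact_of_isClosed_isBounded (isClosed_tsupport _)
      (Metric.isBounded_ball.subset (hf i))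
  refine ⟨t, fun i => Metric.ball (i : Space d) (r i), fun i => f i,
    fun i => hU i (htΩ i i.2), fun i => ?_, hc, hf, fun i x => f.nonneg i x,
    fun i x => f.le_one i x, fun x hx => ?_⟩
  · have h1 : ContDiff ℝ ∞ (f i) := (f i).contMDiff.contDiff
    exact h1.lipschitzWith_of_hasCompactSupport (hc i) (by simp)
  · rw [← finsum_eq_sum_of_fintype]
    exact f.sum_eq_one hx

/-! ### Boundary Jacobians -/

/-- Rademacher's theorem along the graph: the derivative of `S` in graph coordinates, extended by
zero in the vertical direction, is a derivative of `S` along the boundary. -/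
theorem IsChart.hasFDerivWithinAt_frontier {U : Set (Space d)}
    {F : Frame (Space (d - 1)) (Space d)} {φ : Space (d - 1) → ℝ} {K L : ℝ≥0}
    (h : IsChart Ω U F φ K) {S : Space d → Space d} (hS : LipschitzWith L S) :
    ∀ᵐ u : Space (d - 1), F.graphMap φ u ∈ U → HasFDerivWithinAt S
      (fderiv ℝ (S ∘ F.graphMap φ) u ∘L F.proj) (frontier Ω) (F.graphMap φ u) := by
  filter_upwards [(hS.comp (F.lipschitzWith_graphMap h.lipschitz)).ae_differentiableAt]
    with u hu hU
  have h1 : HasFDerivAt (fun y => (S ∘ F.graphMap φ) (F.proj y))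
      (fderiv ℝ (S ∘ F.graphMap φ) u ∘L F.proj) (F.graphMap φ u) := by
    have : HasFDerivAt (S ∘ F.graphMap φ) (fderiv ℝ (S ∘ F.graphMap φ) u)
        (F.proj (F.graphMap φ u)) := by rw [F.proj_graphMap]; exact hu.hasFDerivAt
    exact this.comp _ F.proj.hasFDerivAt
  refine h1.hasFDerivWithinAt.congr_of_eventuallyEq ?_ (by simp)
  filter_upwards [self_mem_nhdsWithin, mem_nhdsWithin_of_mem_nhds (h.isOpen.mem_nhds hU)]
    with y hy hyU
  obtain ⟨v, rfl⟩ : y ∈ range (F.graphMap φ) :=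
    (h.frontier_inter ▸ (⟨hy, hyU⟩ : y ∈ frontier Ω ∩ U) : y ∈ range (F.graphMap φ) ∩ U).1
  simp

/-- Lipschitz fields have boundary Jacobians, with a bound that is linear in the Lipschitz
constant: in a chart, differentiate along the graph and extend by zero in the direction `e`. -/
theorem exists_boundaryJacobian (hd : 2 ≤ d) (hΩ : IsBoundedLipschitzDomain Ω) :
    ∃ C : ℝ, 0 ≤ C ∧ ∀ (L : ℝ≥0) (S : Space d → Space d), LipschitzWith L S →
      ∃ A : Space d → Space d →L[ℝ] Space d, AEStronglyMeasurable A (surfaceMeasure Ω) ∧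
        (∀ x, ‖A x‖ ≤ C * L) ∧
        ∀ᵐ x ∂(surfaceMeasure Ω), HasFDerivWithinAt S (A x) (frontier Ω) x := by
  obtain ⟨t, U, χ, hU, hχL, hχc, hχU, hχ0, hχ1, hχs⟩ := exists_partition_of_charts hd hΩ
  -- the claim for a single member of the partition
  have hloc : ∀ i, ∃ C : ℝ, 0 ≤ C ∧ ∀ (L : ℝ≥0) (S : Space d → Space d), LipschitzWith L S →
      ∃ A : Space d → Space d →L[ℝ] Space d, AEStronglyMeasurable A (surfaceMeasure Ω) ∧
        (∀ x, ‖A x‖ ≤ C * L) ∧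
        ∀ᵐ x ∂(surfaceMeasure Ω), x ∈ U i → HasFDerivWithinAt S (A x) (frontier Ω) x := by
    intro i
    rcases hU i with hi | ⟨F, φ, K, hc⟩
    · refine ⟨0, le_rfl, fun L S _ => ⟨0, aestronglyMeasurable_const, fun x => by simp, ?_⟩⟩
      filter_upwards [surfaceMeasure_frontier_compl Ω] with x hx hxU
      rw [hΩ.isOpen.frontier_eq] at hx
      exact absurd (hi hxU) hx.2
    · refine ⟨1 + K, by positivity, fun L S hS =>
        ⟨fun x => fderiv ℝ (S ∘ F.graphMap φ) (F.proj x) ∘L F.proj, ?_, fun x => ?_, ?_⟩⟩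
      · have h1 : Measurable fun x : Space d => fderiv ℝ (S ∘ F.graphMap φ) (F.proj x) :=
          (measurable_fderiv ℝ _).comp F.proj.continuous.measurable
        have h2 : Continuous fun B : Space (d - 1) →L[ℝ] Space d => B ∘L F.proj := by fun_prop
        exact (h2.measurable.comp h1).aestronglyMeasurable
      · have h1 := norm_fderiv_le_of_lipschitz' (hS.comp (F.lipschitzWith_graphMap hc.lipschitz))
          (F.proj x)
        have h2 : ‖F.proj‖ ≤ 1 := F.proj.opNorm_le_bound zero_le_one fun y => by
          rw [one_mul]; exact F.norm_proj_le y
        refine (ContinuousLinearMap.opNorm_comp_le _ _).trans ?_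
        calc _ ≤ ((L * (1 + K) : ℝ≥0) : ℝ) * 1 := by gcongr
          _ = _ := by push_cast; ring
      · rw [← ae_restrict_iff' hc.isOpen.measurableSet, hc.ae_restrict_iff]
        filter_upwards [hc.hasFDerivWithinAt_frontier hS] with u hu hU
        rw [F.proj_graphMap]
        exact hu hU
  choose C hC0 hC using hloc
  refine ⟨∑ i, C i, Finset.sum_nonneg fun i _ => hC0 i, fun L S hS => ?_⟩
  choose A hAm hAb hAd using fun i => hC i L S hS
  refine ⟨fun x => ∑ i, χ i x • A i x, ?_, fun x => ?_, ?_⟩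
  · refine Finset.aestronglyMeasurable_fun_sum _ fun i _ => ?_
    obtain ⟨M, hM⟩ := hχL i
    exact hM.continuous.aestronglyMeasurable.smul (hAm i)
  · refine (norm_sum_le _ _).trans ?_
    rw [Finset.sum_mul]
    refine Finset.sum_le_sum fun i _ => ?_
    rw [norm_smul, Real.norm_eq_abs, abs_of_nonneg (hχ0 i x)]
    exact (mul_le_of_le_one_left (norm_nonneg _) (hχ1 i x)).trans (hAb i x)
  · filter_upwards [ae_all_iff.2 hAd, surfaceMeasure_frontier_compl Ω] with x hx hxf
    have hs := hχs x (frontier_subset_closure hxf)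
    have h1 : HasFDerivWithinAt (fun y => ∑ i, χ i x • S y) (∑ i, χ i x • A i x)
        (frontier Ω) x := by
      refine HasFDerivWithinAt.fun_sum fun i _ => ?_
      by_cases h0 : χ i x = 0
      · rw [h0, show (0 : ℝ) • A i x = 0 from zero_smul ℝ (A i x)]
        simpa using hasFDerivWithinAt_const (𝕜 := ℝ) (0 : Space d) x (frontier Ω)
      · exact (hx i (hχU i (subset_tsupport _ h0))).const_smul (χ i x)
    have h2 : (fun y => ∑ i, χ i x • S y) = S := by
      ext1 y
      rw [← Finset.sum_smul, hs, one_smul]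
    rwa [h2] at h1

/-! ### The first variation of the determinant on a Lipschitz domain -/

/-- The chain rule for a boundary Jacobian along the parametrisation of the boundary. -/
theorem IsChart.ae_fderiv_comp_graphMap {U : Set (Space d)}
    {F : Frame (Space (d - 1)) (Space d)} {φ : Space (d - 1) → ℝ} {K : ℝ≥0}
    (h : IsChart Ω U F φ K) {T : Space d → Space d} {A : Space d → Space d →L[ℝ] Space d}
    (hA : ∀ᵐ x ∂(surfaceMeasure Ω), HasFDerivWithinAt T (A x) (frontier Ω) x) :
    ∀ᵐ u : Space (d - 1), F.graphMap φ u ∈ U →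
      fderiv ℝ (T ∘ F.graphMap φ) u ∘L F.proj
        = A (F.graphMap φ u) ∘L (1 + rankOne ℝ F.e (F.graphNormal φ u)) := by
  filter_upwards [h.ae_restrict_iff.1 (ae_restrict_of_ae hA), h.lipschitz.ae_differentiableAt]
    with u hu hφ hU
  have h1 := F.hasFDerivAt_graphMap hφ.hasFDerivAt
  have h2 : ∀ᶠ v in 𝓝 u, F.graphMap φ v ∈ frontier Ω := by
    have : Tendsto (F.graphMap φ) (𝓝 u) (𝓝 (F.graphMap φ u)) :=
      (F.isClosedEmbedding_graphMap h.lipschitz.continuous).continuous.tendsto u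
    filter_upwards [this (h.isOpen.mem_nhds hU)] with v hv
    exact (h.frontier_inter ▸ (⟨mem_range_self v, hv⟩ : _ ∈ range (F.graphMap φ) ∩ U) :
      _ ∈ frontier Ω ∩ U).1
  have h3 : HasFDerivAt (T ∘ F.graphMap φ)
      (A (F.graphMap φ u) ∘L F.graphMapDeriv (fderiv ℝ φ u)) u :=
    (hu hU).comp_hasFDerivAt u h1 h2
  rw [h3.fderiv, ContinuousLinearMap.comp_assoc, F.graphMapDeriv_comp_proj]

/-- The surface formula for fields supported in a chart. -/
theorem IsChart.setIntegral_detDeriv {U : Set (Space d)}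
    {F : Frame (Space (d - 1)) (Space d)} {φ : Space (d - 1) → ℝ} {K KT KW : ℝ≥0}
    (h : IsChart Ω U F φ K) (hΩ : IsOpen Ω) {T W : Space d → Space d} (hT : LipschitzWith KT T)
    (hW : LipschitzWith KW W) (hWc : HasCompactSupport W) (hWU : tsupport W ⊆ U)
    {A : Space d → Space d →L[ℝ] Space d}
    (hA : ∀ᵐ x ∂(surfaceMeasure Ω), HasFDerivWithinAt T (A x) (frontier Ω) x) :
    ∫ x in Ω, detDeriv (fderiv ℝ T x) (fderiv ℝ W x)
      = ∫ x, detDeriv (A x) (rankOne ℝ (W x) (outerNormal Ω x)) ∂(surfaceMeasure Ω) := by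
  have hleft : ∫ x in Ω, detDeriv (fderiv ℝ T x) (fderiv ℝ W x)
      = ∫ x in F.epigraph φ, detDeriv (fderiv ℝ T x) (fderiv ℝ W x) := by
    rw [← integral_indicator hΩ.measurableSet,
      ← integral_indicator (F.isOpen_epigraph h.lipschitz.continuous).measurableSet]
    congr 1
    ext x
    by_cases hx : x ∈ tsupport W
    · have := h.mem_iff x (hWU hx)
      by_cases hxΩ : x ∈ Ω
      · rw [indicator_of_mem hxΩ, indicator_of_mem (this.1 hxΩ)]
      · rw [indicator_of_notMem hxΩ, indicator_of_notMem fun h => hxΩ (this.2 h)]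
    · have h0 : fderiv ℝ W x = 0 := by
        by_contra hne
        exact hx (support_fderiv_subset ℝ hne)
      have : detDeriv (fderiv ℝ T x) (fderiv ℝ W x) = 0 := by simp [h0, detDeriv]
      simp [indicator, this]
  have hW0 : ∀ x ∉ U, W x = 0 := fun x hx =>
    image_eq_zero_of_notMem_tsupport fun hx' => hx (hWU hx')
  rw [hleft, F.setIntegral_epigraph_detDeriv h.lipschitz hT hW hWc,
    h.integral_surfaceMeasure (fun x hx => by rw [hW0 x hx]; simp [detDeriv]), ← integral_neg]
  refine integral_congr_ae ?_
  filter_upwards [h.ae_fderiv_comp_graphMap hA, h.ae_outerNormal] with u hu hn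
  by_cases hU : F.graphMap φ u ∈ U
  · have hq : ⟪F.e, F.incl ((InnerProductSpace.toDual ℝ _).symm (fderiv ℝ φ u))⟫ = 0 :=
      F.inner_e_incl _
    rw [hu hU, hn hU, Frame.graphNormal, det_comp_graph_add_rankOne _ _ F.norm_e hq, neg_neg,
      ← Frame.graphNormal]
    rw [map_smulₛₗ, detDeriv_smul]
    simp only [conj_trivial]
    rw [mul_inv_cancel_left₀ (Frame.graphDensity_pos φ u).ne']
  · rw [hW0 _ hU, det_eq_zero_of_apply_eq_zero F.e_ne_zero (by simp)]
    simp [detDeriv]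

theorem integrable_surfaceMeasure_detDeriv (hd : 2 ≤ d) (hΩ : IsBoundedLipschitzDomain Ω)
    {W : Space d → Space d} (hW : ContinuousOn W (frontier Ω))
    {A : Space d → Space d →L[ℝ] Space d} (hAm : AEStronglyMeasurable A (surfaceMeasure Ω))
    {R : ℝ} (hAb : ∀ᵐ x ∂(surfaceMeasure Ω), ‖A x‖ ≤ R) :
    Integrable (fun x => detDeriv (A x) (rankOne ℝ (W x) (outerNormal Ω x)))
      (surfaceMeasure Ω) := by
  have := isFiniteMeasure_surfaceMeasure hd hΩ
  obtain ⟨b, hb⟩ := hΩ.isCompact_frontier.exists_bound_of_continuousOn hW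
  have hWm : AEStronglyMeasurable W (surfaceMeasure Ω) :=
    hW.aestronglyMeasurable isClosed_frontier.measurableSet
  refine integrable_continuous_comp
    (G := fun p : (Space d →L[ℝ] Space d) × (Space d × Space d) =>
      detDeriv p.1 (rankOne ℝ p.2.1 p.2.2))
    (u := fun x => (A x, (W x, outerNormal Ω x))) ?_
    (hAm.prodMk (hWm.prodMk (aestronglyMeasurable_outerNormal hd hΩ)))
    (R := max R (max b 1)) ?_
  · refine continuous_detDeriv.comp (continuous_fst.prodMk ?_)
    exact ((rankOne ℝ).continuous.comp continuous_snd.fst).clm_apply continuous_snd.snd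
  · filter_upwards [hAb, surfaceMeasure_frontier_compl Ω] with x h1 h2
    exact max_le_max h1 (max_le_max (hb x h2) (norm_outerNormal_le Ω x))

/-- The first variation of the determinant on a Lipschitz domain is a boundary integral. For
`T = id` this is the divergence theorem. -/
theorem setIntegral_detDeriv_eq_surface (hd : 2 ≤ d) (hΩ : IsBoundedLipschitzDomain Ω)
    {KT KW : ℝ≥0} {T W : Space d → Space d} (hT : LipschitzWith KT T) (hW : LipschitzWith KW W)
    {A : Space d → Space d →L[ℝ] Space d} (hAm : AEStronglyMeasurable A (surfaceMeasure Ω))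
    {R : ℝ} (hAb : ∀ᵐ x ∂(surfaceMeasure Ω), ‖A x‖ ≤ R)
    (hA : ∀ᵐ x ∂(surfaceMeasure Ω), HasFDerivWithinAt T (A x) (frontier Ω) x) :
    ∫ x in Ω, detDeriv (fderiv ℝ T x) (fderiv ℝ W x)
      = ∫ x, detDeriv (A x) (rankOne ℝ (W x) (outerNormal Ω x)) ∂(surfaceMeasure Ω) := by
  obtain ⟨t, U, χ, hU, hχL, hχc, hχU, hχ0, hχ1, hχs⟩ := exists_partition_of_charts hd hΩ
  have hWi : ∀ i, ∃ L, LipschitzWith L fun x => χ i x • W x := by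
    intro i
    obtain ⟨M, hM⟩ := hχL i
    obtain ⟨b, hb⟩ := (hχc i).isCompact.exists_bound_of_continuousOn hW.continuous.continuousOn
    exact exists_lipschitzWith_smul hM hW
      (fun x => (abs_of_nonneg (hχ0 i x)).trans_le (hχ1 i x))
      (fun x hx => hb x (subset_tsupport _ hx))
  choose L hL using hWi
  have hsub : ∀ i, tsupport (fun x => χ i x • W x) ⊆ tsupport (χ i) := fun i =>
    tsupport_smul_subset_left _ _
  have hWc : ∀ i, HasCompactSupport fun x => χ i x • W x := fun i => (hχc i).smul_right
  have hloc : ∀ i, ∫ x in Ω, detDeriv (fderiv ℝ T x) (fderiv ℝ (fun x => χ i x • W x) x)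
      = ∫ x, detDeriv (A x) (rankOne ℝ (χ i x • W x) (outerNormal Ω x))
          ∂(surfaceMeasure Ω) := by
    intro i
    rcases hU i with hi | ⟨F, φ, K, hc⟩
    · have h1 : ∫ x in Ω, detDeriv (fderiv ℝ T x) (fderiv ℝ (fun x => χ i x • W x) x) = 0 := by
        rw [← integral_detDeriv_eq_zero hT (hL i) (hWc i)]
        refine setIntegral_eq_integral_of_forall_compl_eq_zero fun x hx => ?_
        have h0 : fderiv ℝ (fun x => χ i x • W x) x = 0 := by
          by_contra hne
          exact hx (hi (hχU i (hsub i (support_fderiv_subset ℝ hne))))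
        simp [h0, detDeriv]
      rw [h1, eq_comm]
      refine integral_eq_zero_of_ae ?_
      filter_upwards [surfaceMeasure_frontier_compl Ω] with x hx
      rw [hΩ.isOpen.frontier_eq] at hx
      have h0 : χ i x = 0 := image_eq_zero_of_notMem_tsupport fun h => hx.2 (hi (hχU i h))
      simp [h0, detDeriv]
    · exact hc.setIntegral_detDeriv hΩ.isOpen hT (hL i) (hWc i) ((hsub i).trans (hχU i)) hA
  have hleft : ∫ x in Ω, detDeriv (fderiv ℝ T x) (fderiv ℝ W x)
      = ∑ i, ∫ x in Ω, detDeriv (fderiv ℝ T x) (fderiv ℝ (fun x => χ i x • W x) x) := by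
    rw [← integral_finsetSum _ fun i _ => integrableOn_detDeriv_fderiv hT (hL i)
      hΩ.isBounded.measure_lt_top.ne]
    refine setIntegral_congr_ae hΩ.isOpen.measurableSet ?_
    filter_upwards [ae_all_iff.2 fun i => (hL i).ae_differentiableAt] with x hx hxΩ
    rw [← detDeriv_sum, ← fderiv_fun_sum fun i _ => hx i]
    congr 1
    refine Filter.EventuallyEq.fderiv_eq ?_
    filter_upwards [hΩ.isOpen.mem_nhds hxΩ] with y hy
    rw [← Finset.sum_smul, hχs y (subset_closure hy), one_smul]
  have hright : ∫ x, detDeriv (A x) (rankOne ℝ (W x) (outerNormal Ω x)) ∂(surfaceMeasure Ω)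
      = ∑ i, ∫ x, detDeriv (A x) (rankOne ℝ (χ i x • W x) (outerNormal Ω x))
          ∂(surfaceMeasure Ω) := by
    rw [← integral_finsetSum _ fun i _ => integrable_surfaceMeasure_detDeriv hd hΩ
      (hL i).continuous.continuousOn hAm hAb]
    refine integral_congr_ae ?_
    filter_upwards [surfaceMeasure_frontier_compl Ω] with x hx
    rw [← detDeriv_sum]
    congr 1
    ext1 v
    simp only [InnerProductSpace.rankOne_apply, FunLike.coe_sum, Finset.sum_apply]
    rw [← Finset.smul_sum, ← Finset.sum_smul, hχs x (frontier_subset_closure hx), one_smul]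
  rw [hleft, hright]
  exact Finset.sum_congr rfl fun i _ => hloc i

end

/-! ### From pointwise to global Lipschitz bounds on a Lipschitz domain -/

/-- A growth estimate along segments: pointwise Lipschitz bounds on a convex set are global. -/
theorem lipschitzOnWith_of_convex_of_eventually {E G : Type*} [NormedAddCommGroup E]
    [NormedSpace ℝ E] [NormedAddCommGroup G] {s : Set E} (hs : Convex ℝ s) {k : E → G} {L : ℝ≥0}
    (h : ∀ x ∈ s, ∀ᶠ y in 𝓝[s] x, ‖k y - k x‖ ≤ L * ‖y - x‖) : LipschitzOnWith L k s := by
  refine LipschitzOnWith.of_dist_le_mul fun b hb a ha => ?_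
  rw [dist_eq_norm, dist_eq_norm]
  have hmem : ∀ τ ∈ Icc (0 : ℝ) 1, a + τ • (b - a) ∈ s := fun τ hτ =>
    hs.add_smul_sub_mem ha hb hτ
  let f : ℝ → ℝ := fun τ => ‖k (a + τ • (b - a)) - k a‖
  have htend : ∀ τ ∈ Icc (0 : ℝ) 1, Tendsto (fun σ : ℝ => a + σ • (b - a)) (𝓝[Icc 0 1] τ)
      (𝓝[s] (a + τ • (b - a))) := by
    intro τ hτ
    refine tendsto_nhdsWithin_iff.2 ⟨?_, eventually_mem_nhdsWithin.mono fun σ hσ => hmem σ hσ⟩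
    have : Continuous fun σ : ℝ => a + σ • (b - a) := by fun_prop
    exact (this.tendsto τ).mono_left nhdsWithin_le_nhds
  have hloc : ∀ τ ∈ Icc (0 : ℝ) 1, ∀ᶠ σ in 𝓝[Icc 0 1] τ,
      |f σ - f τ| ≤ L * ‖b - a‖ * |σ - τ| := by
    intro τ hτ
    filter_upwards [(htend τ hτ).eventually (h _ (hmem τ hτ))] with σ hσ
    have e1 : a + σ • (b - a) - (a + τ • (b - a)) = (σ - τ) • (b - a) := by module
    rw [e1, norm_smul, Real.norm_eq_abs] at hσ
    have e2 := abs_norm_sub_norm_le (k (a + σ • (b - a)) - k a) (k (a + τ • (b - a)) - k a)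
    rw [sub_sub_sub_cancel_right] at e2
    calc _ ≤ _ := e2
      _ ≤ _ := hσ
      _ = _ := by ring
  have hcont : ContinuousOn f (Icc 0 1) := by
    intro τ hτ
    rw [ContinuousWithinAt, tendsto_iff_dist_tendsto_zero]
    refine squeeze_zero' (Eventually.of_forall fun _ => dist_nonneg) (hloc τ hτ) ?_
    have : Continuous fun σ : ℝ => L * ‖b - a‖ * |σ - τ| := by fun_prop
    simpa using (this.tendsto τ).mono_left (nhdsWithin_le_nhds (s := Icc 0 1))
  have key := image_le_of_liminf_slope_right_le_deriv_boundary (f := f) (a := 0) (b := 1)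
    (B := fun τ => L * ‖b - a‖ * τ) (B' := fun _ => L * ‖b - a‖) hcont (by simp [f])
    (by fun_prop) (fun τ _ => by
      simpa using ((hasDerivAt_id τ).const_mul (L * ‖b - a‖)).hasDerivWithinAt)
    (fun τ hτ r hr => by
      have h1 := (hloc τ ⟨hτ.1, hτ.2.le⟩).filter_mono
        (nhdsWithin_mono τ (Ico_subset_Icc_self : Ico (0 : ℝ) 1 ⊆ Icc 0 1))
      have h2 : 𝓝[>] τ ≤ 𝓝[Ico 0 1] τ := by
        rw [← nhdsWithin_Ioo_eq_nhdsGT hτ.2]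
        exact nhdsWithin_mono τ fun σ hσ => ⟨hτ.1.trans hσ.1.le, hσ.2⟩
      refine Eventually.frequently ?_
      filter_upwards [h1.filter_mono h2, self_mem_nhdsWithin] with σ hσ hlt
      have hlt : 0 < σ - τ := sub_pos.2 hlt
      refine lt_of_le_of_lt ?_ hr
      rw [slope_def_field, div_le_iff₀ hlt]
      calc f σ - f τ ≤ |f σ - f τ| := le_abs_self _
        _ ≤ _ := hσ
        _ = _ := by rw [abs_of_pos hlt])
    (right_mem_Icc.2 zero_le_one)
  simpa [f] using key

/-- Locally, a Lipschitz domain is a convex set in sheared coordinates. Hence a continuous function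
with pointwise Lipschitz constants bounded by `L` in `Ω` is Lipschitz on the closure. -/
theorem exists_lipschitzOnWith_closure {d : ℕ} (hd : 2 ≤ d) {Ω : Set (Space d)}
    (hΩ : IsBoundedLipschitzDomain Ω) {k : Space d → ℝ} (hk : ContinuousOn k (closure Ω)) {L : ℝ≥0}
    (h : ∀ x ∈ Ω, ∀ᶠ y in 𝓝 x, ‖k y - k x‖ ≤ L * ‖y - x‖) :
    ∃ L', LipschitzOnWith L' k (closure Ω) := by
  refine LocallyLipschitzOn.exists_lipschitzOnWith_of_compact hΩ.isCompact_closure fun x hx => ?_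
  by_cases hxΩ : x ∈ Ω
  · obtain ⟨r, hr, hball⟩ := Metric.isOpen_iff.1 hΩ.isOpen x hxΩ
    exact ⟨L, Metric.ball x r, mem_nhdsWithin_of_mem_nhds (Metric.ball_mem_nhds x hr),
      lipschitzOnWith_of_convex_of_eventually (convex_ball x r) fun y hy =>
        (h y (hball hy)).filter_mono nhdsWithin_le_nhds⟩
  · obtain ⟨r, hr, F, φ, K, hc⟩ := exists_chart hd hΩ (x₀ := x)
      ⟨hx, fun hi => hxΩ (interior_subset hi)⟩
    have hsh := F.lipschitzWith_shear hc.lipschitz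
    have hinv : LipschitzWith (1 + K) (F.shear (-φ)) := F.lipschitzWith_shear hc.lipschitz.neg
    have hop : IsOpen (F.shear φ ⁻¹' Metric.ball x r) :=
      hc.isOpen.preimage hsh.continuous
    obtain ⟨ρ, hρ, hball⟩ := Metric.isOpen_iff.1 hop (F.shear (-φ) x)
      (by rw [mem_preimage, F.shear_shear_neg]; exact Metric.mem_ball_self hr)
    set B := Metric.ball (F.shear (-φ) x) ρ
    set V := B ∩ {y | 0 < ⟪F.e, y⟫}
    have hVΩ : ∀ y ∈ V, F.shear φ y ∈ Ω := fun y hy => by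
      rw [hc.mem_iff _ (hball hy.1), ← F.shear_image_halfSpace]
      exact mem_image_of_mem _ hy.2
    have hVc : Convex ℝ V := (convex_ball _ _).inter
      (convex_halfSpace_gt (f := fun y => ⟪F.e, y⟫) (innerSL ℝ F.e).toLinearMap.isLinear 0)
    have h1 : LipschitzOnWith (L * (1 + K)) (k ∘ F.shear φ) V := by
      refine lipschitzOnWith_of_convex_of_eventually hVc fun y hy => ?_
      refine ((hsh.continuous.tendsto y).eventually (h _ (hVΩ y hy))).filter_mono
        nhdsWithin_le_nhds |>.mono fun z hz => ?_
      refine hz.trans ?_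
      rw [NNReal.coe_mul, mul_assoc]
      gcongr
      exact hsh.norm_sub_le z y
    set O := F.shear (-φ) ⁻¹' B
    have hO : IsOpen O := Metric.isOpen_ball.preimage hinv.continuous
    have h2 : LipschitzOnWith (L * (1 + K) * (1 + K)) k (Ω ∩ O) := by
      have hmaps : MapsTo (F.shear (-φ)) (Ω ∩ O) V := by
        intro y hy
        refine ⟨hy.2, ?_⟩
        have hyr : y ∈ Metric.ball x r := by
          have := hball hy.2
          rwa [mem_preimage, F.shear_shear_neg] at this
        have := (hc.mem_iff y hyr).1 hy.1
        rw [← F.shear_image_halfSpace] at this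
        obtain ⟨z, hz, rfl⟩ := this
        rw [F.shear_neg_shear]
        exact hz
      have h3 := h1.comp (hinv.lipschitzOnWith (s := Ω ∩ O)) hmaps
      have e : (k ∘ F.shear φ) ∘ F.shear (-φ) = k := funext fun y => by
        simp [F.shear_shear_neg]
      rwa [e] at h3
    refine ⟨L * (1 + K) * (1 + K), closure Ω ∩ O, inter_mem_nhdsWithin _ (hO.mem_nhds ?_), ?_⟩
    · rw [mem_preimage]
      exact Metric.mem_ball_self hρ
    · exact (h2.closure (hk.mono (closure_mono inter_subset_left))).mono
        hO.closure_inter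

/-! ### Differentiating integrals that depend on a parameter -/

theorem hasDerivAt_of_norm_sub_sub_le_sq {G : Type*} [NormedAddCommGroup G] [NormedSpace ℝ G]
    {f : ℝ → G} {f' : G} {s C : ℝ}
    (h : ∀ᶠ t in 𝓝 s, ‖f t - f s - (t - s) • f'‖ ≤ C * |t - s| ^ 2) : HasDerivAt f f' s := by
  rw [hasDerivAt_iff_isLittleO]
  have hO : (fun t => f t - f s - (t - s) • f') =O[𝓝 s] fun t => |t - s| ^ 2 := by
    refine Asymptotics.IsBigO.of_bound C ?_
    filter_upwards [h] with t ht
    rwa [Real.norm_eq_abs, abs_of_nonneg (by positivity)]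
  refine hO.trans_isLittleO ?_
  have h1 : (fun t : ℝ => |t - s| ^ 2) =o[𝓝 s] fun t => |t - s| := by
    have : Tendsto (fun t : ℝ => |t - s|) (𝓝 s) (𝓝 0) := by
      have : Continuous fun t : ℝ => |t - s| := by fun_prop
      simpa using this.tendsto s
    exact ((Asymptotics.isLittleO_pow_id (𝕜 := ℝ) one_lt_two).comp_tendsto this).congr
      (fun _ => rfl) (fun _ => rfl)
  exact h1.trans_isBigO (Asymptotics.isBigO_abs_left.2 (Asymptotics.isBigO_refl _ _))

/-- Differentiation under the integral when the remainder is quadratic in `t - s` uniformly in `x`.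
The exceptional null set may depend on `t`, unlike for dominated convergence; this matters for
the volume elements, as derivatives in `x` of Lipschitz maps exist off null sets depending on `t`. -/
theorem hasDerivAt_integral_of_quadratic {X : Type*} [MeasurableSpace X] {μ : Measure X}
    [IsFiniteMeasure μ] {f : ℝ → X → ℝ} {f' : X → ℝ} {s C : ℝ}
    (hf : ∀ᶠ t in 𝓝 s, Integrable (f t) μ) (hf' : Integrable f' μ)
    (h : ∀ᶠ t in 𝓝 s, ∀ᵐ x ∂μ, |f t x - f s x - (t - s) * f' x| ≤ C * |t - s| ^ 2) :
    HasDerivAt (fun t => ∫ x, f t x ∂μ) (∫ x, f' x ∂μ) s := by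
  have hs := hf.self_of_nhds
  refine hasDerivAt_of_norm_sub_sub_le_sq (C := C * μ.real univ) ?_
  filter_upwards [hf, h] with t ht hb
  have e : (∫ x, f t x ∂μ) - (∫ x, f s x ∂μ) - (t - s) • ∫ x, f' x ∂μ
      = ∫ x, (f t x - f s x - (t - s) * f' x) ∂μ := by
    have h1 : Integrable (fun x => f t x - f s x) μ := ht.sub hs
    rw [integral_sub h1 (hf'.const_mul _), integral_sub ht hs, integral_const_mul, smul_eq_mul]
  rw [e]
  have := norm_integral_le_of_norm_le_const
    (f := fun x => f t x - f s x - (t - s) * f' x) (C := C * |t - s| ^ 2) hb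
  linarith

theorem norm_sub_sub_le_of_lipschitz_deriv {G : Type*} [NormedAddCommGroup G] [NormedSpace ℝ G]
    {f f' : ℝ → G} {J : Set ℝ} (hJ : Convex ℝ J) {C : ℝ}
    (hf : ∀ t ∈ J, HasDerivAt f (f' t) t)
    (hf' : ∀ t ∈ J, ∀ s ∈ J, ‖f' t - f' s‖ ≤ C * |t - s|) {s t : ℝ} (hs : s ∈ J) (ht : t ∈ J) :
    ‖f t - f s - (t - s) • f' s‖ ≤ C * |t - s| ^ 2 := by
  have hsub : segment ℝ s t ⊆ J := hJ.segment_subset hs ht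
  have hder : ∀ r ∈ segment ℝ s t, HasDerivWithinAt (fun r => f r - (r - s) • f' s)
      (f' r - f' s) (segment ℝ s t) r := by
    intro r hr
    have h1 := (hf r (hsub hr)).sub (((hasDerivAt_id r).sub_const s).smul_const (f' s))
    rw [one_smul] at h1
    exact h1.hasDerivWithinAt
  have key := (convex_segment s t).norm_image_sub_le_of_norm_hasDerivWithin_le hder
    (C := C * |t - s|) (fun r hr => by
      refine (hf' r (hsub hr) s hs).trans ?_
      rcases eq_or_ne s t with rfl | hne
      · rw [segment_same] at hr
        rw [mem_singleton_iff.1 hr]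
      have hC : 0 ≤ C := by
        have := (norm_nonneg _).trans (hf' s hs t ht)
        exact nonneg_of_mul_nonneg_left this (abs_pos.2 (sub_ne_zero.2 hne))
      rw [segment_eq_uIcc] at hr
      exact mul_le_mul_of_nonneg_left (abs_sub_left_of_mem_uIcc hr) hC)
    (left_mem_segment ℝ s t) (right_mem_segment ℝ s t)
  simp only [sub_self, zero_smul, sub_zero] at key
  rw [show f t - f s - (t - s) • f' s = f t - (t - s) • f' s - f s by abel]
  refine key.trans_eq ?_
  rw [Real.norm_eq_abs]; ring

theorem norm_sub_le_of_bounded_deriv {G : Type*} [NormedAddCommGroup G] [NormedSpace ℝ G]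
    {f f' : ℝ → G} {J : Set ℝ} (hJ : Convex ℝ J) {C : ℝ}
    (hf : ∀ t ∈ J, HasDerivAt f (f' t) t) (hf' : ∀ t ∈ J, ‖f' t‖ ≤ C) {s t : ℝ}
    (hs : s ∈ J) (ht : t ∈ J) : ‖f t - f s‖ ≤ C * |t - s| :=
  hJ.norm_image_sub_le_of_norm_hasDerivWithin_le
    (fun r hr => (hf r hr).hasDerivWithinAt) hf' hs ht

/-- The product rule with quadratic remainders. -/
theorem abs_mul_sub_mul_sub_le {a₀ a₁ a' b₀ b₁ b' τ A B R : ℝ} (hτ : |τ| ≤ 1)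
    (ha : |a₁ - a₀ - τ * a'| ≤ A * |τ| ^ 2) (hb : |b₁ - b₀ - τ * b'| ≤ B * |τ| ^ 2)
    (ha₀ : |a₀| ≤ R) (ha' : |a'| ≤ R) (hb₀ : |b₀| ≤ R) (hb' : |b'| ≤ R)
    (hA : 0 ≤ A) (hB : 0 ≤ B) :
    |a₁ * b₁ - a₀ * b₀ - τ * (a' * b₀ + a₀ * b')|
      ≤ (R * R + A * (R + R + B) + (R + R) * B) * |τ| ^ 2 := by
  have hR : 0 ≤ R := (abs_nonneg _).trans ha₀
  have hτ2 : |τ| ^ 2 ≤ 1 := pow_le_one₀ (abs_nonneg _) hτ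
  set α := a₁ - a₀ - τ * a'
  set β := b₁ - b₀ - τ * b'
  have hlin : ∀ {p q : ℝ}, |p| ≤ R → |q| ≤ R → |p + τ * q| ≤ R + R := by
    intro p q hp hq
    refine (abs_add_le _ _).trans (add_le_add hp ?_)
    rw [abs_mul]
    calc |τ| * |q| ≤ 1 * R := by gcongr
      _ = R := one_mul R
  have e : a₁ * b₁ - a₀ * b₀ - τ * (a' * b₀ + a₀ * b')
      = τ ^ 2 * (a' * b') + α * ((b₀ + τ * b') + β) + (a₀ + τ * a') * β := by
    simp only [α, β]; ring
  have h1 : |(b₀ + τ * b') + β| ≤ R + R + B := by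
    refine (abs_add_le _ _).trans (add_le_add (hlin hb₀ hb') (hb.trans ?_))
    exact mul_le_of_le_one_right hB hτ2
  rw [e]
  refine (abs_add_three _ _ _).trans ?_
  rw [abs_mul, abs_mul, abs_mul, abs_mul, abs_pow]
  calc |τ| ^ 2 * (|a'| * |b'|) + |α| * |(b₀ + τ * b') + β| + |a₀ + τ * a'| * |β|
      ≤ |τ| ^ 2 * (R * R) + (A * |τ| ^ 2) * (R + R + B) + (R + R) * (B * |τ| ^ 2) := by
        gcongr
        exact hlin ha₀ ha'
    _ = _ := by ring

/-! ### Extending a family of deformations to the whole space -/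

/-- The maps `Θ t` of the whole space extend the deformations `T t` of `Ω` for `|t| < δ`, and `V t`
extends the velocity field `∂ₜ T t`, with bounds that are uniform in `t`. The remainder
`E t = Θ t - id - t • V 0` has Lipschitz constant `O(t²)`, and `Θ t - id` is a contraction, so that
`Θ t` is a bi-Lipschitz homeomorphism of the whole space. -/
structure IsFamilyExtension {d : ℕ} (Ω : Set (Space d)) (T : ℝ → Space d → Space d) (δ : ℝ)
    (B : ℝ≥0) (Θ V E : ℝ → Space d → Space d) : Prop where
  pos : 0 < δ
  le_one : δ ≤ 1
  eqOn : ∀ t ∈ Ioo (-δ) δ, EqOn (Θ t) (T t) Ω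
  eq_add : ∀ t x, Θ t x = x + (t • V 0 x + E t x)
  zero : ∀ x, Θ 0 x = x
  lipschitz_V : ∀ t ∈ Ioo (-δ) δ, LipschitzWith B (V t)
  lipschitz_E : ∀ t ∈ Ioo (-δ) δ, LipschitzWith (B * ‖t‖₊ ^ 2) (E t)
  lipschitz_half : ∀ t ∈ Ioo (-δ) δ, LipschitzWith (1 / 2) fun x => t • V 0 x + E t x
  norm_V_le : ∀ t ∈ Ioo (-δ) δ, ∀ x ∈ closure Ω, ‖V t x‖ ≤ B
  norm_V_sub_le : ∀ t ∈ Ioo (-δ) δ, ∀ s ∈ Ioo (-δ) δ, ∀ x ∈ closure Ω,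
    ‖V t x - V s x‖ ≤ B * |t - s|
  norm_sub_sub_le : ∀ t ∈ Ioo (-δ) δ, ∀ s ∈ Ioo (-δ) δ, ∀ x ∈ closure Ω,
    ‖Θ t x - Θ s x - (t - s) • V s x‖ ≤ B * |t - s| ^ 2
  lipschitz_sub_sub : ∀ t ∈ Ioo (-δ) δ, ∀ s ∈ Ioo (-δ) δ,
    LipschitzOnWith (B * ‖t - s‖₊ ^ 2) (fun x => Θ t x - Θ s x - (t - s) • V s x) Ω
  velocity_eq : EqOn (velocity Ω T) (V 0) (closure Ω)
  hasDerivAt_V : ∀ x ∈ closure Ω, HasDerivAt (fun t => V t x) (acceleration Ω T x) 0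
  continuousOn_acceleration : ContinuousOn (acceleration Ω T) (closure Ω)

namespace IsTwiceDifferentiableFamily

variable {d : ℕ} {Ω : Set (Space d)} {ε : ℝ} {T : ℝ → Space d → Space d}

theorem hasDerivAt (hT : IsTwiceDifferentiableFamily Ω ε T) {x : Space d} (hx : x ∈ Ω) {t : ℝ}
    (ht : t ∈ Ioo (-ε) ε) : HasDerivAt (fun s => T s x) (deriv (fun s => T s x) t) t :=
  (((hT.contDiffOn x hx).contDiffAt (isOpen_Ioo.mem_nhds ht)).differentiableAt
    (by norm_num)).hasDerivAt

theorem continuousOn_iteratedDeriv (hT : IsTwiceDifferentiableFamily Ω ε T) {x : Space d}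
    (hx : x ∈ Ω) : ContinuousOn (iteratedDeriv 2 fun s => T s x) (Ioo (-ε) ε) := by
  have h1 := ((contDiffOn_succ_iff_deriv_of_isOpen (n := 1) isOpen_Ioo).1
    (by rw [one_add_one_eq_two]; exact hT.contDiffOn x hx)).2.2
  have h2 := ((contDiffOn_succ_iff_deriv_of_isOpen (n := 0) isOpen_Ioo).1
    (by simpa using h1)).2.2
  rw [iteratedDeriv_succ, iteratedDeriv_one]
  exact h2.continuousOn

theorem hasDerivAt_deriv (hT : IsTwiceDifferentiableFamily Ω ε T) {x : Space d} (hx : x ∈ Ω)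
    {t : ℝ} (ht : t ∈ Ioo (-ε) ε) :
    HasDerivAt (fun r => deriv (fun s => T s x) r) (iteratedDeriv 2 (fun s => T s x) t) t := by
  have h1 := ((contDiffOn_succ_iff_deriv_of_isOpen (n := 1) isOpen_Ioo).1
    (by rw [one_add_one_eq_two]; exact hT.contDiffOn x hx)).2.2
  rw [iteratedDeriv_succ, iteratedDeriv_one]
  exact ((h1.contDiffAt (isOpen_Ioo.mem_nhds ht)).differentiableAt (by norm_num)).hasDerivAt

/-- The velocities and the remainders `T t - id - t • S`, which are Lipschitz on `Ω`, are extended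
separately, so that the Lipschitz constants of the extended remainders are still `O(t²)`. -/
theorem exists_extension (hΩ : IsBoundedLipschitzDomain Ω) (hε : 0 < ε)
    (hT : IsTwiceDifferentiableFamily Ω ε T) :
    ∃ δ ≤ ε, ∃ B Θ V E, IsFamilyExtension Ω T δ B Θ V E := by
  obtain ⟨M₁, hM₁⟩ := hT.bounded_jacobian_deriv
  obtain ⟨M₂, hM₂⟩ := hT.bounded_jacobian_deriv_two
  set V₀ : ℝ → Space d → Space d := fun t x => deriv (fun s => T s x) t
  set R₀ : ℝ → Space d → Space d := fun t x => iteratedDeriv 2 (fun s => T s x) t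
  have hTd : ∀ x ∈ Ω, ∀ t ∈ Ioo (-ε) ε, HasDerivAt (fun s => T s x) (V₀ t x) t :=
    fun x hx t ht => hT.hasDerivAt hx ht
  have hVd : ∀ x ∈ Ω, ∀ t ∈ Ioo (-ε) ε, HasDerivAt (fun s => V₀ s x) (R₀ t x) t :=
    fun x hx t ht => hT.hasDerivAt_deriv hx ht
  have h0ε : (0 : ℝ) ∈ Ioo (-ε) ε := ⟨by linarith, hε⟩
  -- Differences of two trajectories: this controls Lipschitz constants in `x`.
  have hVV : ∀ x ∈ Ω, ∀ y ∈ Ω, ∀ t ∈ Ioo (-ε) ε, ∀ s ∈ Ioo (-ε) ε,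
      ‖(V₀ t x - V₀ t y) - (V₀ s x - V₀ s y)‖ ≤ M₂ * ‖x - y‖ * |t - s| := by
    intro x hx y hy t ht s hs
    exact norm_sub_le_of_bounded_deriv (f := fun t => V₀ t x - V₀ t y) (convex_Ioo _ _)
      (fun r hr => (hVd x hx r hr).sub (hVd y hy r hr))
      (fun r hr => (hM₂ r hr).norm_sub_le hx hy) hs ht
  have hTT : ∀ x ∈ Ω, ∀ y ∈ Ω, ∀ t ∈ Ioo (-ε) ε, ∀ s ∈ Ioo (-ε) ε,
      ‖(T t x - T t y) - (T s x - T s y) - (t - s) • (V₀ s x - V₀ s y)‖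
        ≤ M₂ * ‖x - y‖ * |t - s| ^ 2 := by
    intro x hx y hy t ht s hs
    exact norm_sub_sub_le_of_lipschitz_deriv (f := fun t => T t x - T t y)
      (f' := fun t => V₀ t x - V₀ t y) (convex_Ioo _ _)
      (fun r hr => (hTd x hx r hr).sub (hTd y hy r hr))
      (fun r hr q hq => hVV x hx y hy r hr q hq) hs ht
  -- Uniform bounds in `x` on a compact interval of times.
  obtain ⟨x₀, hx₀⟩ := hΩ.isConnected.nonempty
  obtain ⟨D, hD⟩ := Metric.isBounded_iff.1 hΩ.isBounded
  have hD0 : 0 ≤ D := dist_nonneg.trans (hD hx₀ hx₀)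
  have hsub : Icc (-(ε / 2)) (ε / 2) ⊆ Ioo (-ε) ε := fun t ht =>
    ⟨by linarith [ht.1], by linarith [ht.2]⟩
  obtain ⟨b, hb⟩ := isCompact_Icc.exists_bound_of_continuousOn
    ((hT.continuousOn_iteratedDeriv hx₀).mono hsub)
  have hR : ∀ t ∈ Icc (-(ε / 2)) (ε / 2), ∀ x ∈ Ω, ‖R₀ t x‖ ≤ b + M₂ * D := by
    intro t ht x hx
    have h1 := (hM₂ t (hsub ht)).norm_sub_le hx hx₀
    have h2 := hb t ht
    have h3 : M₂ * ‖x - x₀‖ ≤ M₂ * D := by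
      gcongr
      simpa [dist_eq_norm] using hD hx hx₀
    have h4 := norm_sub_norm_le (R₀ t x) (R₀ t x₀)
    have h2' : ‖R₀ t x₀‖ ≤ b := h2
    have h1' : ‖R₀ t x - R₀ t x₀‖ ≤ M₂ * ‖x - x₀‖ := h1
    linarith
  set b₂ := b + M₂ * D
  have hb₂ : 0 ≤ b₂ := (norm_nonneg _).trans (hR 0 ⟨by linarith, by linarith⟩ x₀ hx₀)
  set b₁ := ‖V₀ 0 x₀‖ + M₁ * D
  have hV0 : ∀ x ∈ Ω, ‖V₀ 0 x‖ ≤ b₁ := by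
    intro x hx
    have h1 : ‖V₀ 0 x - V₀ 0 x₀‖ ≤ M₁ * ‖x - x₀‖ := (hM₁ 0 h0ε).norm_sub_le hx hx₀
    have h3 : M₁ * ‖x - x₀‖ ≤ M₁ * D := by
      gcongr
      simpa [dist_eq_norm] using hD hx hx₀
    have h4 := norm_sub_norm_le (V₀ 0 x) (V₀ 0 x₀)
    linarith
  have hb₁ : 0 ≤ b₁ := (norm_nonneg _).trans (hV0 x₀ hx₀)
  set κ := lipschitzExtensionConstant (Space d)
  -- The constant bounding everything, and a time interval on which `Θ t - id` is a contraction.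
  set B : ℝ≥0 := κ * M₁ + κ * M₂ + M₂ + ⟨b₂, hb₂⟩ + ⟨b₁ + b₂, add_nonneg hb₁ hb₂⟩ with hBdef
  have hBcoe : (B : ℝ) = κ * M₁ + κ * M₂ + M₂ + b₂ + (b₁ + b₂) := by
    rw [hBdef]; rfl
  have hB1 : κ * M₁ ≤ B := by
    rw [← NNReal.coe_le_coe, hBcoe]; push_cast
    have : 0 ≤ (κ * M₂ : ℝ) := by positivity
    have := M₂.coe_nonneg; linarith
  have hB2 : κ * M₂ ≤ B := by
    rw [← NNReal.coe_le_coe, hBcoe]; push_cast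
    have : 0 ≤ (κ * M₁ : ℝ) := by positivity
    have := M₂.coe_nonneg; linarith
  have hB3 : M₂ ≤ B := by
    rw [← NNReal.coe_le_coe, hBcoe]
    have : 0 ≤ (κ * M₁ : ℝ) := by positivity
    have : 0 ≤ (κ * M₂ : ℝ) := by positivity
    linarith
  have hB4 : b₂ ≤ B := by
    rw [hBcoe]
    have : 0 ≤ (κ * M₁ : ℝ) := by positivity
    have : 0 ≤ (κ * M₂ : ℝ) := by positivity
    have := M₂.coe_nonneg; linarith
  have hB5 : b₁ + b₂ ≤ B := by
    rw [hBcoe]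
    have : 0 ≤ (κ * M₁ : ℝ) := by positivity
    have : 0 ≤ (κ * M₂ : ℝ) := by positivity
    have := M₂.coe_nonneg; linarith
  obtain ⟨δ, hδ0, hδ1, hδε, hδB⟩ : ∃ δ : ℝ, 0 < δ ∧ δ ≤ 1 ∧ δ ≤ ε / 2 ∧ δ * (B + B) ≤ 1 / 2 := by
    refine ⟨min (min 1 (ε / 2)) (1 / (4 * (B + 1))), by positivity,
      (min_le_left _ _).trans (min_le_left _ _), (min_le_left _ _).trans (min_le_right _ _), ?_⟩
    have hBn := B.coe_nonneg
    calc _ ≤ 1 / (4 * ((B : ℝ) + 1)) * (B + B) := by gcongr; exact min_le_right _ _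
      _ ≤ 1 / 2 := by
        rw [div_mul_eq_mul_div, div_le_div_iff₀ (by positivity) (by positivity)]
        linarith
  have hJI : ∀ t ∈ Ioo (-δ) δ, t ∈ Icc (-(ε / 2)) (ε / 2) := fun t ht =>
    ⟨by linarith [ht.1], by linarith [ht.2]⟩
  have hJ : ∀ t ∈ Ioo (-δ) δ, t ∈ Ioo (-ε) ε := fun t ht => hsub (hJI t ht)
  have h0J : (0 : ℝ) ∈ Ioo (-δ) δ := ⟨by linarith, hδ0⟩
  -- The extensions.
  have hexV : ∀ t, ∃ g : Space d → Space d, t ∈ Ioo (-ε) ε →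
      LipschitzWith (κ * M₁) g ∧ EqOn (V₀ t) g Ω := by
    intro t
    by_cases ht : t ∈ Ioo (-ε) ε
    · obtain ⟨g, hg⟩ := (hM₁ t ht).extend_finite_dimension
      exact ⟨g, fun _ => hg⟩
    · exact ⟨0, fun h => absurd h ht⟩
  choose V hV using hexV
  have hexE : ∀ t, ∃ g : Space d → Space d, t ∈ Ioo (-ε) ε →
      LipschitzWith (κ * (M₂ * ‖t‖₊ ^ 2)) g ∧ EqOn (fun x => T t x - x - t • V₀ 0 x) g Ω := by
    intro t
    by_cases ht : t ∈ Ioo (-ε) ε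
    · have hl : LipschitzOnWith (M₂ * ‖t‖₊ ^ 2) (fun x => T t x - x - t • V₀ 0 x) Ω := by
        refine LipschitzOnWith.of_dist_le_mul fun x hx y hy => ?_
        have := hTT x hx y hy t ht 0 h0ε
        rw [hT.zero_eq x hx, hT.zero_eq y hy, sub_zero] at this
        rw [dist_eq_norm, dist_eq_norm]
        calc _ = ‖T t x - T t y - (x - y) - t • (V₀ 0 x - V₀ 0 y)‖ := by
              congr 1; module
          _ ≤ _ := this
          _ = _ := by push_cast; rw [Real.norm_eq_abs]; ring
      obtain ⟨g, hg⟩ := hl.extend_finite_dimension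
      exact ⟨g, fun _ => hg⟩
    · exact ⟨0, fun h => absurd h ht⟩
  choose E hE using hexE
  obtain ⟨R, hRl, hRe⟩ := (hM₂ 0 h0ε).extend_finite_dimension
  have hVe : ∀ t ∈ Ioo (-δ) δ, ∀ x ∈ Ω, V t x = V₀ t x := fun t ht x hx =>
    ((hV t (hJ t ht)).2 hx).symm
  have hVl : ∀ t ∈ Ioo (-δ) δ, LipschitzWith B (V t) := fun t ht =>
    (hV t (hJ t ht)).1.weaken hB1
  have hEl : ∀ t ∈ Ioo (-δ) δ, LipschitzWith (B * ‖t‖₊ ^ 2) (E t) := fun t ht =>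
    (hE t (hJ t ht)).1.weaken (by rw [← mul_assoc]; gcongr)
  set Θ : ℝ → Space d → Space d := fun t x => x + (t • V 0 x + E t x)
  have hΘe : ∀ t ∈ Ioo (-δ) δ, ∀ x ∈ Ω, Θ t x = T t x := fun t ht x hx => by
    have := (hE t (hJ t ht)).2 hx
    simp only [Θ]
    rw [← this, hVe 0 h0J x hx]
    module
  have hhalf : ∀ t ∈ Ioo (-δ) δ, LipschitzWith (1 / 2) fun x => t • V 0 x + E t x := by
    intro t ht
    have habs : |t| ≤ δ := (abs_lt.2 ht).le
    refine LipschitzWith.of_dist_le_mul fun x y => ?_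
    rw [dist_eq_norm, dist_eq_norm]
    have e1 : t • V 0 x + E t x - (t • V 0 y + E t y)
        = t • (V 0 x - V 0 y) + (E t x - E t y) := by module
    have h1 := (hVl 0 h0J).norm_sub_le x y
    have h2 := (hEl t ht).norm_sub_le x y
    have h3 : ‖t • (V 0 x - V 0 y)‖ ≤ δ * (B * ‖x - y‖) := by
      rw [norm_smul, Real.norm_eq_abs]; gcongr
    have h4 : ‖E t x - E t y‖ ≤ δ * (B * ‖x - y‖) := by
      refine h2.trans ?_
      push_cast
      rw [Real.norm_eq_abs]
      have : |t| ^ 2 ≤ δ := by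
        calc |t| ^ 2 = |t| * |t| := sq _
          _ ≤ δ * 1 := by gcongr; exact habs.trans hδ1
          _ = δ := mul_one δ
      calc B * |t| ^ 2 * ‖x - y‖ ≤ B * δ * ‖x - y‖ := by gcongr
        _ = _ := by ring
    rw [e1]
    calc _ ≤ _ := norm_add_le _ _
      _ ≤ δ * (B * ‖x - y‖) + δ * (B * ‖x - y‖) := add_le_add h3 h4
      _ = δ * (B + B) * ‖x - y‖ := by ring
      _ ≤ 1 / 2 * ‖x - y‖ := by gcongr
      _ = _ := by norm_num
  have hΘc : ∀ t ∈ Ioo (-δ) δ, Continuous (Θ t) := fun t ht =>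
    continuous_id.add (hhalf t ht).continuous
  -- Passing to the closure.
  have hcl : ∀ {p : Space d → Space d} {a : ℝ}, Continuous p → (∀ x ∈ Ω, ‖p x‖ ≤ a) →
      ∀ x ∈ closure Ω, ‖p x‖ ≤ a := fun {p a} hp h x hx =>
    closure_minimal (s := Ω) (t := {x | ‖p x‖ ≤ a}) h
      (isClosed_le hp.norm continuous_const) hx
  have hVsub : ∀ t ∈ Ioo (-δ) δ, ∀ s ∈ Ioo (-δ) δ, ∀ x ∈ Ω, ‖V t x - V s x‖ ≤ b₂ * |t - s| := by
    intro t ht s hs x hx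
    rw [hVe t ht x hx, hVe s hs x hx]
    exact norm_sub_le_of_bounded_deriv (f := fun t => V₀ t x) (convex_Icc _ _)
      (fun r hr => hVd x hx r (hsub hr)) (fun r hr => hR r hr x hx) (hJI s hs) (hJI t ht)
  have hvel : EqOn (velocity Ω T) (V 0) (closure Ω) := fun x hx =>
    extendFrom_eq hx ((((hVl 0 h0J).continuous.tendsto x).mono_left nhdsWithin_le_nhds).congr'
      (eventually_mem_nhdsWithin.mono fun y hy => hVe 0 h0J y hy))
  have hacc : EqOn (acceleration Ω T) R (closure Ω) := fun x hx =>
    extendFrom_eq hx (((hRl.continuous.tendsto x).mono_left nhdsWithin_le_nhds).congr'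
      (eventually_mem_nhdsWithin.mono fun y hy => (hRe hy).symm))
  have hVlip : ∀ t ∈ Ioo (-δ) δ, ∀ s ∈ Ioo (-δ) δ,
      LipschitzOnWith (M₂ * ‖t - s‖₊) (fun x => V t x - V s x) Ω := by
    intro t ht s hs
    refine LipschitzOnWith.of_dist_le_mul fun x hx y hy => ?_
    rw [dist_eq_norm, dist_eq_norm, hVe t ht x hx, hVe t ht y hy, hVe s hs x hx, hVe s hs y hy]
    have := hVV x hx y hy t (hJ t ht) s (hJ s hs)
    calc _ = ‖(V₀ t x - V₀ t y) - (V₀ s x - V₀ s y)‖ := by congr 1; abel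
      _ ≤ _ := this
      _ = _ := by push_cast; rw [Real.norm_eq_abs]; ring
  have hVlipc : ∀ t ∈ Ioo (-δ) δ,
      LipschitzOnWith (M₂ * ‖t‖₊) (fun x => V t x - V 0 x) (closure Ω) := fun t ht => by
    have := (hVlip t ht 0 h0J).closure
      ((hVl t ht).continuous.sub (hVl 0 h0J).continuous).continuousOn
    rwa [sub_zero] at this
  refine ⟨δ, by linarith, B, Θ, V, E, ?_⟩
  constructor
  case pos => exact hδ0
  case le_one => exact hδ1
  case eqOn => exact hΘe
  case eq_add => exact fun t x => rfl
  case zero =>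
    intro x
    have h1 := (hEl 0 h0J).norm_sub_le x x₀
    have h2 : E 0 x₀ = 0 := by
      have := (hE 0 h0ε).2 hx₀
      rw [← this]
      simp [hT.zero_eq x₀ hx₀]
    have h3 : E 0 x = 0 := by
      rw [h2] at h1
      simpa using h1
    simp [Θ, h3]
  case lipschitz_V => exact hVl
  case lipschitz_E => exact hEl
  case lipschitz_half => exact hhalf
  case norm_V_le =>
    intro t ht
    refine hcl (hVl t ht).continuous fun x hx => ?_
    have h1 := hVsub t ht 0 h0J x hx
    have h2 := hV0 x hx
    rw [← hVe 0 h0J x hx] at h2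
    have h3 : b₂ * |t - 0| ≤ b₂ := by
      rw [sub_zero]
      exact mul_le_of_le_one_right hb₂ ((abs_lt.2 ht).le.trans hδ1)
    have := norm_sub_norm_le (V t x) (V 0 x)
    linarith
  case norm_V_sub_le =>
    intro t ht s hs
    refine hcl ((hVl t ht).continuous.sub (hVl s hs).continuous) fun x hx => ?_
    exact (hVsub t ht s hs x hx).trans (by gcongr)
  case norm_sub_sub_le =>
    intro t ht s hs
    have hVs := (hVl s hs).continuous
    have hcont : Continuous fun x => Θ t x - Θ s x - (t - s) • V s x :=
      ((hΘc t ht).sub (hΘc s hs)).sub (by fun_prop)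
    refine hcl hcont fun x hx => ?_
    rw [hΘe t ht x hx, hΘe s hs x hx, hVe s hs x hx]
    refine (norm_sub_sub_le_of_lipschitz_deriv (f := fun t => T t x) (f' := fun t => V₀ t x)
      (C := b₂) (convex_Ioo (-δ) δ) (fun r hr => hTd x hx r (hJ r hr)) (fun r hr q hq => ?_)
      hs ht).trans (by gcongr)
    have := hVsub r hr q hq x hx
    rwa [hVe r hr x hx, hVe q hq x hx] at this
  case lipschitz_sub_sub =>
    intro t ht s hs
    refine LipschitzOnWith.of_dist_le_mul fun x hx y hy => ?_
    rw [dist_eq_norm, dist_eq_norm, hΘe t ht x hx, hΘe s hs x hx, hVe s hs x hx, hΘe t ht y hy,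
      hΘe s hs y hy, hVe s hs y hy]
    calc _ = ‖(T t x - T t y) - (T s x - T s y) - (t - s) • (V₀ s x - V₀ s y)‖ := by
          congr 1; module
      _ ≤ _ := hTT x hx y hy t (hJ t ht) s (hJ s hs)
      _ ≤ B * ‖x - y‖ * |t - s| ^ 2 := by gcongr
      _ = _ := by push_cast; rw [Real.norm_eq_abs]; ring
  case velocity_eq => exact hvel
  case hasDerivAt_V =>
    intro x hx
    rw [hacc hx, hasDerivAt_iff_isLittleO, Asymptotics.isLittleO_iff]
    intro η hη
    -- Compare with a point `y` of `Ω` near `x`, where `V` is known to be differentiable in `t`.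
    obtain ⟨y, hy, hxy⟩ : ∃ y ∈ Ω, (M₂ + κ * M₂) * ‖x - y‖ ≤ η / 2 := by
      obtain ⟨y, hy, hd⟩ := Metric.mem_closure_iff.1 hx (η / 2 / (M₂ + κ * M₂ + 1)) (by positivity)
      refine ⟨y, hy, ?_⟩
      rw [dist_eq_norm, lt_div_iff₀ (by positivity)] at hd
      have := norm_nonneg (x - y)
      nlinarith
    have hy' : HasDerivAt (fun t => V t y) (R y) 0 := by
      rw [← hRe hy]
      refine (hVd y hy 0 h0ε).congr_of_eventuallyEq ?_
      filter_upwards [isOpen_Ioo.mem_nhds h0J] with t ht using hVe t ht y hy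
    rw [hasDerivAt_iff_isLittleO, Asymptotics.isLittleO_iff] at hy'
    filter_upwards [hy' (half_pos hη), isOpen_Ioo.mem_nhds h0J] with t h1 ht
    rw [sub_zero] at h1 ⊢
    have h2 := (hVlipc t ht).norm_sub_le hx (subset_closure hy)
    have h3 := hRl.norm_sub_le x y
    have e : V t x - V 0 x - t • R x = (V t y - V 0 y - t • R y)
        + ((V t x - V 0 x - (V t y - V 0 y)) - t • (R x - R y)) := by module
    have h4 : ‖t • (R x - R y)‖ ≤ ‖t‖ * (κ * M₂ * ‖x - y‖) := by
      rw [norm_smul]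
      gcongr
      exact_mod_cast h3
    rw [e]
    calc _ ≤ η / 2 * ‖t‖ + (M₂ * ‖t‖ * ‖x - y‖ + ‖t‖ * (κ * M₂ * ‖x - y‖)) := by
          refine (norm_add_le _ _).trans (add_le_add h1 ((norm_sub_le _ _).trans ?_))
          refine add_le_add ?_ h4
          exact_mod_cast h2
      _ = (η / 2 + (M₂ + κ * M₂) * ‖x - y‖) * ‖t‖ := by ring
      _ ≤ (η / 2 + η / 2) * ‖t‖ := by gcongr
      _ = η * ‖t‖ := by ring
  case continuousOn_acceleration => exact hRl.continuous.continuousOn.congr hacc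

end IsTwiceDifferentiableFamily

/-! ### The deformed volume element -/

namespace IsFamilyExtension

variable {d : ℕ} {Ω : Set (Space d)} {ε δ : ℝ} {T Θ V E : ℝ → Space d → Space d} {B : ℝ≥0}
  {t s : ℝ} {x : Space d}

theorem zero_mem (h : IsFamilyExtension Ω T δ B Θ V E) : (0 : ℝ) ∈ Ioo (-δ) δ :=
  ⟨neg_lt_zero.2 h.pos, h.pos⟩

theorem mem_nhds (_h : IsFamilyExtension Ω T δ B Θ V E) (ht : t ∈ Ioo (-δ) δ) :
    Ioo (-δ) δ ∈ 𝓝 t := isOpen_Ioo.mem_nhds ht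

theorem lipschitz (h : IsFamilyExtension Ω T δ B Θ V E) (ht : t ∈ Ioo (-δ) δ) :
    LipschitzWith (1 + 1 / 2) (Θ t) := by
  have : Θ t = fun x => id x + (t • V 0 x + E t x) := funext fun x => h.eq_add t x
  rw [this]
  exact LipschitzWith.id.add (h.lipschitz_half t ht)

theorem continuous (h : IsFamilyExtension Ω T δ B Θ V E) (ht : t ∈ Ioo (-δ) δ) :
    Continuous (Θ t) := (h.lipschitz ht).continuous

theorem injective (h : IsFamilyExtension Ω T δ B Θ V E) (ht : t ∈ Ioo (-δ) δ) :
    Function.Injective (Θ t) := by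
  have h1 := (bijective_smul_add_lipschitz (h.lipschitz_half t ht) (s := 1)
    (by rw [← NNReal.coe_lt_coe]; norm_num)).1
  have : Θ t = fun x => ((1 : ℝ≥0) : ℝ) • x + (t • V 0 x + E t x) := funext fun x => by
    rw [h.eq_add t x]; simp
  rwa [this]

theorem image_eq (h : IsFamilyExtension Ω T δ B Θ V E) (ht : t ∈ Ioo (-δ) δ) :
    T t '' Ω = Θ t '' Ω := ((h.eqOn t ht).image_eq).symm

theorem hasDerivAt (h : IsFamilyExtension Ω T δ B Θ V E) (hs : s ∈ Ioo (-δ) δ)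
    (hx : x ∈ closure Ω) : HasDerivAt (fun t => Θ t x) (V s x) s :=
  hasDerivAt_of_norm_sub_sub_le_sq (by
    filter_upwards [h.mem_nhds hs] with t ht using h.norm_sub_sub_le t ht s hs x hx)

theorem norm_sub_le (h : IsFamilyExtension Ω T δ B Θ V E) (ht : t ∈ Ioo (-δ) δ)
    (hs : s ∈ Ioo (-δ) δ) (hx : x ∈ closure Ω) : ‖Θ t x - Θ s x‖ ≤ B * |t - s| :=
  norm_sub_le_of_bounded_deriv (convex_Ioo (-δ) δ) (fun _ hr => h.hasDerivAt hr hx)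
    (fun r hr => h.norm_V_le r hr x hx) hs ht

theorem fderiv_eq (h : IsFamilyExtension Ω T δ B Θ V E)
    (hx : DifferentiableAt ℝ (fun y => t • V 0 y + E t y) x) :
    fderiv ℝ (Θ t) x = (1 : ℝ) • 1 + fderiv ℝ (fun y => t • V 0 y + E t y) x := by
  have : Θ t = fun y => y + (t • V 0 y + E t y) := funext fun y => h.eq_add t y
  rw [this, fderiv_fun_add differentiableAt_fun_id hx, fderiv_fun_id, one_smul]
  rfl

/-- `Θ t` preserves orientation, being a perturbation of the identity by a contraction. -/
theorem ae_det_pos (h : IsFamilyExtension Ω T δ B Θ V E) (ht : t ∈ Ioo (-δ) δ) :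
    ∀ᵐ x, 0 < (fderiv ℝ (Θ t) x).det := by
  filter_upwards [(h.lipschitz_half t ht).ae_differentiableAt] with x hx
  rw [h.fderiv_eq hx]
  refine det_smul_one_add_pos
    ((norm_fderiv_le_of_lipschitz' (h.lipschitz_half t ht) x).trans_lt ?_)
  norm_num

theorem norm_fderiv_le (h : IsFamilyExtension Ω T δ B Θ V E) (ht : t ∈ Ioo (-δ) δ)
    (x : Space d) : ‖fderiv ℝ (Θ t) x‖ ≤ 2 := by
  refine (norm_fderiv_le_of_lipschitz' (h.lipschitz ht) x).trans ?_
  norm_num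

theorem exists_abs_det_le (d : ℕ) : ∃ C : ℝ, 0 ≤ C ∧ ∀ A : Space d →L[ℝ] Space d, ‖A‖ ≤ 2 →
    |A.det| ≤ C := by
  have : ProperSpace (Space d →L[ℝ] Space d) := FiniteDimensional.proper_real _
  obtain ⟨C, hC⟩ := (isCompact_closedBall (0 : Space d →L[ℝ] Space d) 2).exists_bound_of_continuousOn
    continuous_det.continuousOn
  exact ⟨C, (norm_nonneg _).trans (hC 0 (by simp)), fun A hA => hC A (by simpa using hA)⟩

/-- The volume elements `det D(Θ t)` are differentiable in `t`, uniformly on `Ω`. -/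
theorem exists_det_bounds (h : IsFamilyExtension Ω T δ B Θ V E) (hΩ : IsOpen Ω) :
    ∃ C : ℝ, 0 ≤ C ∧ (∀ t ∈ Ioo (-δ) δ, ∀ x, |(fderiv ℝ (Θ t) x).det| ≤ C) ∧
      (∀ t ∈ Ioo (-δ) δ, ∀ x, |detDeriv (fderiv ℝ (Θ t) x) (fderiv ℝ (V t) x)| ≤ C) ∧
      ∀ t ∈ Ioo (-δ) δ, ∀ s ∈ Ioo (-δ) δ, ∀ᵐ x ∂volume.restrict Ω,
        |(fderiv ℝ (Θ t) x).det - (fderiv ℝ (Θ s) x).det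
          - (t - s) * detDeriv (fderiv ℝ (Θ s) x) (fderiv ℝ (V s) x)| ≤ C * |t - s| ^ 2 := by
  obtain ⟨C₀, hC₀, hdet⟩ := exists_abs_det_le d
  obtain ⟨C₁, hC₁, hquad⟩ := exists_abs_det_add_sub_le (Space d) 2
  obtain ⟨C₂, hC₂, hlin⟩ := exists_abs_detDeriv_le (Space d) 2
  have hVn : ∀ t ∈ Ioo (-δ) δ, ∀ x, ‖fderiv ℝ (V t) x‖ ≤ B := fun t ht x =>
    norm_fderiv_le_of_lipschitz' (h.lipschitz_V t ht) x
  have hB := B.coe_nonneg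
  have hBBn : (0 : ℝ) ≤ C₁ * (3 * B) ^ 2 := by positivity
  have hBn : (0 : ℝ) ≤ C₂ * B := by positivity
  refine ⟨C₀ + C₂ * B + C₁ * (3 * B) ^ 2, by positivity, fun t ht x => ?_, fun t ht x => ?_,
    fun t ht s hs => ?_⟩
  · have := hdet _ (h.norm_fderiv_le ht x)
    linarith
  · have := (hlin _ (fderiv ℝ (V t) x) (h.norm_fderiv_le ht x)).trans
      (mul_le_mul_of_nonneg_left (hVn t ht x) hC₂)
    linarith
  · filter_upwards [ae_restrict_mem hΩ.measurableSet,
      ae_restrict_of_ae (h.lipschitz ht).ae_differentiableAt,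
      ae_restrict_of_ae (h.lipschitz hs).ae_differentiableAt,
      ae_restrict_of_ae (h.lipschitz_V s hs).ae_differentiableAt] with x hx h1 h2 h3
    have hD : ‖fderiv ℝ (Θ t) x - fderiv ℝ (Θ s) x - (t - s) • fderiv ℝ (V s) x‖
        ≤ B * |t - s| ^ 2 := by
      have e := ((h1.hasFDerivAt.sub h2.hasFDerivAt).sub (h3.hasFDerivAt.const_smul (t - s)))
      have := e.le_of_lipschitzOn (hΩ.mem_nhds hx) (h.lipschitz_sub_sub t ht s hs)
      simpa using this
    have hts : |t - s| ≤ 2 := by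
      have := h.le_one
      rw [abs_le]
      constructor <;> linarith [ht.1, ht.2, hs.1, hs.2]
    have hD2 : ‖fderiv ℝ (Θ t) x - fderiv ℝ (Θ s) x‖ ≤ 3 * B * |t - s| := by
      have e : fderiv ℝ (Θ t) x - fderiv ℝ (Θ s) x
          = (fderiv ℝ (Θ t) x - fderiv ℝ (Θ s) x - (t - s) • fderiv ℝ (V s) x)
            + (t - s) • fderiv ℝ (V s) x := by abel
      rw [e]
      refine (norm_add_le _ _).trans ?_
      rw [norm_smul, Real.norm_eq_abs]
      have a1 : |t - s| * ‖fderiv ℝ (V s) x‖ ≤ |t - s| * B := by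
        gcongr; exact hVn s hs x
      have a2 : B * |t - s| ^ 2 ≤ B * (2 * |t - s|) := by
        rw [sq]; gcongr
      linarith
    have q1 := hquad _ _ (h.norm_fderiv_le hs x) (h.norm_fderiv_le ht x)
    have q2 := hlin (fderiv ℝ (Θ s) x) _ (h.norm_fderiv_le hs x) |>.trans
      (mul_le_mul_of_nonneg_left hD hC₂)
    rw [detDeriv_sub, detDeriv_smul] at q2
    have q3 : C₁ * ‖fderiv ℝ (Θ t) x - fderiv ℝ (Θ s) x‖ ^ 2 ≤ C₁ * (3 * B * |t - s|) ^ 2 := by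
      gcongr
    have e : (fderiv ℝ (Θ t) x).det - (fderiv ℝ (Θ s) x).det
        - (t - s) * detDeriv (fderiv ℝ (Θ s) x) (fderiv ℝ (V s) x)
        = ((fderiv ℝ (Θ t) x).det - (fderiv ℝ (Θ s) x).det
          - detDeriv (fderiv ℝ (Θ s) x) (fderiv ℝ (Θ t) x - fderiv ℝ (Θ s) x))
        + (detDeriv (fderiv ℝ (Θ s) x) (fderiv ℝ (Θ t) x - fderiv ℝ (Θ s) x)
          - (t - s) * detDeriv (fderiv ℝ (Θ s) x) (fderiv ℝ (V s) x)) := by ring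
    rw [e]
    refine (abs_add_le _ _).trans ?_
    have q4 : 0 ≤ C₀ * |t - s| ^ 2 := by positivity
    calc _ ≤ C₁ * (3 * B * |t - s|) ^ 2 + C₂ * (B * |t - s| ^ 2) :=
          add_le_add (q1.trans q3) q2
      _ ≤ _ := by linarith

theorem mem_spaceTime (h : IsFamilyExtension Ω T δ B Θ V E) (hδ : δ ≤ ε) (ht : t ∈ Ioo (-δ) δ)
    (hx : x ∈ Ω) : (Θ t x, t) ∈ spaceTime Ω ε T :=
  ⟨⟨by linarith [ht.1], by linarith [ht.2]⟩, x, hx, (h.eqOn t ht hx).symm⟩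

theorem mapsTo_closure (h : IsFamilyExtension Ω T δ B Θ V E) (hδ : δ ≤ ε)
    (ht : t ∈ Ioo (-δ) δ) :
    MapsTo (fun x => (Θ t x, t)) (closure Ω) (closure (spaceTime Ω ε T)) := fun _ hx =>
  map_mem_closure (f := fun x => (Θ t x, t)) ((h.continuous ht).prodMk continuous_const) hx
    fun _ hy => h.mem_spaceTime hδ ht hy

end IsFamilyExtension

/-! ### The density along the deformation -/

/-- `c` is continuous on the closure of the space-time domain `Q`, and its derivative on `Q` is
given by the globally Lipschitz function `G`. -/
structure IsDensityExtension {d : ℕ} (Q : Set (Space d × ℝ)) (c : Space d × ℝ → ℝ)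
    (G : Space d × ℝ → Space d × ℝ →L[ℝ] ℝ) (L : ℝ≥0) : Prop where
  continuousOn : ContinuousOn c (closure Q)
  hasFDerivAt : ∀ z ∈ Q, HasFDerivAt c (G z) z
  lipschitz : LipschitzWith L G
  extendFrom_eq : ∀ z ∈ closure Q, extendFrom Q (fderiv ℝ c) z = G z

theorem IsC11.exists_extension {d : ℕ} {Q : Set (Space d × ℝ)} {c : Space d × ℝ → ℝ}
    (hc : IsC11 Q c) : ∃ G L, IsDensityExtension Q c G L := by
  obtain ⟨hcont, hdiff, K, hK⟩ := hc
  obtain ⟨G, hG, hGe⟩ := hK.extend_finite_dimension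
  refine ⟨G, _, hcont, fun z hz => ?_, hG, fun z hz => ?_⟩
  · rw [← hGe hz]
    exact (hdiff z hz).hasFDerivAt
  · exact extendFrom_eq hz (((hG.continuous.tendsto z).mono_left nhdsWithin_le_nhds).congr'
      (eventually_mem_nhdsWithin.mono fun y hy => (hGe hy).symm))

namespace IsDensityExtension

variable {d : ℕ} {Ω : Set (Space d)} {ε δ : ℝ} {T Θ V E : ℝ → Space d → Space d} {B L : ℝ≥0}
  {c : Space d × ℝ → ℝ} {G : Space d × ℝ → Space d × ℝ →L[ℝ] ℝ} {t s : ℝ} {x : Space d}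

theorem continuousOn_comp (hc : IsDensityExtension (spaceTime Ω ε T) c G L)
    (h : IsFamilyExtension Ω T δ B Θ V E) (hδ : δ ≤ ε) (ht : t ∈ Ioo (-δ) δ) :
    ContinuousOn (fun x => c (Θ t x, t)) (closure Ω) :=
  hc.continuousOn.comp ((h.continuous ht).prodMk continuous_const).continuousOn
    (h.mapsTo_closure hδ ht)

theorem exists_norm_le (hc : IsDensityExtension (spaceTime Ω ε T) c G L)
    (h : IsFamilyExtension Ω T δ B Θ V E) (hΩ : Bornology.IsBounded Ω) :
    ∃ C : ℝ, 0 ≤ C ∧ ∀ t ∈ Ioo (-δ) δ, ∀ x ∈ closure Ω, ‖G (Θ t x, t)‖ ≤ C := by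
  obtain ⟨D, hD⟩ := hΩ.closure.exists_norm_le
  refine ⟨‖G 0‖ + L * (max 0 D + B + 1), by positivity, fun t ht x hx => ?_⟩
  have h1 := hc.lipschitz.norm_sub_le (Θ t x, t) 0
  rw [sub_zero] at h1
  have htd : |t| ≤ 1 := (abs_lt.2 ht).le.trans h.le_one
  have h2 : ‖(Θ t x, t)‖ ≤ max 0 D + B + 1 := by
    have h3 := h.norm_sub_le ht h.zero_mem hx
    rw [h.zero, sub_zero] at h3
    have h4 := norm_sub_norm_le (Θ t x) x
    have h5 := hD x hx
    have h6 := le_max_right 0 D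
    have h7 := le_max_left 0 D
    have h8 : B * |t| ≤ B := mul_le_of_le_one_right B.coe_nonneg htd
    rw [Prod.norm_def]
    refine max_le ?_ ?_
    · simp only; linarith
    · rw [Real.norm_eq_abs]; simp only
      have := B.coe_nonneg
      linarith
  have h3 := norm_sub_norm_le (G (Θ t x, t)) (G 0)
  have h4 : L * ‖(Θ t x, t)‖ ≤ L * (max 0 D + B + 1) := by gcongr
  linarith

theorem hasDerivAt_comp (hc : IsDensityExtension (spaceTime Ω ε T) c G L)
    (h : IsFamilyExtension Ω T δ B Θ V E) (hδ : δ ≤ ε) (ht : t ∈ Ioo (-δ) δ) (hx : x ∈ Ω) :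
    HasDerivAt (fun t => c (Θ t x, t)) (G (Θ t x, t) (V t x, 1)) t :=
  HasFDerivAt.comp_hasDerivAt (f := fun t => (Θ t x, t)) t (hc.hasFDerivAt _ (h.mem_spaceTime hδ ht hx))
    ((h.hasDerivAt ht (subset_closure hx)).prodMk (hasDerivAt_id t))

/-- Along trajectories, `c` is differentiable in `t` uniformly on the closure of `Ω`. -/
theorem exists_bounds (hc : IsDensityExtension (spaceTime Ω ε T) c G L)
    (h : IsFamilyExtension Ω T δ B Θ V E) (hδ : δ ≤ ε) (hΩ : Bornology.IsBounded Ω) :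
    ∃ C : ℝ, 0 ≤ C ∧ (∀ t ∈ Ioo (-δ) δ, ∀ x ∈ closure Ω, |c (Θ t x, t)| ≤ C) ∧
      (∀ t ∈ Ioo (-δ) δ, ∀ x ∈ closure Ω, ‖G (Θ t x, t)‖ ≤ C) ∧
      (∀ t ∈ Ioo (-δ) δ, ∀ x ∈ closure Ω, |G (Θ t x, t) (V t x, 1)| ≤ C) ∧
      ∀ t ∈ Ioo (-δ) δ, ∀ s ∈ Ioo (-δ) δ, ∀ x ∈ closure Ω,
        |c (Θ t x, t) - c (Θ s x, s) - (t - s) * G (Θ s x, s) (V s x, 1)| ≤ C * |t - s| ^ 2 := by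
  obtain ⟨g, hg, hG⟩ := hc.exists_norm_le h hΩ
  obtain ⟨m, hm⟩ := (Metric.isCompact_of_isClosed_isBounded isClosed_closure
    hΩ.closure).exists_bound_of_continuousOn (hc.continuousOn_comp h hδ h.zero_mem)
  have hB := B.coe_nonneg
  have hv : ∀ t ∈ Ioo (-δ) δ, ∀ x ∈ closure Ω, ‖(V t x, (1 : ℝ))‖ ≤ B + 1 := by
    intro t ht x hx
    rw [Prod.norm_def]
    have := h.norm_V_le t ht x hx
    refine max_le ?_ ?_ <;> simp only [norm_one] <;> linarith
  have hGv : ∀ t ∈ Ioo (-δ) δ, ∀ x ∈ closure Ω, ‖G (Θ t x, t) (V t x, 1)‖ ≤ g * (B + 1) := by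
    intro t ht x hx
    exact ((G _).le_opNorm _).trans (mul_le_mul (hG t ht x hx) (hv t ht x hx) (norm_nonneg _) hg)
  have hcl : ∀ {p : Space d → ℝ} {a : ℝ}, ContinuousOn p (closure Ω) → (∀ x ∈ Ω, |p x| ≤ a) →
      ∀ x ∈ closure Ω, |p x| ≤ a := fun {p a} hp hb x hx => by
    exact le_on_closure hb hp.abs continuousOn_const hx
  have hcc := fun t (ht : t ∈ Ioo (-δ) δ) => hc.continuousOn_comp h hδ ht
  have hGc : ∀ s ∈ Ioo (-δ) δ, Continuous fun x => G (Θ s x, s) (V s x, 1) := fun s hs =>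
    (hc.lipschitz.continuous.comp ((h.continuous hs).prodMk continuous_const)).clm_apply
      ((h.lipschitz_V s hs).continuous.prodMk continuous_const)
  set C₁ := g * (B + 1)
  set C₂ := L * (B + 1) * (B + 1) + g * B
  have hC₁ : 0 ≤ C₁ := by positivity
  have hC₂ : 0 ≤ C₂ := by positivity
  have hlip : ∀ x ∈ Ω, ∀ t ∈ Ioo (-δ) δ, ∀ s ∈ Ioo (-δ) δ,
      ‖G (Θ t x, t) (V t x, 1) - G (Θ s x, s) (V s x, 1)‖ ≤ C₂ * |t - s| := by
    intro x hx t ht s hs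
    have hx' := subset_closure hx
    have e : G (Θ t x, t) (V t x, 1) - G (Θ s x, s) (V s x, 1)
        = (G (Θ t x, t) - G (Θ s x, s)) (V t x, 1) + G (Θ s x, s) (V t x - V s x, 0) := by
      have : (V t x - V s x, (0 : ℝ)) = (V t x, 1) - (V s x, 1) := by simp
      rw [this, map_sub, sub_apply]; ring
    have h1 : ‖G (Θ t x, t) - G (Θ s x, s)‖ ≤ L * ((B + 1) * |t - s|) := by
      refine (hc.lipschitz.norm_sub_le _ _).trans ?_
      gcongr
      rw [Prod.mk_sub_mk, Prod.norm_def]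
      have := h.norm_sub_le ht hs hx'
      have h0 := abs_nonneg (t - s)
      refine max_le ?_ ?_
      · simp only; nlinarith
      · simp only [Real.norm_eq_abs]; nlinarith
    have h2 : ‖(V t x - V s x, (0 : ℝ))‖ ≤ B * |t - s| := by
      rw [Prod.norm_def]
      simpa using h.norm_V_sub_le t ht s hs x hx'
    rw [e]
    calc _ ≤ ‖G (Θ t x, t) - G (Θ s x, s)‖ * ‖(V t x, (1 : ℝ))‖
          + ‖G (Θ s x, s)‖ * ‖(V t x - V s x, (0 : ℝ))‖ :=
          (norm_add_le _ _).trans (add_le_add (ContinuousLinearMap.le_opNorm _ _)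
            (ContinuousLinearMap.le_opNorm _ _))
      _ ≤ L * ((B + 1) * |t - s|) * (B + 1) + g * (B * |t - s|) := by
          gcongr
          · exact hv t ht x hx'
          · exact hG s hs x hx'
      _ = C₂ * |t - s| := by simp only [C₂]; ring
  refine ⟨max 0 m + C₁ + g + C₂, by positivity, fun t ht => hcl (hcc t ht) fun x hx => ?_,
    fun t ht x hx => ?_, fun t ht x hx => ?_, fun t ht s hs => hcl ?_ fun x hx => ?_⟩
  · have h1 := norm_sub_le_of_bounded_deriv (f := fun t => c (Θ t x, t)) (convex_Ioo (-δ) δ)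
      (fun r hr => hc.hasDerivAt_comp h hδ hr hx) (fun r hr => hGv r hr x (subset_closure hx))
      h.zero_mem ht
    have h2 := hm x (subset_closure hx)
    rw [Real.norm_eq_abs] at h1 h2
    have h3 := abs_sub_abs_le_abs_sub (c (Θ t x, t)) (c (Θ 0 x, 0))
    have h4 : C₁ * |t - 0| ≤ C₁ := by
      rw [sub_zero]
      exact mul_le_of_le_one_right hC₁ ((abs_lt.2 ht).le.trans h.le_one)
    have h5 := le_max_right 0 m
    have h1' : |c (Θ t x, t) - c (Θ 0 x, 0)| ≤ C₁ * |t - 0| := h1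
    linarith
  · have h5 := le_max_left 0 m
    have := hG t ht x hx
    linarith
  · have h5 := le_max_left 0 m
    have := hGv t ht x hx
    rw [Real.norm_eq_abs] at this
    linarith
  · exact ((hcc t ht).sub (hcc s hs)).sub (continuousOn_const.mul (hGc s hs).continuousOn)
  · have h1 := norm_sub_sub_le_of_lipschitz_deriv (f := fun t => c (Θ t x, t))
      (f' := fun t => G (Θ t x, t) (V t x, 1)) (convex_Ioo (-δ) δ)
      (fun r hr => hc.hasDerivAt_comp h hδ hr hx) (hlip x hx) hs ht
    rw [Real.norm_eq_abs, smul_eq_mul] at h1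
    refine h1.trans ?_
    have h5 := le_max_left 0 m
    gcongr
    linarith

/-- The bound for the gradient of `c` gives local Lipschitz bounds in `Ω`. They hold up to the
boundary because `Ω` is a Lipschitz domain. -/
theorem exists_lipschitzOnWith (hc : IsDensityExtension (spaceTime Ω ε T) c G L)
    (h : IsFamilyExtension Ω T δ B Θ V E) (hδ : δ ≤ ε) (hd : 2 ≤ d)
    (hΩ : IsBoundedLipschitzDomain Ω) (ht : t ∈ Ioo (-δ) δ) :
    ∃ K, LipschitzOnWith K (fun x => c (Θ t x, t)) (closure Ω) := by
  obtain ⟨g, hg, hG⟩ := hc.exists_norm_le h hΩ.isBounded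
  refine exists_lipschitzOnWith_closure hd hΩ (hc.continuousOn_comp h hδ ht)
    (L := (g + 1).toNNReal * 2) fun x hx => ?_
  have h1 := (hc.hasFDerivAt _ (h.mem_spaceTime hδ ht hx)).isLittleO.def one_pos
  have htend : Tendsto (fun y => (Θ t y, t)) (𝓝 x) (𝓝 (Θ t x, t)) :=
    ((h.continuous ht).prodMk continuous_const).tendsto x
  filter_upwards [htend.eventually h1] with y hy
  have h2 : ‖(Θ t y, t) - (Θ t x, t)‖ ≤ 2 * ‖y - x‖ := by
    rw [Prod.mk_sub_mk, Prod.norm_def]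
    have h3 := (h.lipschitz ht).norm_sub_le y x
    have h4 : ((1 + 1 / 2 : ℝ≥0) : ℝ) ≤ 2 := by norm_num
    have h5 := norm_nonneg (y - x)
    refine max_le ?_ (by simp)
    exact h3.trans (by gcongr)
  have h3 := (G (Θ t x, t)).le_opNorm ((Θ t y, t) - (Θ t x, t))
  have h4 := hG t ht x (subset_closure hx)
  have h5 := norm_sub_norm_le (c (Θ t y, t) - c (Θ t x, t))
    (G (Θ t x, t) ((Θ t y, t) - (Θ t x, t)))
  rw [NNReal.coe_mul, Real.coe_toNNReal _ (by positivity)]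
  push_cast
  have h6 : ‖G (Θ t x, t)‖ * ‖(Θ t y, t) - (Θ t x, t)‖ ≤ g * ‖(Θ t y, t) - (Θ t x, t)‖ := by
    gcongr
  calc _ ≤ (g + 1) * ‖(Θ t y, t) - (Θ t x, t)‖ := by linarith
    _ ≤ (g + 1) * (2 * ‖y - x‖) := by gcongr
    _ = _ := by ring

end IsDensityExtension

/-! ### The first derivative of the integral -/

section

open InnerProductSpace (rankOne)

theorem exists_lipschitzOnWith_smul {X F : Type*} [PseudoMetricSpace X] [NormedAddCommGroup F]
    [NormedSpace ℝ F] {f : X → ℝ} {g : X → F} {s : Set X} {K L : ℝ≥0} {a b : ℝ}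
    (hf : LipschitzOnWith K f s) (hg : LipschitzOnWith L g s) (ha : ∀ x ∈ s, |f x| ≤ a)
    (hb : ∀ x ∈ s, ‖g x‖ ≤ b) : ∃ M, LipschitzOnWith M (fun x => f x • g x) s := by
  refine ⟨(|a| * L + K * |b|).toNNReal, LipschitzOnWith.of_dist_le_mul fun x hx y hy => ?_⟩
  rw [Real.coe_toNNReal _ (by positivity), dist_eq_norm]
  have e : f x • g x - f y • g y = f x • (g x - g y) + (f x - f y) • g y := by module
  have h1 := hf.dist_le_mul x hx y hy
  have h2 := hg.dist_le_mul x hx y hy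
  rw [dist_eq_norm] at h1 h2
  rw [e]
  refine (norm_add_le _ _).trans ?_
  rw [norm_smul, norm_smul, Real.norm_eq_abs (f x)]
  calc _ ≤ |a| * (L * dist x y) + K * dist x y * |b| :=
        add_le_add
          (mul_le_mul ((ha x hx).trans (le_abs_self a)) h2 (norm_nonneg _) (abs_nonneg _))
          (mul_le_mul h1 ((hb y hy).trans (le_abs_self b)) (norm_nonneg _) (by positivity))
    _ = _ := by ring

theorem IsBoundedLipschitzDomain.isFiniteMeasure_restrict {d : ℕ} {Ω : Set (Space d)}
    (hΩ : IsBoundedLipschitzDomain Ω) : IsFiniteMeasure (volume.restrict Ω) :=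
  ⟨by simpa using hΩ.isBounded.measure_lt_top⟩

namespace IsDensityExtension

variable {d : ℕ} {Ω : Set (Space d)} {ε δ : ℝ} {T Θ V E : ℝ → Space d → Space d} {B L : ℝ≥0}
  {c : Space d × ℝ → ℝ} {G : Space d × ℝ → Space d × ℝ →L[ℝ] ℝ} {t s : ℝ} {x : Space d}

theorem aestronglyMeasurable_comp (hc : IsDensityExtension (spaceTime Ω ε T) c G L)
    (h : IsFamilyExtension Ω T δ B Θ V E) (hδ : δ ≤ ε) (hΩ : IsOpen Ω) (ht : t ∈ Ioo (-δ) δ) :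
    AEStronglyMeasurable (fun x => c (Θ t x, t)) (volume.restrict Ω) :=
  ((hc.continuousOn_comp h hδ ht).mono subset_closure).aestronglyMeasurable hΩ.measurableSet

theorem integrable_mul_det (hc : IsDensityExtension (spaceTime Ω ε T) c G L)
    (h : IsFamilyExtension Ω T δ B Θ V E) (hδ : δ ≤ ε) (hΩ : IsBoundedLipschitzDomain Ω)
    (ht : t ∈ Ioo (-δ) δ) :
    IntegrableOn (fun x => c (Θ t x, t) * (fderiv ℝ (Θ t) x).det) Ω := by
  have := hΩ.isFiniteMeasure_restrict
  obtain ⟨C₁, hC₁, hJ, -⟩ := h.exists_det_bounds hΩ.isOpen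
  obtain ⟨C₂, hC₂, hb, -⟩ := hc.exists_bounds h hδ hΩ.isBounded
  refine Integrable.of_bound ((hc.aestronglyMeasurable_comp h hδ hΩ.isOpen ht).mul
    (continuous_det.comp_aestronglyMeasurable (aestronglyMeasurable_fderiv _ _))) (C₂ * C₁) ?_
  filter_upwards [ae_restrict_mem hΩ.isOpen.measurableSet] with x hx
  rw [norm_mul]
  exact mul_le_mul (hb t ht x (subset_closure hx)) (hJ t ht x) (norm_nonneg _) hC₂

theorem integrableOn_image (hc : IsDensityExtension (spaceTime Ω ε T) c G L)
    (h : IsFamilyExtension Ω T δ B Θ V E) (hδ : δ ≤ ε) (hΩ : IsBoundedLipschitzDomain Ω)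
    (ht : t ∈ Ioo (-δ) δ) : IntegrableOn (fun x => c (x, t)) (T t '' Ω) := by
  rw [h.image_eq ht, integrableOn_image_iff_of_lipschitz (h.lipschitz ht)
    hΩ.isOpen.measurableSet (h.injective ht).injOn]
  refine (hc.integrable_mul_det h hδ hΩ ht).congr ?_
  filter_upwards [ae_restrict_of_ae (h.ae_det_pos ht)] with x hx
  rw [abs_of_pos hx, mul_comm]

/-- The integral over the deformed domain, pulled back to `Ω`. -/
theorem volumeIntegral_eq (h : IsFamilyExtension Ω T δ B Θ V E)
    (hΩ : IsBoundedLipschitzDomain Ω) (c : Space d × ℝ → ℝ) (ht : t ∈ Ioo (-δ) δ) :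
    volumeIntegral Ω T c t = ∫ x in Ω, c (Θ t x, t) * (fderiv ℝ (Θ t) x).det := by
  rw [volumeIntegral, h.image_eq ht, setIntegral_image_of_lipschitz (h.lipschitz ht)
    hΩ.isOpen.measurableSet (h.injective ht).injOn]
  refine integral_congr_ae ?_
  filter_upwards [ae_restrict_of_ae (h.ae_det_pos ht)] with x hx
  rw [abs_of_pos hx, mul_comm]

theorem continuous_apply (hc : IsDensityExtension (spaceTime Ω ε T) c G L)
    (h : IsFamilyExtension Ω T δ B Θ V E) (ht : t ∈ Ioo (-δ) δ) {v : Space d → Space d × ℝ}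
    (hv : Continuous v) : Continuous fun x => G (Θ t x, t) (v x) :=
  (hc.lipschitz.continuous.comp ((h.continuous ht).prodMk continuous_const)).clm_apply hv

/-- The first derivative, before integration by parts: the product rule for the density and the
volume element under the integral. -/
theorem hasDerivAt_volumeIntegral (hc : IsDensityExtension (spaceTime Ω ε T) c G L)
    (h : IsFamilyExtension Ω T δ B Θ V E) (hδ : δ ≤ ε) (hΩ : IsBoundedLipschitzDomain Ω)
    (hs : s ∈ Ioo (-δ) δ) :
    HasDerivAt (volumeIntegral Ω T c)
      (∫ x in Ω, (G (Θ s x, s) (V s x, 1) * (fderiv ℝ (Θ s) x).det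
        + c (Θ s x, s) * detDeriv (fderiv ℝ (Θ s) x) (fderiv ℝ (V s) x))) s := by
  have := hΩ.isFiniteMeasure_restrict
  obtain ⟨C₁, hC₁, hJ, hJ', hJq⟩ := h.exists_det_bounds hΩ.isOpen
  obtain ⟨C₂, hC₂, hb, -, hb', hbq⟩ := hc.exists_bounds h hδ hΩ.isBounded
  have hJm : AEStronglyMeasurable (fun x => (fderiv ℝ (Θ s) x).det) (volume.restrict Ω) :=
    continuous_det.comp_aestronglyMeasurable (aestronglyMeasurable_fderiv _ _)
  have hJm' : AEStronglyMeasurable (fun x => detDeriv (fderiv ℝ (Θ s) x) (fderiv ℝ (V s) x))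
      (volume.restrict Ω) :=
    continuous_detDeriv.comp_aestronglyMeasurable
      ((aestronglyMeasurable_fderiv _ _).prodMk (aestronglyMeasurable_fderiv _ _))
  have hGm : AEStronglyMeasurable (fun x => G (Θ s x, s) (V s x, 1)) (volume.restrict Ω) :=
    (hc.continuous_apply h hs
      ((h.lipschitz_V s hs).continuous.prodMk continuous_const)).aestronglyMeasurable
  have hcm := hc.aestronglyMeasurable_comp h hδ hΩ.isOpen hs
  refine (hasDerivAt_integral_of_quadratic
    (f := fun t x => c (Θ t x, t) * (fderiv ℝ (Θ t) x).det)
    (C := (C₁ + C₂) * (C₁ + C₂) + C₂ * ((C₁ + C₂) + (C₁ + C₂) + C₁) + ((C₁ + C₂) + (C₁ + C₂)) * C₁)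
    ?_ ?_ ?_).congr_of_eventuallyEq ?_
  · filter_upwards [h.mem_nhds hs] with t ht using hc.integrable_mul_det h hδ hΩ ht
  · refine Integrable.of_bound ((hGm.mul hJm).add (hcm.mul hJm')) (C₂ * C₁ + C₂ * C₁) ?_
    filter_upwards [ae_restrict_mem hΩ.isOpen.measurableSet] with x hx
    have hx' := subset_closure hx
    refine (norm_add_le _ _).trans ?_
    rw [norm_mul, norm_mul]
    exact add_le_add (mul_le_mul (hb' s hs x hx') (hJ s hs x) (norm_nonneg _) hC₂)
      (mul_le_mul (hb s hs x hx') (hJ' s hs x) (norm_nonneg _) hC₂)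
  · have hsmall : ∀ᶠ t in 𝓝 s, |t - s| ≤ 1 := by
      have : Continuous fun t : ℝ => |t - s| := by fun_prop
      exact (this.tendsto s).eventually (eventually_le_nhds (by simp))
    filter_upwards [h.mem_nhds hs, hsmall] with t ht hts
    filter_upwards [ae_restrict_mem hΩ.isOpen.measurableSet, hJq t ht s hs] with x hx hq
    have hx' := subset_closure hx
    exact abs_mul_sub_mul_sub_le hts (hbq t ht s hs x hx') hq
      ((hb s hs x hx').trans (by linarith)) ((hb' s hs x hx').trans (by linarith))
      ((hJ s hs x).trans (by linarith)) ((hJ' s hs x).trans (by linarith)) hC₂ hC₁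
  · filter_upwards [h.mem_nhds hs] with t ht using volumeIntegral_eq h hΩ c ht

/-- The chain rule turns the derivative of the pulled back integrand into `c_t` and a null
Lagrangian, whose integral is a surface integral. -/
theorem setIntegral_deriv_eq (hc : IsDensityExtension (spaceTime Ω ε T) c G L)
    (h : IsFamilyExtension Ω T δ B Θ V E) (hδ : δ ≤ ε) (hd : 2 ≤ d)
    (hΩ : IsBoundedLipschitzDomain Ω) (hs : s ∈ Ioo (-δ) δ)
    {A : Space d → Space d →L[ℝ] Space d} (hAm : AEStronglyMeasurable A (surfaceMeasure Ω))
    {R : ℝ} (hAb : ∀ᵐ x ∂(surfaceMeasure Ω), ‖A x‖ ≤ R)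
    (hA : ∀ᵐ x ∂(surfaceMeasure Ω), HasFDerivWithinAt (Θ s) (A x) (frontier Ω) x) :
    ∫ x in Ω, (G (Θ s x, s) (V s x, 1) * (fderiv ℝ (Θ s) x).det
        + c (Θ s x, s) * detDeriv (fderiv ℝ (Θ s) x) (fderiv ℝ (V s) x))
      = (∫ x in Ω, G (Θ s x, s) (0, 1) * (fderiv ℝ (Θ s) x).det)
        + ∫ x, detDeriv (A x) (rankOne ℝ (c (Θ s x, s) • V s x) (outerNormal Ω x))
            ∂(surfaceMeasure Ω) := by
  have := hΩ.isFiniteMeasure_restrict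
  obtain ⟨C₁, hC₁, hJ, -⟩ := h.exists_det_bounds hΩ.isOpen
  obtain ⟨C₂, hC₂, hb, hGb, -⟩ := hc.exists_bounds h hδ hΩ.isBounded
  obtain ⟨K, hK⟩ := hc.exists_lipschitzOnWith h hδ hd hΩ hs
  obtain ⟨M, hM⟩ := exists_lipschitzOnWith_smul hK ((h.lipschitz_V s hs).lipschitzOnWith)
    (hb s hs) (h.norm_V_le s hs)
  obtain ⟨W, hW, hWe⟩ := hM.extend_finite_dimension
  have hdiv := setIntegral_detDeriv_eq_surface hd hΩ (h.lipschitz hs) hW hAm hAb hA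
  have hsurf : ∫ x, detDeriv (A x) (rankOne ℝ (W x) (outerNormal Ω x)) ∂(surfaceMeasure Ω)
      = ∫ x, detDeriv (A x) (rankOne ℝ (c (Θ s x, s) • V s x) (outerNormal Ω x))
        ∂(surfaceMeasure Ω) := by
    refine integral_congr_ae ?_
    filter_upwards [surfaceMeasure_frontier_compl Ω] with x hx
    have : c (Θ s x, s) • V s x = W x := hWe (frontier_subset_closure hx)
    rw [this]
  rw [← hsurf, ← hdiv, ← integral_add]
  · refine integral_congr_ae ?_
    filter_upwards [ae_restrict_mem hΩ.isOpen.measurableSet,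
      ae_restrict_of_ae (h.lipschitz hs).ae_differentiableAt,
      ae_restrict_of_ae (h.lipschitz_V s hs).ae_differentiableAt] with x hx h1 h2
    have hz := hc.hasFDerivAt _ (h.mem_spaceTime hδ hs hx)
    have hcd : HasFDerivAt (fun y => c (Θ s y, s))
        ((G (Θ s x, s) ∘L ContinuousLinearMap.inl ℝ (Space d) ℝ) ∘L fderiv ℝ (Θ s) x) x := by
      refine (HasFDerivAt.comp (f := fun y => (Θ s y, s)) x hz
        (h1.hasFDerivAt.prodMk (hasFDerivAt_const s x))).congr_fderiv ?_
      ext v; simp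
    have hWd : fderiv ℝ W x = c (Θ s x, s) • fderiv ℝ (V s) x
        + ((G (Θ s x, s) ∘L ContinuousLinearMap.inl ℝ (Space d) ℝ)
          ∘L fderiv ℝ (Θ s) x).smulRight (V s x) := by
      refine HasFDerivAt.fderiv ((hcd.smul h2.hasFDerivAt).congr_of_eventuallyEq ?_)
      filter_upwards [hΩ.isOpen.mem_nhds hx] with y hy using (hWe (subset_closure hy)).symm
    have hsplit : (V s x, (1 : ℝ)) = (0, 1) + (V s x, 0) := by simp
    rw [hWd, detDeriv_add, detDeriv_smul, detDeriv_smulRight_comp, hsplit, map_add]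
    simp only [ContinuousLinearMap.comp_apply, ContinuousLinearMap.inl_apply]
    ring
  · refine Integrable.of_bound ((hc.continuous_apply h hs
      continuous_const).aestronglyMeasurable.mul (continuous_det.comp_aestronglyMeasurable
        (aestronglyMeasurable_fderiv _ _))) (C₂ * C₁) ?_
    filter_upwards [ae_restrict_mem hΩ.isOpen.measurableSet] with x hx
    rw [norm_mul]
    refine mul_le_mul ?_ (hJ s hs x) (norm_nonneg _) hC₂
    refine ((G (Θ s x, s)).le_opNorm _).trans ?_
    have h1 : ‖((0 : Space d), (1 : ℝ))‖ = 1 := by simp [Prod.norm_def]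
    rw [h1, mul_one]
    exact hGb s hs x (subset_closure hx)
  · exact integrableOn_detDeriv_fderiv (h.lipschitz hs) hW hΩ.isBounded.measure_lt_top.ne

end IsDensityExtension

end

/-! ### The derivative of the interior term -/

section

open InnerProductSpace (rankOne)

variable {d : ℕ} {Ω : Set (Space d)} {ε δ : ℝ} {T Θ V E : ℝ → Space d → Space d} {B L : ℝ≥0}
  {c : Space d × ℝ → ℝ} {G : Space d × ℝ → Space d × ℝ →L[ℝ] ℝ} {t s : ℝ} {x : Space d}

/-- The space-time domain is a neighbourhood of `(x, 0)` for `x ∈ Ω`: the inverses of `Θ t` are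
Lipschitz uniformly in `t`. -/
theorem IsFamilyExtension.eventually_mem_spaceTime (h : IsFamilyExtension Ω T δ B Θ V E)
    (hδ : δ ≤ ε) (hΩ : IsOpen Ω) (hx : x ∈ Ω) : ∀ᶠ z in 𝓝 (x, (0 : ℝ)), z ∈ spaceTime Ω ε T := by
  obtain ⟨r, hr, hball⟩ := Metric.isOpen_iff.1 hΩ x hx
  have hcont : Continuous fun z : Space d × ℝ => 2 * (‖z.1 - x‖ + B * |z.2|) := by fun_prop
  have h1 : ∀ᶠ z in 𝓝 (x, (0 : ℝ)), 2 * (‖z.1 - x‖ + B * |z.2|) < r :=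
    (hcont.tendsto (x, 0)).eventually (eventually_lt_nhds (by simpa using hr))
  have h2 : ∀ᶠ z in 𝓝 (x, (0 : ℝ)), z.2 ∈ Ioo (-δ) δ :=
    (continuous_snd.tendsto (x, (0 : ℝ))).eventually (h.mem_nhds h.zero_mem)
  filter_upwards [h1, h2] with z hz hzt
  have hbij := bijective_smul_add_lipschitz (h.lipschitz_half z.2 hzt) (s := 1)
    (by rw [← NNReal.coe_lt_coe]; norm_num)
  obtain ⟨y, hy⟩ := hbij.2 z.1
  have hy' : Θ z.2 y = z.1 := by rw [h.eq_add, ← hy]; simp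
  have hyx : ‖y - x‖ < r := by
    have e : y - x = (Θ z.2 y - Θ z.2 x)
        - ((z.2 • V 0 y + E z.2 y) - (z.2 • V 0 x + E z.2 x)) := by
      rw [h.eq_add z.2 y, h.eq_add z.2 x]; module
    have h3 := (h.lipschitz_half z.2 hzt).norm_sub_le y x
    have h4 : ‖Θ z.2 y - Θ z.2 x‖ ≤ ‖z.1 - x‖ + B * |z.2| := by
      have h5 := h.norm_sub_le hzt h.zero_mem (subset_closure hx)
      rw [h.zero, sub_zero] at h5
      rw [hy', show z.1 - Θ z.2 x = (z.1 - x) - (Θ z.2 x - x) by abel]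
      exact (_root_.norm_sub_le _ _).trans (add_le_add le_rfl h5)
    have h6 : ‖y - x‖ ≤ ‖Θ z.2 y - Θ z.2 x‖
        + ‖(z.2 • V 0 y + E z.2 y) - (z.2 • V 0 x + E z.2 x)‖ := by
      conv_lhs => rw [e]
      exact _root_.norm_sub_le _ _
    have h7 : ((1 / 2 : ℝ≥0) : ℝ) = 1 / 2 := by norm_num
    rw [h7] at h3
    linarith
  have hyΩ : y ∈ Ω := hball (by rwa [Metric.mem_ball, dist_eq_norm])
  have := h.mem_spaceTime hδ hzt hyΩ
  rwa [hy'] at this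

namespace IsDensityExtension

theorem deriv_eq {Q : Set (Space d × ℝ)} (hc : IsDensityExtension Q c G L) {z : Space d × ℝ}
    (hz : z ∈ Q) : deriv (fun s => c (z.1, s)) z.2 = G z (0, 1) := by
  have h1 : HasDerivAt (fun s : ℝ => (z.1, s)) ((0 : Space d), (1 : ℝ)) z.2 :=
    (hasDerivAt_const z.2 z.1).prodMk (hasDerivAt_id z.2)
  exact (HasFDerivAt.comp_hasDerivAt (f := fun s : ℝ => (z.1, s)) z.2
    (hc.hasFDerivAt z hz) h1).deriv

/-- The derivative of `c_t` along a trajectory. Only the time derivative of `c_t` is assumed to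
exist everywhere, so the mean value theorem is used in time, at the moving point. -/
theorem hasDerivAt_apply_time (hc : IsDensityExtension (spaceTime Ω ε T) c G L)
    (h : IsFamilyExtension Ω T δ B Θ V E) (hδ : δ ≤ ε) (hΩ : IsOpen Ω)
    {g : Space d × ℝ → ℝ} (hg : ContinuousOn g (closure (spaceTime Ω ε T)))
    (hgd : ∀ z ∈ spaceTime Ω ε T, HasDerivAt (deriv fun s => c (z.1, s)) (g z) z.2)
    (hx : x ∈ Ω) (hxd : DifferentiableAt ℝ (fun y => G (y, 0) (0, 1)) x) :
    HasDerivAt (fun t => G (Θ t x, t) (0, 1))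
      (g (x, 0) + fderiv ℝ (fun y => G (y, 0) (0, 1)) x (V 0 x)) 0 := by
  have hΘ0 := h.hasDerivAt h.zero_mem (subset_closure hx)
  have hspace : HasDerivAt (fun t => G (Θ t x, 0) (0, 1))
      (fderiv ℝ (fun y => G (y, 0) (0, 1)) x (V 0 x)) 0 :=
    HasFDerivAt.comp_hasDerivAt_of_eq (f := fun t => Θ t x) 0 hxd.hasFDerivAt hΘ0 (h.zero x).symm
  have htime : HasDerivAt (fun t => G (Θ t x, t) (0, 1) - G (Θ t x, 0) (0, 1)) (g (x, 0)) 0 := by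
    rw [hasDerivAt_iff_isLittleO, Asymptotics.isLittleO_iff]
    intro η hη
    have hQ := h.eventually_mem_spaceTime hδ hΩ hx
    have hxQ : (x, (0 : ℝ)) ∈ closure (spaceTime Ω ε T) := subset_closure hQ.self_of_nhds
    have hgx : ∀ᶠ z in 𝓝 (x, (0 : ℝ)), z ∈ spaceTime Ω ε T → |g z - g (x, 0)| ≤ η := by
      have h1 := (hg (x, 0) hxQ).mono (subset_closure)
      have h2 := (Metric.tendsto_nhds.1 h1 η hη)
      exact (eventually_nhdsWithin_iff.1 h2).mono fun z hz hzQ => (hz hzQ).le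
    obtain ⟨r, hr, hball⟩ := Metric.eventually_nhds_iff_ball.1 (hQ.and hgx)
    have hΘt : ∀ᶠ t in 𝓝 (0 : ℝ), Θ t x ∈ Metric.ball x r := by
      have := hΘ0.continuousAt
      rw [ContinuousAt, h.zero] at this
      exact this (Metric.ball_mem_nhds x hr)
    filter_upwards [hΘt, Metric.ball_mem_nhds (0 : ℝ) hr] with t h1 h2
    set y := Θ t x
    have hmem : ∀ τ ∈ Metric.ball (0 : ℝ) r, (y, τ) ∈ Metric.ball (x, (0 : ℝ)) r := fun τ hτ => by
      rw [← ball_prod_same]; exact ⟨h1, hτ⟩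
    have hder : ∀ τ ∈ Metric.ball (0 : ℝ) r, HasDerivWithinAt
        (fun τ => G (y, τ) (0, 1) - τ * g (x, 0)) (g (y, τ) - g (x, 0)) (Metric.ball 0 r) τ := by
      intro τ hτ
      have e1 := hgd (y, τ) (hball _ (hmem τ hτ)).1
      have e2 : (fun τ => G (y, τ) (0, 1)) =ᶠ[𝓝 τ] deriv fun s => c (y, s) := by
        filter_upwards [Metric.isOpen_ball.mem_nhds hτ] with σ hσ
        exact (hc.deriv_eq (hball _ (hmem σ hσ)).1).symm
      have e3 := (e1.congr_of_eventuallyEq e2).sub ((hasDerivAt_id τ).mul_const (g (x, 0)))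
      rw [one_mul] at e3
      exact e3.hasDerivWithinAt
    have key := (convex_ball (0 : ℝ) r).norm_image_sub_le_of_norm_hasDerivWithin_le hder
      (C := η) (fun τ hτ => (hball _ (hmem τ hτ)).2 (hball _ (hmem τ hτ)).1)
      (Metric.mem_ball_self hr) h2
    rw [h.zero, sub_self, sub_zero, sub_zero, smul_eq_mul]
    rw [zero_mul, sub_zero, sub_zero] at key
    refine le_of_eq_of_le ?_ key
    congr 1; ring
  have := htime.add hspace
  refine this.congr_of_eventuallyEq (Eventually.of_forall fun t => ?_)
  simp

theorem timeDerivTwo_eq (h : IsFamilyExtension Ω T δ B Θ V E) (hδ : δ ≤ ε)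
    {g : Space d × ℝ → ℝ}
    (hgd : ∀ z ∈ spaceTime Ω ε T, HasDerivAt (deriv fun s => c (z.1, s)) (g z) z.2)
    (hx : x ∈ Ω) : timeDerivTwo c x = g (x, 0) := by
  have hz := h.mem_spaceTime hδ h.zero_mem hx
  rw [h.zero] at hz
  rw [timeDerivTwo, iteratedDeriv_succ, iteratedDeriv_one]
  exact (hgd _ hz).deriv

theorem integrableOn_timeDerivTwo (h : IsFamilyExtension Ω T δ B Θ V E) (hδ : δ ≤ ε)
    (hΩ : IsBoundedLipschitzDomain Ω)
    (hctt : HasContinuousTimeDerivTwo (spaceTime Ω ε T) c) :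
    IntegrableOn (timeDerivTwo c) Ω := by
  obtain ⟨g, hg, hgd⟩ := hctt
  have hcont : ContinuousOn (fun x => g (x, 0)) (closure Ω) := by
    refine hg.comp (by fun_prop) fun x hx => ?_
    have := h.mapsTo_closure hδ h.zero_mem hx
    simpa only [h.zero] using this
  refine (((hcont.integrableOn_compact hΩ.isCompact_closure).mono_set subset_closure).congr_fun
    (fun x hx => ?_) hΩ.isOpen.measurableSet)
  exact (timeDerivTwo_eq h hδ hgd hx).symm

theorem abs_apply_time_le (z : Space d × ℝ) {C : ℝ} (hz : ‖G z‖ ≤ C) : |G z (0, 1)| ≤ C := by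
  refine ((G z).le_opNorm _).trans ?_
  have h1 : ‖((0 : Space d), (1 : ℝ))‖ = 1 := by simp [Prod.norm_def]
  rwa [h1, mul_one]

theorem norm_comp_sub_le (hc : IsDensityExtension (spaceTime Ω ε T) c G L)
    (h : IsFamilyExtension Ω T δ B Θ V E) (ht : t ∈ Ioo (-δ) δ) (hs : s ∈ Ioo (-δ) δ)
    (hx : x ∈ closure Ω) :
    ‖G (Θ t x, t) - G (Θ s x, s)‖ ≤ L * (B + 1) * |t - s| := by
  refine (hc.lipschitz.norm_sub_le _ _).trans ?_
  rw [mul_assoc]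
  gcongr
  rw [Prod.mk_sub_mk, Prod.norm_def]
  have := h.norm_sub_le ht hs hx
  have h0 := abs_nonneg (t - s)
  have := B.coe_nonneg
  refine max_le ?_ ?_
  · simp only; nlinarith
  · simp only [Real.norm_eq_abs]; nlinarith

theorem lipschitz_apply_time {Q : Set (Space d × ℝ)} (hc : IsDensityExtension Q c G L) :
    LipschitzWith L fun x => G (x, 0) (0, 1) := by
  refine LipschitzWith.of_dist_le_mul fun x y => ?_
  have h1 := hc.lipschitz.dist_le_mul (x, 0) (y, 0)
  rw [dist_prod_same_right] at h1
  refine le_trans ?_ h1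
  rw [dist_eq_norm, dist_eq_norm, ← sub_apply]
  refine ((G (x, 0) - G (y, 0)).le_opNorm _).trans_eq ?_
  have h1 : ‖((0 : Space d), (1 : ℝ))‖ = 1 := by simp [Prod.norm_def]
  rw [h1, mul_one]

/-- The divergence theorem for `c_t S` at time `0`. -/
theorem setIntegral_div_time (hc : IsDensityExtension (spaceTime Ω ε T) c G L)
    (h : IsFamilyExtension Ω T δ B Θ V E) (hδ : δ ≤ ε) (hd : 2 ≤ d)
    (hΩ : IsBoundedLipschitzDomain Ω) :
    ∫ x in Ω, (fderiv ℝ (fun y => G (y, 0) (0, 1)) x (V 0 x)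
        + G (x, 0) (0, 1) * detDeriv 1 (fderiv ℝ (V 0) x))
      = ∫ x, G (x, 0) (0, 1) * ⟪V 0 x, outerNormal Ω x⟫ ∂(surfaceMeasure Ω) := by
  obtain ⟨C, hC, -, hGb, -⟩ := hc.exists_bounds h hδ hΩ.isBounded
  have hb0 : LipschitzWith L fun x => G (x, 0) (0, 1) := hc.lipschitz_apply_time
  obtain ⟨M, hM⟩ := exists_lipschitzOnWith_smul (hb0.lipschitzOnWith (s := closure Ω))
    ((h.lipschitz_V 0 h.zero_mem).lipschitzOnWith) (a := C)
    (fun x hx => abs_apply_time_le _ (by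
      have := hGb 0 h.zero_mem x hx
      rwa [h.zero] at this)) (h.norm_V_le 0 h.zero_mem)
  obtain ⟨W, hW, hWe⟩ := hM.extend_finite_dimension
  have hdiv := setIntegral_detDeriv_eq_surface hd hΩ LipschitzWith.id hW
    (A := fun _ => 1) aestronglyMeasurable_const (R := 1)
    (Eventually.of_forall fun _ => by
      exact ContinuousLinearMap.norm_id_le)
    (Eventually.of_forall fun x => hasFDerivWithinAt_id x _)
  refine Eq.trans ?_ (hdiv.trans ?_)
  · refine integral_congr_ae ?_
    filter_upwards [ae_restrict_mem hΩ.isOpen.measurableSet,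
      ae_restrict_of_ae hb0.ae_differentiableAt,
      ae_restrict_of_ae (h.lipschitz_V 0 h.zero_mem).ae_differentiableAt] with x hx h1 h2
    have hWd : fderiv ℝ W x = G (x, 0) (0, 1) • fderiv ℝ (V 0) x
        + (fderiv ℝ (fun y => G (y, 0) (0, 1)) x).smulRight (V 0 x) := by
      refine HasFDerivAt.fderiv ((h1.hasFDerivAt.smul h2.hasFDerivAt).congr_of_eventuallyEq ?_)
      filter_upwards [hΩ.isOpen.mem_nhds hx] with y hy using (hWe (subset_closure hy)).symm
    have h3 := detDeriv_smulRight_comp 1 (fderiv ℝ (fun y => G (y, 0) (0, 1)) x) (V 0 x)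
    have h4 : (1 : Space d →L[ℝ] Space d).det = 1 := by simp [ContinuousLinearMap.det]
    have h5 : fderiv ℝ (fun y => G (y, 0) (0, 1)) x ∘L (1 : Space d →L[ℝ] Space d)
        = fderiv ℝ (fun y => G (y, 0) (0, 1)) x := by ext; simp
    rw [h4, h5, mul_one] at h3
    have h6 : fderiv ℝ (id : Space d → Space d) x = 1 := fderiv_id
    rw [h6, hWd, detDeriv_add, detDeriv_smul, h3]
    ring
  · refine integral_congr_ae ?_
    filter_upwards [surfaceMeasure_frontier_compl Ω] with x hx
    have hw : G (x, 0) (0, 1) • V 0 x = W x := hWe (frontier_subset_closure hx)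
    have h3 := detDeriv_rankOne_apply 1 (W x) (outerNormal Ω x)
    have h4 : (1 : Space d →L[ℝ] Space d).det = 1 := by simp [ContinuousLinearMap.det]
    rw [h4, one_mul] at h3
    have h5 : (1 : Space d →L[ℝ] Space d) (W x) = W x := rfl
    rw [h5] at h3
    rw [h3, ← hw, inner_smul_right, real_inner_comm]

/-- The interior term in the first derivative, differentiated at `t = 0`. As `c_t` is only known
to be differentiable in `t` and Lipschitz in `x`, its derivative along the trajectories exists
almost everywhere, and the part with `∇c_t` is turned into a surface integral. -/
theorem hasDerivAt_setIntegral_time (hc : IsDensityExtension (spaceTime Ω ε T) c G L)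
    (h : IsFamilyExtension Ω T δ B Θ V E) (hδ : δ ≤ ε) (hd : 2 ≤ d)
    (hΩ : IsBoundedLipschitzDomain Ω)
    (hctt : HasContinuousTimeDerivTwo (spaceTime Ω ε T) c) :
    HasDerivAt (fun t => ∫ x in Ω, G (Θ t x, t) (0, 1) * (fderiv ℝ (Θ t) x).det)
      ((∫ x in Ω, timeDerivTwo c x)
        + ∫ x, G (x, 0) (0, 1) * ⟪V 0 x, outerNormal Ω x⟫ ∂(surfaceMeasure Ω)) 0 := by
  have := hΩ.isFiniteMeasure_restrict
  have hint := integrableOn_timeDerivTwo h hδ hΩ hctt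
  obtain ⟨g, hg, hgd⟩ := hctt
  obtain ⟨C₁, hC₁, hJ, hJ', hJq⟩ := h.exists_det_bounds hΩ.isOpen
  obtain ⟨C₂, hC₂, -, hGb, -⟩ := hc.exists_bounds h hδ hΩ.isBounded
  set b : ℝ → Space d → ℝ := fun t x => G (Θ t x, t) (0, 1)
  have hbm : ∀ t ∈ Ioo (-δ) δ, AEStronglyMeasurable (b t) (volume.restrict Ω) := fun t ht =>
    (hc.continuous_apply h ht continuous_const).aestronglyMeasurable
  have hbb : ∀ t ∈ Ioo (-δ) δ, ∀ x ∈ Ω, |b t x| ≤ C₂ := fun t ht x hx =>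
    abs_apply_time_le _ (hGb t ht x (subset_closure hx))
  have hbL : ∀ t ∈ Ioo (-δ) δ, ∀ s ∈ Ioo (-δ) δ, ∀ x ∈ Ω,
      |b t x - b s x| ≤ L * (B + 1) * |t - s| := by
    intro t ht s hs x hx
    have h1 := hc.norm_comp_sub_le h ht hs (subset_closure hx)
    exact abs_apply_time_le (G := fun z => G z - G (Θ s x, s)) (Θ t x, t) h1
  have hbi : ∀ t ∈ Ioo (-δ) δ, IntegrableOn (b t) Ω := fun t ht =>
    Integrable.of_bound (hbm t ht) C₂ (by
      filter_upwards [ae_restrict_mem hΩ.isOpen.measurableSet] with x hx using hbb t ht x hx)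
  have hJm : ∀ t, AEStronglyMeasurable (fun x => (fderiv ℝ (Θ t) x).det) (volume.restrict Ω) :=
    fun t => continuous_det.comp_aestronglyMeasurable (aestronglyMeasurable_fderiv _ _)
  have hb0 : b 0 = fun x => G (x, 0) (0, 1) := funext fun x => by simp only [b, h.zero]
  have hb0L : LipschitzWith L fun x => G (x, 0) (0, 1) := hc.lipschitz_apply_time
  -- The integral of `c_t`, by dominated convergence.
  have hder := hasDerivAt_integral_of_dominated_loc_of_lip (μ := volume.restrict Ω) (F := b)
    (F' := fun x => g (x, 0) + fderiv ℝ (fun y => G (y, 0) (0, 1)) x (V 0 x)) (x₀ := 0)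
    (s := Ioo (-δ) δ) (bound := fun _ => L * (B + 1)) (h.mem_nhds h.zero_mem)
    (by filter_upwards [h.mem_nhds h.zero_mem] with t ht using hbm t ht) (hbi 0 h.zero_mem)
    (by
      have h1 : AEStronglyMeasurable (fun x => g (x, 0)) (volume.restrict Ω) := by
        refine hint.aestronglyMeasurable.congr ?_
        filter_upwards [ae_restrict_mem hΩ.isOpen.measurableSet] with x hx
          using timeDerivTwo_eq h hδ hgd hx
      refine h1.add ?_
      have h2 := aestronglyMeasurable_fderiv (fun y => G (y, 0) (0, 1)) (volume.restrict Ω)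
      exact isBoundedBilinearMap_apply.continuous.comp_aestronglyMeasurable
        (h2.prodMk (h.lipschitz_V 0 h.zero_mem).continuous.aestronglyMeasurable))
    (by
      filter_upwards [ae_restrict_mem hΩ.isOpen.measurableSet] with x hx
      refine LipschitzOnWith.of_dist_le_mul fun t ht s hs => ?_
      have h0 : (0 : ℝ) ≤ L * (B + 1) := by positivity
      rw [Real.coe_nnabs, abs_of_nonneg h0]
      exact hbL t ht s hs x hx)
    (integrable_const _)
    (by
      filter_upwards [ae_restrict_mem hΩ.isOpen.measurableSet,
        ae_restrict_of_ae hb0L.ae_differentiableAt] with x hx h1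
      exact hc.hasDerivAt_apply_time h hδ hΩ.isOpen hg hgd hx h1)
  -- The contribution of the volume element.
  have hid : ∀ x, fderiv ℝ (Θ 0) x = 1 := fun x => by
    have : Θ 0 = id := funext h.zero
    rw [this]; exact fderiv_id
  have hdet1 : (1 : Space d →L[ℝ] Space d).det = 1 := by simp [ContinuousLinearMap.det]
  have hprod : ∀ t ∈ Ioo (-δ) δ,
      IntegrableOn (fun x => b t x * ((fderiv ℝ (Θ t) x).det - 1)) Ω := fun t ht =>
    Integrable.of_bound ((hbm t ht).mul ((hJm t).sub aestronglyMeasurable_const))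
      (C₂ * (C₁ + 1)) (by
        filter_upwards [ae_restrict_mem hΩ.isOpen.measurableSet] with x hx
        rw [norm_mul]
        refine mul_le_mul (hbb t ht x hx) ?_ (norm_nonneg _) hC₂
        refine (norm_sub_le _ _).trans ?_
        rw [norm_one]
        exact add_le_add (hJ t ht x) le_rfl)
  have hD0 : ∀ x, |detDeriv 1 (fderiv ℝ (V 0) x)| ≤ C₁ := fun x => by
    have := hJ' 0 h.zero_mem x
    rwa [hid] at this
  have hprod' : IntegrableOn (fun x => b 0 x * detDeriv 1 (fderiv ℝ (V 0) x)) Ω := by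
    refine Integrable.of_bound ((hbm 0 h.zero_mem).mul ?_) (C₂ * C₁) ?_
    · exact continuous_detDeriv.comp_aestronglyMeasurable
        (aestronglyMeasurable_const.prodMk (aestronglyMeasurable_fderiv _ _))
    · filter_upwards [ae_restrict_mem hΩ.isOpen.measurableSet] with x hx
      rw [norm_mul]
      exact mul_le_mul (hbb 0 h.zero_mem x hx) (hD0 x) (norm_nonneg _) hC₂
  have hder2 := hasDerivAt_integral_of_quadratic (μ := volume.restrict Ω) (s := 0)
    (f := fun t x => b t x * ((fderiv ℝ (Θ t) x).det - 1))
    (f' := fun x => b 0 x * detDeriv 1 (fderiv ℝ (V 0) x))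
    (C := C₂ * C₁ + L * (B + 1) * C₁)
    (by filter_upwards [h.mem_nhds h.zero_mem] with t ht using hprod t ht) hprod' (by
      filter_upwards [h.mem_nhds h.zero_mem] with t ht
      filter_upwards [ae_restrict_mem hΩ.isOpen.measurableSet, hJq t ht 0 h.zero_mem] with x hx hq
      rw [hid, hdet1] at hq
      rw [hid, hdet1]
      have e : b t x * ((fderiv ℝ (Θ t) x).det - 1) - b 0 x * (1 - 1)
          - (t - 0) * (b 0 x * detDeriv 1 (fderiv ℝ (V 0) x))
          = b t x * ((fderiv ℝ (Θ t) x).det - 1 - (t - 0) * detDeriv 1 (fderiv ℝ (V 0) x))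
            + (b t x - b 0 x) * ((t - 0) * detDeriv 1 (fderiv ℝ (V 0) x)) := by ring
      rw [e]
      refine (abs_add_le _ _).trans ?_
      rw [abs_mul, abs_mul, abs_mul (t - 0)]
      calc _ ≤ C₂ * (C₁ * |t - 0| ^ 2) + L * (B + 1) * |t - 0| * (|t - 0| * C₁) :=
            add_le_add (mul_le_mul (hbb t ht x hx) hq (abs_nonneg _) hC₂)
              (mul_le_mul (hbL t ht 0 h.zero_mem x hx)
                (mul_le_mul_of_nonneg_left (hD0 x) (abs_nonneg _)) (by positivity) (by positivity))
        _ = _ := by ring)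
  have hsum := hder.2.add hder2
  have hval : (∫ x in Ω, timeDerivTwo c x)
        + ∫ x, G (x, 0) (0, 1) * ⟪V 0 x, outerNormal Ω x⟫ ∂(surfaceMeasure Ω)
      = (∫ x in Ω, (g (x, 0) + fderiv ℝ (fun y => G (y, 0) (0, 1)) x (V 0 x)))
        + ∫ x in Ω, b 0 x * detDeriv 1 (fderiv ℝ (V 0) x) := by
    have hg0 : Integrable (fun x => g (x, 0)) (volume.restrict Ω) :=
      hint.congr (by filter_upwards [ae_restrict_mem hΩ.isOpen.measurableSet] with x hx
          using timeDerivTwo_eq h hδ hgd hx)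
    have hF : Integrable (fun x => fderiv ℝ (fun y => G (y, 0) (0, 1)) x (V 0 x))
        (volume.restrict Ω) := by
      refine (hder.1.sub hg0).congr (Eventually.of_forall fun x => ?_)
      simp
    rw [← hc.setIntegral_div_time h hδ hd hΩ, hb0]
    rw [hb0] at hprod'
    rw [integral_add hF hprod', integral_add hg0 hF, ← add_assoc]
    congr 2
    refine setIntegral_congr_fun hΩ.isOpen.measurableSet fun x hx => ?_
    exact timeDerivTwo_eq h hδ hgd hx
  rw [hval]
  refine hsum.congr_of_eventuallyEq ?_
  filter_upwards [h.mem_nhds h.zero_mem] with t ht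
  have := integral_add (hbi t ht) (hprod t ht)
  rw [Pi.add_apply, ← this]
  refine integral_congr_ae (Eventually.of_forall fun x => ?_)
  simp only [b]; ring

end IsDensityExtension

end

/-! ### The derivative of the boundary term -/

section

open InnerProductSpace (rankOne)

theorem norm_rankOne_le_of_norm_le {F : Type*} [NormedAddCommGroup F] [InnerProductSpace ℝ F]
    (w : F) {n : F} (hn : ‖n‖ ≤ 1) : ‖rankOne ℝ w n‖ ≤ ‖w‖ := by
  refine ContinuousLinearMap.opNorm_le_bound _ (norm_nonneg _) fun v => ?_
  rw [InnerProductSpace.rankOne_apply, norm_smul, mul_comm]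
  refine mul_le_mul_of_nonneg_left ((norm_inner_le_norm n v).trans ?_) (norm_nonneg _)
  exact mul_le_of_le_one_left (norm_nonneg _) hn

/-- Second order expansion of `t ↦ detDeriv (1 + t A + O(t²)) (w ⊗ n)`, by way of
`w = (1 + t A) (w - t A w) + t² A² w`. -/
theorem exists_abs_detDeriv_rankOne_sub_le (F : Type*) [NormedAddCommGroup F]
    [InnerProductSpace ℝ F] [FiniteDimensional ℝ F] {R : ℝ} (hR : 0 ≤ R) :
    ∃ C : ℝ, 0 ≤ C ∧ ∀ (A P : F →L[ℝ] F) (w n : F) (t : ℝ), ‖A‖ ≤ R → ‖P‖ ≤ R * |t| ^ 2 →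
      ‖w‖ ≤ R → ‖n‖ ≤ 1 → |t| ≤ 1 →
      |detDeriv (1 + (t • A + P)) (rankOne ℝ w n) - ⟪n, w⟫
        - t * (detDeriv 1 A * ⟪n, w⟫ - ⟪n, A w⟫)| ≤ C * |t| ^ 2 := by
  obtain ⟨C₁, hC₁, h₁⟩ := exists_abs_detDeriv_sub_le F (1 + R + R)
  obtain ⟨C₂, hC₂, h₂⟩ := exists_abs_detDeriv_le F (1 + R + R)
  obtain ⟨C₃, hC₃, h₃⟩ := exists_abs_det_add_sub_le F (1 + R + R)
  refine ⟨C₁ * R * R + C₂ * (R * (R * R)) + C₃ * R ^ 2 * (R + R * R) + C₂ * R * (R * R),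
    by positivity, fun A P w n t hA hP hw hn ht => ?_⟩
  have h1n : ‖(1 : F →L[ℝ] F)‖ ≤ 1 := ContinuousLinearMap.norm_id_le
  have ht2 : |t| ^ 2 ≤ 1 := pow_le_one₀ (abs_nonneg t) ht
  have htA : ‖t • A‖ ≤ |t| * R := by
    rw [norm_smul, Real.norm_eq_abs]; gcongr
  have htA' : ‖t • A‖ ≤ R := htA.trans (mul_le_of_le_one_left hR ht)
  have hP' : ‖P‖ ≤ R := hP.trans (mul_le_of_le_one_right hR ht2)
  set X : F →L[ℝ] F := 1 + t • A
  have hX : ‖X‖ ≤ 1 + R + R := by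
    have := (norm_add_le (1 : F →L[ℝ] F) (t • A)); linarith
  have hXP : 1 + (t • A + P) = X + P := (add_assoc _ _ _).symm
  have hXPn : ‖X + P‖ ≤ 1 + R + R := by
    have := norm_add_le (1 : F →L[ℝ] F) (t • A)
    have := norm_add_le X P; linarith
  have hAw : ‖A w‖ ≤ R * R := (A.le_opNorm w).trans (by gcongr)
  have hAAw : ‖A (A w)‖ ≤ R * (R * R) := (A.le_opNorm _).trans (by gcongr)
  have hin : ∀ {v : F} {r : ℝ}, ‖v‖ ≤ r → |⟪n, v⟫| ≤ r := fun {v r} hv => by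
    refine (abs_real_inner_le_norm n v).trans ((mul_le_of_le_one_left (norm_nonneg _) hn).trans hv)
  have e1 : |detDeriv (X + P) (rankOne ℝ w n) - detDeriv X (rankOne ℝ w n)|
      ≤ C₁ * R * R * |t| ^ 2 := by
    refine (h₁ _ _ _ hXPn hX).trans ?_
    rw [add_sub_cancel_left]
    calc C₁ * ‖P‖ * ‖rankOne ℝ w n‖ ≤ C₁ * (R * |t| ^ 2) * R := by
          gcongr
          exact (norm_rankOne_le_of_norm_le w hn).trans hw
      _ = _ := by ring
  have e2 : detDeriv X (rankOne ℝ w n) = X.det * (⟪n, w⟫ - t * ⟪n, A w⟫)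
      + t ^ 2 * detDeriv X (rankOne ℝ (A (A w)) n) := by
    have hw' : w = X (w - t • A w) + t ^ 2 • A (A w) := by
      simp only [X, add_apply, smul_apply, map_sub, map_smul]
      rw [show (1 : F →L[ℝ] F) w = w from rfl, show (1 : F →L[ℝ] F) (A w) = A w from rfl]
      module
    have hr : rankOne ℝ w n = rankOne ℝ (X (w - t • A w)) n + t ^ 2 • rankOne ℝ (A (A w)) n := by
      conv_lhs => rw [hw']
      ext v
      simp [smul_smul, mul_comm]
    rw [hr, detDeriv_add, detDeriv_smul, detDeriv_rankOne_apply, inner_sub_right, inner_smul_right]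
  have e3 : |detDeriv X (rankOne ℝ (A (A w)) n)| ≤ C₂ * (R * (R * R)) := by
    refine (h₂ _ _ hX).trans ?_
    gcongr
    exact (norm_rankOne_le_of_norm_le _ hn).trans hAAw
  have e4 : |X.det - 1 - t * detDeriv 1 A| ≤ C₃ * R ^ 2 * |t| ^ 2 := by
    have := h₃ 1 X (by linarith) hX
    rw [show X - 1 = t • A from add_sub_cancel_left _ _, detDeriv_smul] at this
    rw [show (1 : F →L[ℝ] F).det = 1 by simp [ContinuousLinearMap.det]] at this
    refine this.trans ?_
    calc C₃ * ‖t • A‖ ^ 2 ≤ C₃ * (|t| * R) ^ 2 := by gcongr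
      _ = _ := by ring
  have e5 : |detDeriv 1 A| ≤ C₂ * R := (h₂ 1 A (by linarith)).trans (by gcongr)
  have e6 : |⟪n, w⟫ - t * ⟪n, A w⟫| ≤ R + R * R := by
    refine (abs_sub _ _).trans (add_le_add (hin hw) ?_)
    rw [abs_mul]
    calc |t| * |⟪n, A w⟫| ≤ 1 * (R * R) :=
          mul_le_mul ht (hin hAw) (abs_nonneg _) zero_le_one
      _ = _ := one_mul _
  have e7 : |⟪n, A w⟫| ≤ R * R := hin hAw
  have e : detDeriv (X + P) (rankOne ℝ w n) - ⟪n, w⟫ - t * (detDeriv 1 A * ⟪n, w⟫ - ⟪n, A w⟫)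
      = (detDeriv (X + P) (rankOne ℝ w n) - detDeriv X (rankOne ℝ w n))
        + t ^ 2 * detDeriv X (rankOne ℝ (A (A w)) n)
        + (X.det - 1 - t * detDeriv 1 A) * (⟪n, w⟫ - t * ⟪n, A w⟫)
        + -(t ^ 2 * (detDeriv 1 A * ⟪n, A w⟫)) := by
    rw [e2]; ring
  rw [hXP, e]
  refine (abs_add_le _ _).trans ?_
  rw [abs_neg]
  calc _ ≤ C₁ * R * R * |t| ^ 2 + |t| ^ 2 * (C₂ * (R * (R * R)))
        + C₃ * R ^ 2 * |t| ^ 2 * (R + R * R) + |t| ^ 2 * (C₂ * R * (R * R)) := by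
        refine add_le_add ((abs_add_le _ _).trans (add_le_add ((abs_add_le _ _).trans
          (add_le_add e1 ?_)) ?_)) ?_
        · rw [abs_mul, abs_pow]
          gcongr
        · rw [abs_mul]
          exact mul_le_mul e4 e6 (abs_nonneg _) (by positivity)
        · rw [abs_mul, abs_pow, abs_mul]
          exact mul_le_mul_of_nonneg_left
            (mul_le_mul e5 e7 (abs_nonneg _) (by positivity)) (by positivity)
    _ = _ := by ring

namespace IsDensityExtension

variable {d : ℕ} {Ω : Set (Space d)} {ε δ : ℝ} {T Θ V E : ℝ → Space d → Space d} {B L : ℝ≥0}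
  {c : Space d × ℝ → ℝ} {G : Space d × ℝ → Space d × ℝ →L[ℝ] ℝ} {t s : ℝ} {x : Space d}

/-- The derivative at `t = 0` of the field `c V t`, also on the boundary. -/
theorem hasDerivAt_smul (hc : IsDensityExtension (spaceTime Ω ε T) c G L)
    (h : IsFamilyExtension Ω T δ B Θ V E) (hδ : δ ≤ ε) (hΩ : Bornology.IsBounded Ω)
    (hx : x ∈ closure Ω) :
    HasDerivAt (fun t => c (Θ t x, t) • V t x)
      (c (x, 0) • acceleration Ω T x + G (x, 0) (V 0 x, 1) • V 0 x) 0 := by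
  obtain ⟨C, hC, -, -, -, hq⟩ := hc.exists_bounds h hδ hΩ
  have h1 : HasDerivAt (fun t => c (Θ t x, t)) (G (Θ 0 x, 0) (V 0 x, 1)) 0 :=
    hasDerivAt_of_norm_sub_sub_le_sq (by
      filter_upwards [h.mem_nhds h.zero_mem] with t ht using hq t ht 0 h.zero_mem x hx)
  have := h1.smul (h.hasDerivAt_V x hx)
  rwa [h.zero] at this

theorem exists_smul_bounds (hc : IsDensityExtension (spaceTime Ω ε T) c G L)
    (h : IsFamilyExtension Ω T δ B Θ V E) (hδ : δ ≤ ε) (hΩ : Bornology.IsBounded Ω) :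
    ∃ C : ℝ, 0 ≤ C ∧ (∀ t ∈ Ioo (-δ) δ, ∀ x ∈ closure Ω, ‖c (Θ t x, t) • V t x‖ ≤ C) ∧
      ∀ t ∈ Ioo (-δ) δ, ∀ s ∈ Ioo (-δ) δ, ∀ x ∈ closure Ω,
        ‖c (Θ t x, t) • V t x - c (Θ s x, s) • V s x‖ ≤ C * |t - s| := by
  obtain ⟨C, hC, hb, -, hb', hq⟩ := hc.exists_bounds h hδ hΩ
  have hB := B.coe_nonneg
  refine ⟨C * B + 3 * C * B + C * B, by positivity, fun t ht x hx => ?_,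
    fun t ht s hs x hx => ?_⟩
  · rw [norm_smul, Real.norm_eq_abs]
    have := mul_le_mul (hb t ht x hx) (h.norm_V_le t ht x hx) (norm_nonneg _) hC
    have h2 : 0 ≤ C * B := by positivity
    linarith
  · have hts : |t - s| ≤ 2 := by
      have := h.le_one
      rw [abs_le]
      constructor <;> linarith [ht.1, ht.2, hs.1, hs.2]
    have h1 : |c (Θ t x, t) - c (Θ s x, s)| ≤ 3 * C * |t - s| := by
      have h2 := hq t ht s hs x hx
      have h3 := abs_sub_abs_le_abs_sub (c (Θ t x, t) - c (Θ s x, s))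
        ((t - s) * G (Θ s x, s) (V s x, 1))
      rw [abs_mul] at h3
      have h4 : |t - s| * |G (Θ s x, s) (V s x, 1)| ≤ |t - s| * C := by
        gcongr; exact hb' s hs x hx
      have h5 : C * |t - s| ^ 2 ≤ C * (2 * |t - s|) := by
        rw [sq]; gcongr
      linarith
    have e : c (Θ t x, t) • V t x - c (Θ s x, s) • V s x
        = (c (Θ t x, t) - c (Θ s x, s)) • V t x + c (Θ s x, s) • (V t x - V s x) := by module
    rw [e]
    refine (norm_add_le _ _).trans ?_
    rw [norm_smul, norm_smul, Real.norm_eq_abs, Real.norm_eq_abs]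
    have h6 : 0 ≤ C * B * |t - s| := by positivity
    calc _ ≤ 3 * C * |t - s| * B + C * (B * |t - s|) :=
          add_le_add (mul_le_mul h1 (h.norm_V_le t ht x hx) (norm_nonneg _) (by positivity))
            (mul_le_mul (hb s hs x hx) (h.norm_V_sub_le t ht s hs x hx) (norm_nonneg _) hC)
      _ ≤ _ := by linarith

theorem continuousOn_smul (hc : IsDensityExtension (spaceTime Ω ε T) c G L)
    (h : IsFamilyExtension Ω T δ B Θ V E) (hδ : δ ≤ ε) (ht : t ∈ Ioo (-δ) δ) :
    ContinuousOn (fun x => c (Θ t x, t) • V t x) (closure Ω) :=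
  (hc.continuousOn_comp h hδ ht).smul (h.lipschitz_V t ht).continuous.continuousOn

/-- The surface integral in the first derivative, differentiated at `t = 0`. The boundary Jacobian
of `Θ t` is `1 + t A + P t`, with a remainder `P t` that need not be differentiable in `t`. -/
theorem hasDerivAt_surface (hc : IsDensityExtension (spaceTime Ω ε T) c G L)
    (h : IsFamilyExtension Ω T δ B Θ V E) (hδ : δ ≤ ε) (hd : 2 ≤ d)
    (hΩ : IsBoundedLipschitzDomain Ω)
    {A : Space d → Space d →L[ℝ] Space d} (hAm : AEStronglyMeasurable A (surfaceMeasure Ω))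
    {R : ℝ} (hAb : ∀ᵐ x ∂(surfaceMeasure Ω), ‖A x‖ ≤ R)
    {P : ℝ → Space d → Space d →L[ℝ] Space d}
    (hPm : ∀ t ∈ Ioo (-δ) δ, AEStronglyMeasurable (P t) (surfaceMeasure Ω))
    {R' : ℝ} (hPb : ∀ t ∈ Ioo (-δ) δ, ∀ x, ‖P t x‖ ≤ R' * |t| ^ 2) :
    Integrable (fun x => ⟪outerNormal Ω x, c (x, 0) • acceleration Ω T x
      + G (x, 0) (V 0 x, 1) • V 0 x⟫) (surfaceMeasure Ω) ∧
    Integrable (fun x => detDeriv 1 (A x) * ⟪outerNormal Ω x, c (x, 0) • V 0 x⟫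
      - ⟪outerNormal Ω x, A x (c (x, 0) • V 0 x)⟫) (surfaceMeasure Ω) ∧
    HasDerivAt (fun t => ∫ x, detDeriv (1 + (t • A x + P t x))
        (rankOne ℝ (c (Θ t x, t) • V t x) (outerNormal Ω x)) ∂(surfaceMeasure Ω))
      ((∫ x, ⟪outerNormal Ω x, c (x, 0) • acceleration Ω T x
          + G (x, 0) (V 0 x, 1) • V 0 x⟫ ∂(surfaceMeasure Ω))
        + ∫ x, (detDeriv 1 (A x) * ⟪outerNormal Ω x, c (x, 0) • V 0 x⟫
          - ⟪outerNormal Ω x, A x (c (x, 0) • V 0 x)⟫) ∂(surfaceMeasure Ω)) 0 := by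
  have := isFiniteMeasure_surfaceMeasure hd hΩ
  have hν := aestronglyMeasurable_outerNormal hd hΩ
  obtain ⟨C₁, hC₁, hwb, hwL⟩ := hc.exists_smul_bounds h hδ hΩ.isBounded
  set w : ℝ → Space d → Space d := fun t x => c (Θ t x, t) • V t x
  have hw0 : ∀ x, w 0 x = c (x, 0) • V 0 x := fun x => by simp only [w, h.zero]
  have hwm : ∀ t ∈ Ioo (-δ) δ, AEStronglyMeasurable (w t) (surfaceMeasure Ω) := fun t ht =>
    ((hc.continuousOn_smul h hδ ht).mono frontier_subset_closure).aestronglyMeasurable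
      isClosed_frontier.measurableSet
  have hinner : ∀ {v : Space d} {r : ℝ} (x), ‖v‖ ≤ r → |⟪outerNormal Ω x, v⟫| ≤ r :=
    fun {v r} x hv => (abs_real_inner_le_norm _ v).trans
      ((mul_le_of_le_one_left (norm_nonneg _) (norm_outerNormal_le Ω x)).trans hv)
  have hiw : ∀ t ∈ Ioo (-δ) δ, Integrable (fun x => ⟪outerNormal Ω x, w t x⟫) (surfaceMeasure Ω) :=
    fun t ht => Integrable.of_bound (hν.inner (hwm t ht)) C₁ (by
      filter_upwards [surfaceMeasure_frontier_compl Ω] with x hx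
      exact hinner x (hwb t ht x (frontier_subset_closure hx)))
  -- The part with the boundary Jacobian replaced by the identity.
  have hder := hasDerivAt_integral_of_dominated_loc_of_lip (μ := surfaceMeasure Ω)
    (F := fun t x => ⟪outerNormal Ω x, w t x⟫)
    (F' := fun x => ⟪outerNormal Ω x, c (x, 0) • acceleration Ω T x
      + G (x, 0) (V 0 x, 1) • V 0 x⟫) (x₀ := 0)
    (s := Ioo (-δ) δ) (bound := fun _ => C₁) (h.mem_nhds h.zero_mem)
    (by filter_upwards [h.mem_nhds h.zero_mem] with t ht using (hiw t ht).aestronglyMeasurable)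
    (hiw 0 h.zero_mem)
    (by
      have hc0 : ContinuousOn (fun x => c (x, 0)) (closure Ω) := by
        have := hc.continuousOn_comp h hδ h.zero_mem
        simpa only [h.zero] using this
      have hG0 : Continuous fun x => G (x, 0) (V 0 x, 1) := by
        have := hc.continuous_apply h h.zero_mem
          ((h.lipschitz_V 0 h.zero_mem).continuous.prodMk (continuous_const (y := (1 : ℝ))))
        simpa only [h.zero] using this
      have hcont := (hc0.smul h.continuousOn_acceleration).add
        (hG0.smul (h.lipschitz_V 0 h.zero_mem).continuous).continuousOn
      exact hν.inner ((hcont.mono frontier_subset_closure).aestronglyMeasurable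
        isClosed_frontier.measurableSet))
    (by
      filter_upwards [surfaceMeasure_frontier_compl Ω] with x hx
      refine LipschitzOnWith.of_dist_le_mul fun t ht s hs => ?_
      rw [Real.coe_nnabs, abs_of_nonneg hC₁, Real.dist_eq, ← inner_sub_right]
      exact hinner x (hwL t ht s hs x (frontier_subset_closure hx)))
    (integrable_const _)
    (by
      filter_upwards [surfaceMeasure_frontier_compl Ω] with x hx
      have := (hasDerivAt_const (0 : ℝ) (outerNormal Ω x)).inner ℝ
        (hc.hasDerivAt_smul h hδ hΩ.isBounded (frontier_subset_closure hx))
      simpa using this)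
  -- The remaining part vanishes at `t = 0` and is differentiable uniformly in `x`.
  set R₀ := |R| + |R'| + C₁
  have hR₀ : 0 ≤ R₀ := by positivity
  obtain ⟨C₂, hC₂, hexp⟩ := exists_abs_detDeriv_rankOne_sub_le (Space d) hR₀
  obtain ⟨C₃, hC₃, hlin⟩ := exists_abs_detDeriv_le (Space d) 1
  have h1n : ‖(1 : Space d →L[ℝ] Space d)‖ ≤ 1 := ContinuousLinearMap.norm_id_le
  have hAR : ∀ᵐ x ∂(surfaceMeasure Ω), ‖A x‖ ≤ R₀ := by
    filter_upwards [hAb] with x hx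
    have := le_abs_self R
    have := abs_nonneg R'
    simp only [R₀]; linarith
  have hPR : ∀ t ∈ Ioo (-δ) δ, ∀ x, ‖P t x‖ ≤ R₀ * |t| ^ 2 := fun t ht x => by
    refine (hPb t ht x).trans ?_
    gcongr
    have := le_abs_self R'
    have := abs_nonneg R
    simp only [R₀]; linarith
  have hwR : ∀ t ∈ Ioo (-δ) δ, ∀ x ∈ frontier Ω, ‖w t x‖ ≤ R₀ := fun t ht x hx => by
    refine (hwb t ht x (frontier_subset_closure hx)).trans ?_
    have := abs_nonneg R
    have := abs_nonneg R'
    simp only [R₀]; linarith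
  have hiB : ∀ t ∈ Ioo (-δ) δ, Integrable (fun x => detDeriv (1 + (t • A x + P t x))
      (rankOne ℝ (w t x) (outerNormal Ω x))) (surfaceMeasure Ω) := fun t ht => by
    refine integrable_surfaceMeasure_detDeriv hd hΩ
      ((hc.continuousOn_smul h hδ ht).mono frontier_subset_closure)
      (aestronglyMeasurable_const.add ((hAm.const_smul t).add (hPm t ht)))
      (R := 1 + (|t| * R₀ + R₀ * |t| ^ 2)) ?_
    filter_upwards [hAR] with x hx
    refine (norm_add_le _ _).trans (add_le_add h1n ((norm_add_le _ _).trans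
      (add_le_add ?_ (hPR t ht x))))
    rw [norm_smul, Real.norm_eq_abs]
    gcongr
  have hiD : Integrable (fun x => detDeriv 1 (A x) * ⟪outerNormal Ω x, w 0 x⟫
      - ⟪outerNormal Ω x, A x (w 0 x)⟫) (surfaceMeasure Ω) := by
    have hm1 : AEStronglyMeasurable (fun x => detDeriv 1 (A x)) (surfaceMeasure Ω) :=
      continuous_detDeriv.comp_aestronglyMeasurable (aestronglyMeasurable_const.prodMk hAm)
    have hm2 : AEStronglyMeasurable (fun x => A x (w 0 x)) (surfaceMeasure Ω) :=
      isBoundedBilinearMap_apply.continuous.comp_aestronglyMeasurable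
        (hAm.prodMk (hwm 0 h.zero_mem))
    refine Integrable.of_bound ((hm1.mul (hν.inner (hwm 0 h.zero_mem))).sub (hν.inner hm2))
      (C₃ * R₀ * R₀ + R₀ * R₀) ?_
    filter_upwards [hAR, surfaceMeasure_frontier_compl Ω] with x hx hxf
    refine (norm_sub_le _ _).trans (add_le_add ?_ ?_)
    · rw [norm_mul]
      exact mul_le_mul ((hlin 1 _ h1n).trans (by gcongr)) (hinner x (hwR 0 h.zero_mem x hxf))
        (norm_nonneg _) (by positivity)
    · exact hinner x (((A x).le_opNorm _).trans
        (mul_le_mul hx (hwR 0 h.zero_mem x hxf) (norm_nonneg _) hR₀))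
  have hder2 := hasDerivAt_integral_of_quadratic (μ := surfaceMeasure Ω) (s := 0)
    (f := fun t x => detDeriv (1 + (t • A x + P t x)) (rankOne ℝ (w t x) (outerNormal Ω x))
      - ⟪outerNormal Ω x, w t x⟫)
    (f' := fun x => detDeriv 1 (A x) * ⟪outerNormal Ω x, w 0 x⟫
      - ⟪outerNormal Ω x, A x (w 0 x)⟫)
    (C := C₂ + (C₃ * R₀ * C₁ + R₀ * C₁))
    (by filter_upwards [h.mem_nhds h.zero_mem] with t ht using (hiB t ht).sub (hiw t ht))
    hiD (by
      filter_upwards [h.mem_nhds h.zero_mem] with t ht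
      filter_upwards [hAR, surfaceMeasure_frontier_compl Ω] with x hx hxf
      have ht1 : |t| ≤ 1 := (abs_lt.2 ht).le.trans h.le_one
      have e1 := hexp (A x) (P t x) (w t x) (outerNormal Ω x) t hx (hPR t ht x) (hwR t ht x hxf)
        (norm_outerNormal_le Ω x) ht1
      have e0 := hexp (A x) (P 0 x) (w 0 x) (outerNormal Ω x) 0 hx (hPR 0 h.zero_mem x)
        (hwR 0 h.zero_mem x hxf) (norm_outerNormal_le Ω x) (by simp)
      have e0' : detDeriv (1 + ((0 : ℝ) • A x + P 0 x)) (rankOne ℝ (w 0 x) (outerNormal Ω x))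
          - ⟪outerNormal Ω x, w 0 x⟫ = 0 := by
        rw [zero_mul, sub_zero, abs_zero, zero_pow two_ne_zero, mul_zero] at e0
        exact abs_nonpos_iff.1 e0
      have hdw := hwL t ht 0 h.zero_mem x (frontier_subset_closure hxf)
      have e2 : |(t * (detDeriv 1 (A x) * ⟪outerNormal Ω x, w t x - w 0 x⟫
          - ⟪outerNormal Ω x, A x (w t x - w 0 x)⟫))|
          ≤ |t| * (C₃ * R₀ * (C₁ * |t - 0|) + R₀ * (C₁ * |t - 0|)) := by
        rw [abs_mul]
        refine mul_le_mul_of_nonneg_left ((abs_sub _ _).trans (add_le_add ?_ ?_)) (abs_nonneg _)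
        · rw [abs_mul]
          exact mul_le_mul ((hlin 1 _ h1n).trans (by gcongr)) (hinner x hdw) (abs_nonneg _)
            (by positivity)
        · exact hinner x (((A x).le_opNorm _).trans (mul_le_mul hx hdw (norm_nonneg _) hR₀))
      rw [inner_sub_right, map_sub, inner_sub_right] at e2
      rw [e0', sub_zero, sub_zero]
      rw [sub_zero] at e2
      refine le_trans ?_ ((abs_add_le _ _).trans (add_le_add e1 e2) |>.trans_eq (by ring))
      refine le_of_eq ?_
      congr 1
      ring)
  have hsum := hder.2.add hder2
  simp only [hw0] at hsum hiD
  refine ⟨hder.1, hiD, hsum.congr_of_eventuallyEq ?_⟩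
  filter_upwards [h.mem_nhds h.zero_mem] with t ht
  have h1 : Integrable (fun x => detDeriv (1 + (t • A x + P t x))
      (rankOne ℝ (w t x) (outerNormal Ω x)) - ⟪outerNormal Ω x, w t x⟫) (surfaceMeasure Ω) :=
    (hiB t ht).sub (hiw t ht)
  rw [Pi.add_apply, ← integral_add (hiw t ht) h1]
  refine integral_congr_ae (Eventually.of_forall fun x => ?_)
  simp only [w]; ring

end IsDensityExtension

end

/-! ### The second derivative -/

section

open InnerProductSpace (rankOne)

variable {d : ℕ} {Ω : Set (Space d)} {ε δ : ℝ} {T Θ V E : ℝ → Space d → Space d} {B L : ℝ≥0}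
  {c : Space d × ℝ → ℝ} {G : Space d × ℝ → Space d × ℝ →L[ℝ] ℝ}

/-- The velocity `S` agrees on the closure of `Ω` with the Lipschitz field `V 0`. -/
theorem IsFamilyExtension.exists_isBoundaryJacobian (h : IsFamilyExtension Ω T δ B Θ V E)
    (hd : 2 ≤ d) (hΩ : IsBoundedLipschitzDomain Ω) :
    ∃ A, IsBoundaryJacobian Ω (velocity Ω T) A := by
  obtain ⟨C, -, hC⟩ := exists_boundaryJacobian hd hΩ
  obtain ⟨A, hAm, hAb, hA⟩ := hC B (V 0) (h.lipschitz_V 0 h.zero_mem)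
  refine ⟨A, memLp_top_of_bound hAm (C * B) (Eventually.of_forall hAb), ?_⟩
  filter_upwards [hA, surfaceMeasure_frontier_compl Ω] with x hx hxf
  exact hx.congr (fun y hy => h.velocity_eq (frontier_subset_closure hy))
    (h.velocity_eq (frontier_subset_closure hxf))

theorem IsBoundaryJacobian.ae_norm_le {S : Space d → Space d} {A : Space d → Space d →L[ℝ] Space d}
    (hA : IsBoundaryJacobian Ω S A) : ∃ R : ℝ, ∀ᵐ x ∂(surfaceMeasure Ω), ‖A x‖ ≤ R :=
  ⟨_, ae_le_lpNorm_exponent_top hA.memLp⟩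

theorem integrable_inner_outerNormal (hd : 2 ≤ d) (hΩ : IsBoundedLipschitzDomain Ω)
    {W : Space d → Space d} (hW : AEStronglyMeasurable W (surfaceMeasure Ω)) {R : ℝ}
    (hR : ∀ᵐ x ∂(surfaceMeasure Ω), ‖W x‖ ≤ R) :
    Integrable (fun x => ⟪W x, outerNormal Ω x⟫) (surfaceMeasure Ω) := by
  have := isFiniteMeasure_surfaceMeasure hd hΩ
  refine Integrable.of_bound (hW.inner (aestronglyMeasurable_outerNormal hd hΩ)) R ?_
  filter_upwards [hR] with x hx
  exact (abs_real_inner_le_norm _ _).trans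
    ((mul_le_of_le_one_right (norm_nonneg _) (norm_outerNormal_le Ω x)).trans hx)

namespace IsDensityExtension

/-- With `Θ t = id + t V 0 + E t`, a boundary Jacobian `A` of `V 0` gives boundary Jacobians of all
`Θ t`, and hence a formula for `I'` near `0` that can be differentiated once more at `0`. -/
theorem hasDerivAt_deriv_volumeIntegral (hc : IsDensityExtension (spaceTime Ω ε T) c G L)
    (h : IsFamilyExtension Ω T δ B Θ V E) (hδ : δ ≤ ε) (hd : 2 ≤ d)
    (hΩ : IsBoundedLipschitzDomain Ω)
    (hctt : HasContinuousTimeDerivTwo (spaceTime Ω ε T) c)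
    {A : Space d → Space d →L[ℝ] Space d} (hAm : AEStronglyMeasurable A (surfaceMeasure Ω))
    {R : ℝ} (hAb : ∀ᵐ x ∂(surfaceMeasure Ω), ‖A x‖ ≤ R)
    (hA : ∀ᵐ x ∂(surfaceMeasure Ω), HasFDerivWithinAt (V 0) (A x) (frontier Ω) x) :
    Integrable (fun x => ⟪outerNormal Ω x, c (x, 0) • acceleration Ω T x
      + G (x, 0) (V 0 x, 1) • V 0 x⟫) (surfaceMeasure Ω) ∧
    Integrable (fun x => detDeriv 1 (A x) * ⟪outerNormal Ω x, c (x, 0) • V 0 x⟫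
      - ⟪outerNormal Ω x, A x (c (x, 0) • V 0 x)⟫) (surfaceMeasure Ω) ∧
    HasDerivAt (deriv (volumeIntegral Ω T c))
      (((∫ x in Ω, timeDerivTwo c x)
        + ∫ x, G (x, 0) (0, 1) * ⟪V 0 x, outerNormal Ω x⟫ ∂(surfaceMeasure Ω))
      + ((∫ x, ⟪outerNormal Ω x, c (x, 0) • acceleration Ω T x
          + G (x, 0) (V 0 x, 1) • V 0 x⟫ ∂(surfaceMeasure Ω))
        + ∫ x, (detDeriv 1 (A x) * ⟪outerNormal Ω x, c (x, 0) • V 0 x⟫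
          - ⟪outerNormal Ω x, A x (c (x, 0) • V 0 x)⟫) ∂(surfaceMeasure Ω))) 0 := by
  obtain ⟨C, hC, hex⟩ := exists_boundaryJacobian hd hΩ
  have hP : ∀ t, ∃ P : Space d → Space d →L[ℝ] Space d, t ∈ Ioo (-δ) δ →
      AEStronglyMeasurable P (surfaceMeasure Ω) ∧ (∀ x, ‖P x‖ ≤ C * B * |t| ^ 2) ∧
      ∀ᵐ x ∂(surfaceMeasure Ω), HasFDerivWithinAt (E t) (P x) (frontier Ω) x := by
    intro t
    by_cases ht : t ∈ Ioo (-δ) δ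
    · obtain ⟨P, hPm, hPb, hPd⟩ := hex _ _ (h.lipschitz_E t ht)
      refine ⟨P, fun _ => ⟨hPm, fun x => (hPb x).trans_eq ?_, hPd⟩⟩
      push_cast
      rw [Real.norm_eq_abs]; ring
    · exact ⟨0, fun h => absurd h ht⟩
  choose P hP using hP
  -- `1 + t A + P t` is a boundary Jacobian of `Θ t`
  obtain ⟨hi1, hi2, hB⟩ := hc.hasDerivAt_surface h hδ hd hΩ hAm hAb (P := P)
    (fun t ht => (hP t ht).1) (R' := C * B) (fun t ht => (hP t ht).2.1)
  refine ⟨hi1, hi2,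
    ((hc.hasDerivAt_setIntegral_time h hδ hd hΩ hctt).add hB).congr_of_eventuallyEq ?_⟩
  filter_upwards [h.mem_nhds h.zero_mem] with t ht
  obtain ⟨hPm, hPb, hPd⟩ := hP t ht
  rw [(hc.hasDerivAt_volumeIntegral h hδ hΩ ht).deriv]
  refine hc.setIntegral_deriv_eq h hδ hd hΩ ht
    (aestronglyMeasurable_const.add ((hAm.const_smul t).add hPm))
    (R := 1 + (|t| * R + C * B * |t| ^ 2)) ?_ ?_
  · filter_upwards [hAb] with x hx
    refine (norm_add_le _ _).trans (add_le_add ContinuousLinearMap.norm_id_le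
      ((norm_add_le _ _).trans (add_le_add ?_ (hPb x))))
    rw [norm_smul, Real.norm_eq_abs]
    gcongr
  · filter_upwards [hA, hPd] with x hx hx'
    have e : Θ t = fun y => id y + (t • V 0 y + E t y) := funext fun y => h.eq_add t y
    rw [e]
    exact (hasFDerivWithinAt_id x _).add ((hx.const_smul t).add hx')

end IsDensityExtension

end

end

end Liouville

theorem mainTheorem9 (d : ℕ) (hd : 2 ≤ d) (Ω : Set (Liouville.Space d))
    (hΩ : Liouville.IsBoundedLipschitzDomain Ω)
    (ε : ℝ) (hε : 0 < ε) (T : ℝ → Liouville.Space d → Liouville.Space d)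
    (hT : Liouville.IsTwiceDifferentiableFamily Ω ε T)
    (c : Liouville.Space d × ℝ → ℝ)
    (hc : Liouville.IsC11 (Liouville.spaceTime Ω ε T) c)
    (hctt : Liouville.HasContinuousTimeDerivTwo (Liouville.spaceTime Ω ε T) c) :
    (∃ A, Liouville.IsBoundaryJacobian Ω (Liouville.velocity Ω T) A) ∧
    ∀ A, Liouville.IsBoundaryJacobian Ω (Liouville.velocity Ω T) A →
      (∀ᶠ t in 𝓝 (0 : ℝ), IntegrableOn (fun x => c (x, t)) (T t '' Ω) ∧
        DifferentiableAt ℝ (Liouville.volumeIntegral Ω T c) t) ∧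
      IntegrableOn (Liouville.timeDerivTwo c) Ω ∧
      Integrable (fun x => (2 * Liouville.timeDeriv (Liouville.spaceTime Ω ε T) c x +
          Liouville.divProduct (Liouville.spaceTime Ω ε T) c (Liouville.velocity Ω T) A x) *
        Liouville.deltaRho Ω T x) (Liouville.surfaceMeasure Ω) ∧
      Integrable (fun x => c (x, 0) * (Liouville.deltaSqRho Ω T x -
          Liouville.convectiveNormal Ω (Liouville.velocity Ω T) A x))
        (Liouville.surfaceMeasure Ω) ∧
      HasDerivAt (deriv (Liouville.volumeIntegral Ω T c))
        ((∫ x in Ω, Liouville.timeDerivTwo c x) +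
          (∫ x, (2 * Liouville.timeDeriv (Liouville.spaceTime Ω ε T) c x +
              Liouville.divProduct (Liouville.spaceTime Ω ε T) c (Liouville.velocity Ω T) A x) *
            Liouville.deltaRho Ω T x ∂(Liouville.surfaceMeasure Ω)) +
          ∫ x, c (x, 0) * (Liouville.deltaSqRho Ω T x -
              Liouville.convectiveNormal Ω (Liouville.velocity Ω T) A x)
            ∂(Liouville.surfaceMeasure Ω)) 0 := by
  obtain ⟨δ, hδ, B, Θ, V, E, h⟩ := hT.exists_extension hΩ hε
  obtain ⟨G, L, hG⟩ := hc.exists_extension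
  refine ⟨h.exists_isBoundaryJacobian hd hΩ, fun A hA => ?_⟩
  obtain ⟨R, hR⟩ := hA.ae_norm_le
  have hAV : ∀ᵐ x ∂(Liouville.surfaceMeasure Ω),
      HasFDerivWithinAt (V 0) (A x) (frontier Ω) x := by
    filter_upwards [hA.hasFDerivWithinAt, Liouville.surfaceMeasure_frontier_compl Ω] with x hx hxf
    exact hx.congr (fun y hy => (h.velocity_eq (frontier_subset_closure hy)).symm)
      (h.velocity_eq (frontier_subset_closure hxf)).symm
  obtain ⟨hi1, hi2, hder⟩ :=
    hG.hasDerivAt_deriv_volumeIntegral h hδ hd hΩ hctt hA.memLp.aestronglyMeasurable hR hAV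
  obtain ⟨C, hC, hcb, hGb, -⟩ := hG.exists_bounds h hδ hΩ.isBounded
  have hmem : ∀ x ∈ closure Ω, (x, (0 : ℝ)) ∈ closure (Liouville.spaceTime Ω ε T) := by
    intro x hx
    have := h.mapsTo_closure hδ h.zero_mem hx
    simpa only [h.zero] using this
  have hcc : ContinuousOn (fun x => c (x, 0)) (closure Ω) := by
    have := hG.continuousOn_comp h hδ h.zero_mem
    simpa only [h.zero] using this
  have hmeas : ∀ {F : Type} [NormedAddCommGroup F] {k : Liouville.Space d → F},
      ContinuousOn k (closure Ω) → AEStronglyMeasurable k (Liouville.surfaceMeasure Ω) :=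
    fun hk => (hk.mono frontier_subset_closure).aestronglyMeasurable
      isClosed_frontier.measurableSet
  have hV := (h.lipschitz_V 0 h.zero_mem).continuous
  obtain ⟨a, ha⟩ := hΩ.isCompact_closure.exists_bound_of_continuousOn h.continuousOn_acceleration
  -- The last integrand, and the part of the first one that comes from the interior term.
  have hf2 : Integrable (fun x => c (x, 0) * (Liouville.deltaSqRho Ω T x -
      Liouville.convectiveNormal Ω (Liouville.velocity Ω T) A x))
      (Liouville.surfaceMeasure Ω) := by
    refine (Liouville.integrable_inner_outerNormal hd hΩ
      (W := fun x => c (x, 0) • (Liouville.acceleration Ω T x - A x (V 0 x)))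
      ((hmeas hcc).smul ((hmeas h.continuousOn_acceleration).sub
        (isBoundedBilinearMap_apply.continuous.comp_aestronglyMeasurable
          (hA.memLp.aestronglyMeasurable.prodMk hV.aestronglyMeasurable))))
      (R := C * (a + R * B)) ?_).congr ?_
    · filter_upwards [hR, Liouville.surfaceMeasure_frontier_compl Ω] with x hx hxf
      have hxc := frontier_subset_closure hxf
      have h1 := hcb 0 h.zero_mem x hxc
      rw [h.zero] at h1
      rw [norm_smul]
      refine mul_le_mul h1 ((norm_sub_le _ _).trans (add_le_add (ha x hxc)
        (((A x).le_opNorm _).trans ?_))) (norm_nonneg _) hC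
      exact mul_le_mul hx (h.norm_V_le 0 h.zero_mem x hxc) (norm_nonneg _)
        ((norm_nonneg _).trans hx)
    · filter_upwards [Liouville.surfaceMeasure_frontier_compl Ω] with x hxf
      rw [Liouville.deltaSqRho, Liouville.convectiveNormal,
        h.velocity_eq (frontier_subset_closure hxf), real_inner_smul_left, inner_sub_left]
  have hp : Integrable (fun x => G (x, 0) (0, 1) * ⟪V 0 x, Liouville.outerNormal Ω x⟫)
      (Liouville.surfaceMeasure Ω) := by
    refine (Liouville.integrable_inner_outerNormal hd hΩ
      (W := fun x => G (x, 0) (0, 1) • V 0 x)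
      ((hG.lipschitz_apply_time.continuous.smul hV).aestronglyMeasurable)
      (R := C * B) ?_).congr ?_
    · filter_upwards [Liouville.surfaceMeasure_frontier_compl Ω] with x hxf
      have hxc := frontier_subset_closure hxf
      have h1 := hGb 0 h.zero_mem x hxc
      rw [h.zero] at h1
      rw [norm_smul]
      exact mul_le_mul (Liouville.IsDensityExtension.abs_apply_time_le _ h1)
        (h.norm_V_le 0 h.zero_mem x hxc) (norm_nonneg _) hC
    · exact Eventually.of_forall fun x => real_inner_smul_left _ _ _
  -- Here `detDeriv 1 (A x)` is the trace of `A x`. The two copies of `c_t S · ν` come from the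
  -- interior term and from the time derivative of `c V t` in the boundary term.
  have hsum : (fun x => G (x, 0) (0, 1) * ⟪V 0 x, Liouville.outerNormal Ω x⟫
        + (⟪Liouville.outerNormal Ω x, c (x, 0) • Liouville.acceleration Ω T x
            + G (x, 0) (V 0 x, 1) • V 0 x⟫
          + (Liouville.detDeriv 1 (A x) * ⟪Liouville.outerNormal Ω x, c (x, 0) • V 0 x⟫
            - ⟪Liouville.outerNormal Ω x, A x (c (x, 0) • V 0 x)⟫)))
      =ᵐ[Liouville.surfaceMeasure Ω] fun x =>
        (2 * Liouville.timeDeriv (Liouville.spaceTime Ω ε T) c x +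
          Liouville.divProduct (Liouville.spaceTime Ω ε T) c (Liouville.velocity Ω T) A x) *
          Liouville.deltaRho Ω T x
        + c (x, 0) * (Liouville.deltaSqRho Ω T x -
          Liouville.convectiveNormal Ω (Liouville.velocity Ω T) A x) := by
    filter_upwards [Liouville.surfaceMeasure_frontier_compl Ω] with x hxf
    have hxc := frontier_subset_closure hxf
    have hsplit : (V 0 x, (1 : ℝ)) = (V 0 x, 0) + (0, 1) := by simp
    rw [Liouville.timeDeriv, Liouville.divProduct, Liouville.spaceDeriv, Liouville.deltaRho,
      Liouville.deltaSqRho, Liouville.convectiveNormal, hG.extendFrom_eq _ (hmem x hxc),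
      h.velocity_eq hxc, ← Liouville.detDeriv_one, hsplit, map_add, map_smul, inner_add_right,
      real_inner_smul_right, real_inner_smul_right, real_inner_smul_right, real_inner_smul_right,
      real_inner_comm (Liouville.outerNormal Ω x) (V 0 x),
      real_inner_comm (Liouville.outerNormal Ω x) (Liouville.acceleration Ω T x),
      real_inner_comm (Liouville.outerNormal Ω x) (A x (V 0 x))]
    ring
  have hf1 : Integrable (fun x => (2 * Liouville.timeDeriv (Liouville.spaceTime Ω ε T) c x +
      Liouville.divProduct (Liouville.spaceTime Ω ε T) c (Liouville.velocity Ω T) A x) *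
      Liouville.deltaRho Ω T x) (Liouville.surfaceMeasure Ω) := by
    refine ((((hp.add (hi1.add hi2)).congr hsum).sub hf2).congr
      (Eventually.of_forall fun x => ?_))
    simp
  refine ⟨?_, Liouville.IsDensityExtension.integrableOn_timeDerivTwo h hδ hΩ hctt, hf1, hf2, ?_⟩
  · filter_upwards [h.mem_nhds h.zero_mem] with t ht
    exact ⟨hG.integrableOn_image h hδ hΩ ht,
      (hG.hasDerivAt_volumeIntegral h hδ hΩ ht).differentiableAt⟩
  · have h12 : Integrable (fun x => ⟪Liouville.outerNormal Ω x,
        c (x, 0) • Liouville.acceleration Ω T x + G (x, 0) (V 0 x, 1) • V 0 x⟫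
          + (Liouville.detDeriv 1 (A x) * ⟪Liouville.outerNormal Ω x, c (x, 0) • V 0 x⟫
            - ⟪Liouville.outerNormal Ω x, A x (c (x, 0) • V 0 x)⟫))
        (Liouville.surfaceMeasure Ω) := hi1.add hi2
    rwa [← integral_add hi1 hi2, add_assoc, ← integral_add hp h12, integral_congr_ae hsum,
      integral_add hf1 hf2, ← add_assoc] at hder
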